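/- Let $d\ge 1$, $L,\beta,\hbar,m_0>0$, $\Lambda=(-L/2,L/2]^d$ and $\lambda_t=\sqrt{2\pi\hbar^2t/m_0}$. Let $u:\mathbb R^d\to\mathbb R$ be an even pair potential, and suppose that $\hat u(k)=\int e^{-2\pi i k\cdot x}u(x)\,dx$ exists (i.e. $u$ is integrable) and is integrable, and that $\sum_{z\in\mathbb Z^d}|\hat u(z/L)|<\infty$. Put $u_L(x)=\sum_{z\in\mathbb Z^d}u(x+Lz)$. Let $P^t_{xy}$ be the Wiener measure on continuous trajectories in $\mathbb R^d$ from $x$ (time $0$) to $y$ (time $t$), of total mass $\lambda_t^{-d}e^{-\pi|y-x|^2/\lambda_t^2}$, i.e. this mass times the law of the Brownian bridge from $x$ to $y$ whose coordinates are independent with covariance $\frac{\hbar^2}{m_0}(\min(s,s')-ss'/t)$, and let $W^t_{xy}=\sum_{z\in\mathbb Z^d}P^t_{x,y+Lz}$. For trajectories $\omega,\omega'$ of time lengths $n\beta,n'\beta$ let $$U(\omega)=\beta^{-1}\int_0^\beta\sum_{0\le j<k\le n-1}u_L(\omega(k\beta+t)-\omega(j\beta+t))\,dt,\qquad U(\omega',\omega)=\beta^{-1}\int_0^\beta\sum_{j=0}^{n'-1}\sum_{k=0}^{n-1}u_L(\omega(k\beta+t)-\omega'(j\beta+t))\,dt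 .$$ For $p\ge0$, integers $n_0,\dots,n_p\ge1$ and $x\in\mathbb R^d$ let $$G[\{n_l\}_0^p](x)=\prod_{l=1}^p\int_\Lambda dx_l\int W^{n_l\beta}_{x_lx_l}(d\omega_l)\;L^d\int W^{n_0\beta}_{0x}(d\omega_0)\prod_{l=0}^pe^{-\beta U(\omega_l)}\prod_{0\le l'<l\le p}e^{-\beta U(\omega_{l'},\omega_l)} .$$ Let $N_{-1}=0$, $N_l=\sum_{l'=0}^l n_{l'}$, $N=N_p$, $C_l=\{N_{l-1}+1,\dots,N_l\}$. Then $$G[\{n_l\}_0^p](x)=e^{-\beta\hat u(0)N(N-1)/(2L^d)}\sum_{\{\alpha^k_j\in\mathbb N_0\,|\,1\le j<k\le N\}}\ \prod_{1\le j<k\le N}\frac1{\alpha^k_j!}\prod_{r=1}^{\alpha^k_j}\frac{-\beta}{L^d}\sum_{z^k_{j,r}\in\mathbb Z^d\setminus\{0\}}\hat u\Big(\frac{z^k_{j,r}}L\Big)\int_0^1dt^k_{j,r}$$ $$\Big[\delta_{Z^0_1,0}\sum_{z\in\mathbb Z^d}e^{-\frac{\pi\lambda_\beta^2}{L^2}\sum_{q\in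 C_0}\int_0^1[z+Z_q(t)]^2dt}\cos\Big(\frac{2\pi}Lz\cdot x\Big)\ \prod_{l=1}^p\delta_{Z^l_1,0}\sum_{z\in\mathbb Z^d}e^{-\frac{\pi\lambda_\beta^2}{L^2}\sum_{q\in C_l}\int_0^1[z+Z_q(t)]^2dt}\Big],$$ where the bracket is under all the summations and integrals, the sum over all the $z^k_{j,r}$ for given $\{\alpha^k_j\}$ and the sum over $\{\alpha^k_j\}$ converge absolutely, and for $q\in C_l$ $$Z_q(t)=-\sum_{j=1}^{q-1}\sum_{k=q}^{N_l}\sum_{r=1}^{\alpha^k_j}\mathbf 1_{\{t^k_{j,r}\ge t\}}z^k_{j,r}+\sum_{j=q}^{N_l}\sum_{k=N_l+1}^{N}\sum_{r=1}^{\alpha^k_j}\mathbf 1_{\{t^k_{j,r}\ge t\}}z^k_{j,r}-\sum_{j=1}^{q}\sum_{k=q+1}^{N_l}\sum_{r=1}^{\alpha^k_j}\mathbf 1_{\{t^k_{j,r}<t\}}z^k_{j,r}+\sum_{j=q+1}^{N_l}\sum_{k=N_l+1}^{N}\sum_{r=1}^{\alpha^k_j}\mathbf 1_{\{t^k_{j,r}<t\}}z^k_{j,r}.$$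 In particular $$Z^l_1:=Z_{N_{l-1}+1}(0)=-\sum_{j=1}^{N_{l-1}}\sum_{k\in C_l}\sum_{r=1}^{\alpha^k_j}z^k_{j,r}+\sum_{j\in C_l}\sum_{k=N_l+1}^N\sum_{r=1}^{\alpha^k_j}z^k_{j,r}.$$ -/

import Mathlib

namespace TorusBose

open MeasureTheory ProbabilityTheory

/-! ### Brownian bridges -/

/-- The tent function on `[0, 1]`, zero outside. -/
noncomputable def tent (r : ℝ) : ℝ := max 0 (1 / 2 - |r - 1 / 2|)

/-- Truncation of a real number to `[0, 1]`. -/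
noncomputable def clamp (r : ℝ) : ℝ := max 0 (min r 1)

/-- Covariance of the standard Brownian bridge on `[0, 1]`, zero outside. -/
noncomputable def bridgeCov (a b : ℝ) : ℝ := min (clamp a) (clamp b) - clamp a * clamp b

/-- The Schauder function number `k` of level `n`. -/
noncomputable def schauder (n k : ℕ) (s : ℝ) : ℝ := ((√2)⁻¹) ^ n * tent (2 ^ n * s - k)

lemma clamp_cases (a : ℝ) :
    (a ≤ 0 ∧ clamp a = 0 ∧ clamp (2 * a) = 0 ∧ clamp (2 * a - 1) = 0 ∧ tent a = 0) ∨
    (0 < a ∧ a ≤ 1 / 2 ∧ clamp a = a ∧ clamp (2 * a) = 2 * a ∧ clamp (2 * a - 1) = 0 ∧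
      tent a = a) ∨
    (1 / 2 < a ∧ a < 1 ∧ clamp a = a ∧ clamp (2 * a) = 1 ∧ clamp (2 * a - 1) = 2 * a - 1 ∧
      tent a = 1 - a) ∨
    (1 ≤ a ∧ clamp a = 1 ∧ clamp (2 * a) = 1 ∧ clamp (2 * a - 1) = 1 ∧ tent a = 0) := by
  unfold clamp tent
  rcases le_or_gt a 0 with h | h
  · left
    grind
  rcases le_or_gt a (1/2) with h' | h'
  · right; left
    grind
  rcases lt_or_ge a 1 with h'' | h''
  · right; right; left
    grind
  · right; right; right
    grind

lemma bridgeCov_rec (a b : ℝ) :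
    bridgeCov a b = tent a * tent b +
      1 / 2 * (bridgeCov (2 * a) (2 * b) + bridgeCov (2 * a - 1) (2 * b - 1)) := by
  unfold bridgeCov
  rcases clamp_cases a with ⟨h0, h1, h2, h3, h4⟩ | ⟨h0, h0', h1, h2, h3, h4⟩ |
    ⟨h0, h0', h1, h2, h3, h4⟩ | ⟨h0, h1, h2, h3, h4⟩ <;>
  rcases clamp_cases b with ⟨k0, k1, k2, k3, k4⟩ | ⟨k0, k0', k1, k2, k3, k4⟩ |
    ⟨k0, k0', k1, k2, k3, k4⟩ | ⟨k0, k1, k2, k3, k4⟩ <;>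
  rw [h1, h2, h3, h4, k1, k2, k3, k4] <;>
  rcases le_total a b with h | h <;>
  grind

lemma tent_nonneg (a : ℝ) : 0 ≤ tent a := le_max_left _ _

lemma tent_le_one (a : ℝ) : tent a ≤ 1 := by
  unfold tent
  have := abs_nonneg (a - 1 / 2)
  exact max_le (by norm_num) (by linarith)

lemma tent_eq_zero {a : ℝ} (h : ¬ (0 < a ∧ a < 1)) : tent a = 0 := by
  rcases clamp_cases a with h1 | h1 | h1 | h1 <;> grind

lemma bridgeCov_eq_zero {a b : ℝ} (h : ¬ (0 < a ∧ a < 1)) : bridgeCov a b = 0 := by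
  unfold bridgeCov clamp
  grind

lemma abs_bridgeCov_le (a b : ℝ) : |bridgeCov a b| ≤ 1 := by
  have h (r : ℝ) : 0 ≤ clamp r ∧ clamp r ≤ 1 := by unfold clamp; grind
  obtain ⟨h1, h2⟩ := h a
  obtain ⟨h3, h4⟩ := h b
  unfold bridgeCov
  rw [abs_le]
  rcases min_choice (clamp a) (clamp b) with h | h <;> rw [h] <;> constructor <;> nlinarith

lemma norm_sum_le_of_one_cell {F : Type*} [NormedAddCommGroup F] (f : ℕ → F) (B r : ℝ) (m : ℕ)
    (hB : 0 ≤ B) (h : ∀ k < m, ‖f k‖ ≤ B) (h0 : ∀ k : ℕ, ¬ (0 < r - k ∧ r - k < 1) → f k = 0) :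
    ‖∑ k ∈ Finset.range m, f k‖ ≤ B := by
  by_cases hk : ∃ k ∈ Finset.range m, 0 < r - (k : ℕ) ∧ r - k < 1
  · obtain ⟨k, hk, h1, h2⟩ := hk
    rw [Finset.sum_eq_single_of_mem k hk]
    · exact h k (Finset.mem_range.1 hk)
    · intro j _ hj
      apply h0
      rintro ⟨h3, h4⟩
      apply hj
      have h5 : (j : ℝ) < k + 1 := by linarith
      have h6 : (k : ℝ) < j + 1 := by linarith
      norm_cast at h5 h6
      omega
  · rw [Finset.sum_eq_zero]
    · simpa using hB
    · intro k hk'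
      exact h0 k fun h => hk ⟨k, hk', h⟩

lemma sum_range_pairs (f : ℕ → ℝ) (m : ℕ) :
    ∑ k ∈ Finset.range (2 * m), f k = ∑ k ∈ Finset.range m, (f (2 * k) + f (2 * k + 1)) := by
  induction m with
  | zero => simp
  | succ m ih =>
    rw [show 2 * (m + 1) = 2 * m + 1 + 1 by ring, Finset.sum_range_succ, Finset.sum_range_succ, ih,
      Finset.sum_range_succ]
    ring

lemma schauder_telescope (s s' : ℝ) (M : ℕ) :
    ∑ n ∈ Finset.range M, ∑ k ∈ Finset.range (2 ^ n), schauder n k s * schauder n k s' =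
      bridgeCov s s' - (1 / 2) ^ M * ∑ k ∈ Finset.range (2 ^ M),
        bridgeCov (2 ^ M * s - k) (2 ^ M * s' - k) := by
  induction M with
  | zero => simp
  | succ M ih =>
    rw [Finset.sum_range_succ, ih, pow_succ' (2 : ℕ) M, pow_succ' (2 : ℝ) M, sum_range_pairs]
    have h2 : ((√2)⁻¹ ^ M) * ((√2)⁻¹ ^ M) = (1 / 2 : ℝ) ^ M := by
      rw [← mul_pow, ← mul_inv, Real.mul_self_sqrt (by norm_num)]
      norm_num
    have h3 : ∑ k ∈ Finset.range (2 ^ M), bridgeCov (2 ^ M * s - k) (2 ^ M * s' - k) =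
        ∑ k ∈ Finset.range (2 ^ M), tent (2 ^ M * s - k) * tent (2 ^ M * s' - k) +
        1 / 2 * ∑ k ∈ Finset.range (2 ^ M),
          (bridgeCov (2 * 2 ^ M * s - (2 * k : ℕ)) (2 * 2 ^ M * s' - (2 * k : ℕ)) +
          bridgeCov (2 * 2 ^ M * s - (2 * k + 1 : ℕ)) (2 * 2 ^ M * s' - (2 * k + 1 : ℕ))) := by
      rw [Finset.mul_sum, ← Finset.sum_add_distrib]
      refine Finset.sum_congr rfl fun k _ => ?_
      rw [bridgeCov_rec]
      push_cast
      congr 4 <;> ring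
    have h4 : ∑ k ∈ Finset.range (2 ^ M), schauder M k s * schauder M k s' =
        (1 / 2) ^ M * ∑ k ∈ Finset.range (2 ^ M),
          tent (2 ^ M * s - k) * tent (2 ^ M * s' - k) := by
      rw [Finset.mul_sum]
      refine Finset.sum_congr rfl fun k _ => ?_
      rw [← h2]
      unfold schauder
      ring
    generalize ∑ k ∈ Finset.range (2 ^ M), tent (2 ^ M * s - k) * tent (2 ^ M * s' - k) = A at h3 h4
    generalize ∑ k ∈ Finset.range (2 ^ M),
      (bridgeCov (2 * 2 ^ M * s - (2 * k : ℕ)) (2 * 2 ^ M * s' - (2 * k : ℕ)) +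
      bridgeCov (2 * 2 ^ M * s - (2 * k + 1 : ℕ)) (2 * 2 ^ M * s' - (2 * k + 1 : ℕ))) = B at h3 ⊢
    rw [h3, h4, pow_succ]
    ring

lemma tendsto_schauder_cov (s s' : ℝ) :
    Filter.Tendsto (fun M => ∑ n ∈ Finset.range M, ∑ k ∈ Finset.range (2 ^ n),
      schauder n k s * schauder n k s') Filter.atTop (nhds (bridgeCov s s')) := by
  simp_rw [schauder_telescope]
  rw [show nhds (bridgeCov s s') = nhds (bridgeCov s s' - 0) by rw [sub_zero]]
  refine tendsto_const_nhds.sub ?_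
  refine squeeze_zero_norm (a := fun M => (1 / 2 : ℝ) ^ M) (fun M => ?_)
    (tendsto_pow_atTop_nhds_zero_of_lt_one (by norm_num) (by norm_num))
  rw [norm_mul, norm_pow]
  have : ‖∑ k ∈ Finset.range (2 ^ M), bridgeCov (2 ^ M * s - k) (2 ^ M * s' - k)‖ ≤ 1 :=
    norm_sum_le_of_one_cell _ 1 (2 ^ M * s) _ zero_le_one (fun k _ => abs_bridgeCov_le _ _)
      (fun k hk => bridgeCov_eq_zero hk)
  calc ‖(1 / 2 : ℝ)‖ ^ M * _ ≤ ‖(1 / 2 : ℝ)‖ ^ M * 1 := by gcongr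
    _ = (1 / 2) ^ M := by norm_num

/-- Level `n` of the Lévy–Ciesielski expansion of a Brownian bridge on `[0, 1]`. -/
noncomputable def bridgeLevel {d : ℕ} (ξ : ℕ × ℕ → EuclideanSpace ℝ (Fin d)) (n : ℕ) (s : ℝ) :
    EuclideanSpace ℝ (Fin d) :=
  ∑ k ∈ Finset.range (2 ^ n), schauder n k s • ξ (n, k)

lemma continuous_bridgeLevel {d : ℕ} (ξ : ℕ × ℕ → EuclideanSpace ℝ (Fin d)) (n : ℕ) :
    Continuous (bridgeLevel ξ n) := by
  unfold bridgeLevel schauder tent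
  fun_prop

/-- A weighted sum of moments that controls the Gaussian coefficients. -/
noncomputable def bridgeBound {d : ℕ} (ξ : ℕ × ℕ → EuclideanSpace ℝ (Fin d)) : ENNReal :=
  ∑' n : ℕ, ∑ k ∈ Finset.range (2 ^ n), (1 / 4 : ENNReal) ^ n * ‖ξ (n, k)‖ₑ ^ 8

lemma measurable_bridgeBound {d : ℕ} :
    Measurable (bridgeBound (d := d)) := by
  unfold bridgeBound
  refine Measurable.tsum fun n => ?_
  refine Finset.measurable_sum _ fun k _ => ?_
  fun_prop

/-- The law of independent standard Gaussian vectors. -/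
noncomputable def gaussianSeq (d : ℕ) : Measure (ℕ × ℕ → EuclideanSpace ℝ (Fin d)) :=
  Measure.infinitePi fun _ => stdGaussian (EuclideanSpace ℝ (Fin d))

instance (d : ℕ) : IsProbabilityMeasure (gaussianSeq d) := by
  unfold gaussianSeq; infer_instance

lemma bridgeBound_lt_top (d : ℕ) : ∀ᵐ ξ ∂gaussianSeq d, bridgeBound ξ < ⊤ := by
  refine ae_lt_top measurable_bridgeBound ?_
  unfold bridgeBound
  have hC : ∫⁻ v, ‖v‖ₑ ^ 8 ∂stdGaussian (EuclideanSpace ℝ (Fin d)) ≠ ⊤ := by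
    have h := (IsGaussian.memLp_id (stdGaussian (EuclideanSpace ℝ (Fin d))) 8
      (by norm_num)).eLpNorm_lt_top
    have h2 := (eLpNorm_lt_top_iff_lintegral_rpow_enorm_lt_top (by norm_num) (by norm_num)).1 h
    have h3 : (8 : ENNReal).toReal = (8 : ℕ) := by norm_num
    simp_rw [h3, ENNReal.rpow_natCast, id] at h2
    exact h2.ne
  set C := ∫⁻ v, ‖v‖ₑ ^ 8 ∂stdGaussian (EuclideanSpace ℝ (Fin d)) with hCdef
  rw [lintegral_tsum fun n => (Finset.measurable_sum _ fun k _ => by fun_prop).aemeasurable]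
  have h1 (n : ℕ) : ∫⁻ ξ, ∑ k ∈ Finset.range (2 ^ n), (1 / 4 : ENNReal) ^ n * ‖ξ (n, k)‖ₑ ^ 8
      ∂gaussianSeq d = (1 / 2 : ENNReal) ^ n * C := by
    rw [lintegral_finsetSum _ fun k _ => by fun_prop]
    have h2 (k : ℕ) : ∫⁻ ξ, (1 / 4 : ENNReal) ^ n * ‖ξ (n, k)‖ₑ ^ 8 ∂gaussianSeq d =
        (1 / 4 : ENNReal) ^ n * C := by
      rw [lintegral_const_mul _ (by fun_prop)]
      congr 1
      exact (measurePreserving_eval_infinitePi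
        (fun _ : ℕ × ℕ => stdGaussian (EuclideanSpace ℝ (Fin d))) (n, k)).lintegral_comp
        (f := fun v => ‖v‖ₑ ^ 8) (by fun_prop)
    simp_rw [h2]
    rw [Finset.sum_const, Finset.card_range, nsmul_eq_mul, ← mul_assoc]
    congr 1
    push_cast
    rw [← mul_pow]
    congr 1
    rw [show (4 : ENNReal) = 2 * 2 by norm_num, one_div, one_div,
      ENNReal.mul_inv (by norm_num) (by norm_num), ← mul_assoc,
      ENNReal.mul_inv_cancel (by norm_num) (by norm_num), one_mul]
  simp_rw [h1]
  rw [ENNReal.tsum_mul_right, ENNReal.tsum_geometric]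
  refine ENNReal.mul_ne_top ?_ hC
  rw [one_div, ENNReal.one_sub_inv_two, inv_inv]
  norm_num

lemma norm_bridgeLevel_le {d : ℕ} {ξ : ℕ × ℕ → EuclideanSpace ℝ (Fin d)} (h : bridgeBound ξ < ⊤) :
    ∃ u : ℕ → ℝ, Summable u ∧ ∀ n s, ‖bridgeLevel ξ n s‖ ≤ u n := by
  set C : ℝ := (bridgeBound ξ).toReal with hC
  have hC0 : 0 ≤ C := ENNReal.toReal_nonneg
  have h1 (n k : ℕ) (hk : k < 2 ^ n) : ‖ξ (n, k)‖ ^ 8 ≤ 4 ^ n * C := by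
    have h2 : (1 / 4 : ENNReal) ^ n * ‖ξ (n, k)‖ₑ ^ 8 ≤ bridgeBound ξ :=
      le_trans (Finset.single_le_sum
        (f := fun k => (1 / 4 : ENNReal) ^ n * ‖ξ (n, k)‖ₑ ^ 8) (fun _ _ => zero_le)
        (Finset.mem_range.2 hk)) (ENNReal.le_tsum n)
    have h3 := ENNReal.toReal_mono h.ne h2
    rw [ENNReal.toReal_mul, ENNReal.toReal_pow, ENNReal.toReal_pow, toReal_enorm, ← hC] at h3
    simp only [one_div, ENNReal.toReal_inv, ENNReal.toReal_ofNat] at h3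
    rw [inv_pow, inv_mul_le_iff₀ (by positivity)] at h3
    exact h3
  set a : ℝ := (4 : ℝ) ^ (1 / 8 : ℝ) with ha
  have ha0 : 0 < a := by positivity
  have ha8 : a ^ 8 = 4 := by
    rw [ha, ← Real.rpow_natCast, ← Real.rpow_mul (by norm_num)]
    norm_num
  set c : ℝ := C ^ (1 / 8 : ℝ) with hc
  have hc0 : 0 ≤ c := by positivity
  have hc8 : c ^ 8 = C := by
    rw [hc, ← Real.rpow_natCast, ← Real.rpow_mul hC0]
    norm_num
  have h4 (n k : ℕ) (hk : k < 2 ^ n) : ‖ξ (n, k)‖ ≤ a ^ n * c := by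
    refine le_of_pow_le_pow_left₀ (n := 8) (by norm_num) (by positivity) ?_
    rw [mul_pow, hc8, ← pow_mul, mul_comm n 8, pow_mul, ha8]
    exact h1 n k hk
  have hlt : (√2)⁻¹ * a < 1 := by
    refine lt_of_pow_lt_pow_left₀ 8 (by norm_num) ?_
    rw [mul_pow, ha8, inv_pow, show √2 ^ 8 = (√2 ^ 2) ^ 4 by ring, Real.sq_sqrt (by norm_num)]
    norm_num
  refine ⟨fun n => ((√2)⁻¹ * a) ^ n * c,
    (summable_geometric_of_lt_one (by positivity) hlt).mul_right c, fun n s => ?_⟩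
  unfold bridgeLevel
  refine norm_sum_le_of_one_cell _ _ (2 ^ n * s) _ (by positivity) (fun k hk => ?_) fun k hk => ?_
  · beta_reduce
    rw [norm_smul, mul_pow, mul_assoc]
    unfold schauder
    rw [norm_mul, Real.norm_of_nonneg (tent_nonneg _), Real.norm_of_nonneg (by positivity),
      mul_assoc]
    refine mul_le_mul_of_nonneg_left ?_ (by positivity)
    calc tent (2 ^ n * s - k) * ‖ξ (n, k)‖ ≤ 1 * (a ^ n * c) :=
          mul_le_mul (tent_le_one _) (h4 n k hk) (norm_nonneg _) zero_le_one
      _ = _ := one_mul _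
  · unfold schauder
    rw [tent_eq_zero hk]
    simp

/-- The Lévy–Ciesielski series of a standard Brownian bridge on `[0, 1]`. -/
noncomputable def bridgeSeries {d : ℕ} (ξ : ℕ × ℕ → EuclideanSpace ℝ (Fin d)) (s : ℝ) :
    EuclideanSpace ℝ (Fin d) :=
  ∑' n, bridgeLevel ξ n s

lemma continuous_bridgeSeries {d : ℕ} {ξ : ℕ × ℕ → EuclideanSpace ℝ (Fin d)}
    (h : bridgeBound ξ < ⊤) : Continuous (bridgeSeries ξ) := by
  obtain ⟨u, hu, hle⟩ := norm_bridgeLevel_le h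
  exact continuous_tsum (fun n => continuous_bridgeLevel ξ n) hu hle

lemma tendsto_bridgeSeries {d : ℕ} {ξ : ℕ × ℕ → EuclideanSpace ℝ (Fin d)}
    (h : bridgeBound ξ < ⊤) (s : ℝ) :
    Filter.Tendsto (fun M => ∑ n ∈ Finset.range M, bridgeLevel ξ n s) Filter.atTop
      (nhds (bridgeSeries ξ s)) := by
  obtain ⟨u, hu, hle⟩ := norm_bridgeLevel_le h
  exact (Summable.of_norm_bounded hu fun n => hle n s).hasSum.tendsto_sum_nat

lemma integral_exp_gaussianSeq {d : ℕ} (F : Finset (ℕ × ℕ))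
    (a : ℕ × ℕ → EuclideanSpace ℝ (Fin d)) :
    ∫ ξ, Complex.exp (((∑ i ∈ F, inner ℝ (ξ i) (a i) : ℝ) : ℂ) * Complex.I) ∂gaussianSeq d =
      Complex.exp ((-(∑ i ∈ F, ‖a i‖ ^ 2) / 2 : ℝ) : ℂ) := by
  have h1 (ξ : ℕ × ℕ → EuclideanSpace ℝ (Fin d)) :
      Complex.exp (((∑ i ∈ F, inner ℝ (ξ i) (a i) : ℝ) : ℂ) * Complex.I) =
      (fun y : (i : F) → EuclideanSpace ℝ (Fin d) =>
        ∏ i : F, Complex.exp (((inner ℝ (y i) (a i) : ℝ) : ℂ) * Complex.I)) (F.restrict ξ) := by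
    rw [← Finset.sum_coe_sort, Complex.ofReal_sum, Finset.sum_mul, Complex.exp_sum]
    rfl
  refine (integral_congr_ae (Filter.Eventually.of_forall h1)).trans ?_
  unfold gaussianSeq
  refine (integral_restrict_infinitePi (X := fun _ : ℕ × ℕ => EuclideanSpace ℝ (Fin d))
    (μ := fun _ => stdGaussian (EuclideanSpace ℝ (Fin d))) (s := F) (f := fun y : (i : F) → EuclideanSpace ℝ (Fin d) =>
        ∏ i : F, Complex.exp (((inner ℝ (y i) (a i) : ℝ) : ℂ) * Complex.I)) ?_).trans ?_
  rotate_left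
  · rw [integral_fintype_prod_eq_prod
      (fun (i : F) (v : EuclideanSpace ℝ (Fin d)) =>
        Complex.exp (((inner ℝ v (a i) : ℝ) : ℂ) * Complex.I))]
    simp_rw [← charFun_apply, charFun_stdGaussian]
    rw [← Complex.exp_sum, Finset.sum_coe_sort F fun i => -((‖a i‖ : ℝ) : ℂ) ^ 2 / 2]
    congr 1
    push_cast
    rw [← Finset.sum_div, Finset.sum_neg_distrib]
  · refine Continuous.aestronglyMeasurable ?_
    fun_prop

lemma integral_exp_bridgePartial {d m : ℕ} (s : Fin m → ℝ) (c : Fin m → EuclideanSpace ℝ (Fin d))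
    (M : ℕ) :
    ∫ ξ, Complex.exp (((∑ j, inner ℝ (c j)
        (∑ n ∈ Finset.range M, bridgeLevel ξ n (s j)) : ℝ) : ℂ) * Complex.I) ∂gaussianSeq d =
      Complex.exp ((-(∑ j, ∑ j', (∑ n ∈ Finset.range M, ∑ k ∈ Finset.range (2 ^ n),
        schauder n k (s j) * schauder n k (s j')) * inner ℝ (c j) (c j')) / 2 : ℝ) : ℂ) := by
  set F : Finset (ℕ × ℕ) := ((Finset.range M).sigma fun n => Finset.range (2 ^ n)).map
    (Equiv.sigmaEquivProd ℕ ℕ).toEmbedding with hF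
  have hsum (f : ℕ × ℕ → ℝ) : ∑ i ∈ F, f i =
      ∑ n ∈ Finset.range M, ∑ k ∈ Finset.range (2 ^ n), f (n, k) := by
    rw [hF, Finset.sum_map, Finset.sum_sigma]
    rfl
  set a : ℕ × ℕ → EuclideanSpace ℝ (Fin d) := fun i => ∑ j, schauder i.1 i.2 (s j) • c j with ha
  have h1 (ξ : ℕ × ℕ → EuclideanSpace ℝ (Fin d)) :
      ∑ j, inner ℝ (c j) (∑ n ∈ Finset.range M, bridgeLevel ξ n (s j)) =
      ∑ i ∈ F, inner ℝ (ξ i) (a i) := by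
    rw [hsum]
    simp_rw [ha, bridgeLevel, inner_sum, inner_smul_right]
    rw [Finset.sum_comm]
    refine Finset.sum_congr rfl fun n _ => ?_
    rw [Finset.sum_comm]
    refine Finset.sum_congr rfl fun k _ => Finset.sum_congr rfl fun j _ => ?_
    rw [real_inner_comm]
  have h2 : ∑ i ∈ F, ‖a i‖ ^ 2 = ∑ j, ∑ j', (∑ n ∈ Finset.range M, ∑ k ∈ Finset.range (2 ^ n),
        schauder n k (s j) * schauder n k (s j')) * inner ℝ (c j) (c j') := by
    have h3 (i : ℕ × ℕ) : ‖a i‖ ^ 2 = ∑ j, ∑ j', schauder i.1 i.2 (s j) * schauder i.1 i.2 (s j') *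
        inner ℝ (c j) (c j') := by
      rw [← real_inner_self_eq_norm_sq, ha]
      simp_rw [sum_inner, inner_sum, real_inner_smul_left, real_inner_smul_right, mul_assoc]
    have h4 (j j' : Fin m) : ∑ n ∈ Finset.range M, ∑ k ∈ Finset.range (2 ^ n),
        schauder n k (s j) * schauder n k (s j') =
        ∑ i ∈ F, schauder i.1 i.2 (s j) * schauder i.1 i.2 (s j') :=
      (hsum fun i => schauder i.1 i.2 (s j) * schauder i.1 i.2 (s j')).symm
    simp_rw [h3, h4, Finset.sum_mul]
    rw [Finset.sum_comm]
    refine Finset.sum_congr rfl fun j _ => ?_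
    rw [Finset.sum_comm]
  simp_rw [h1]
  rw [integral_exp_gaussianSeq, h2]

lemma measurable_bridgeLevel {d : ℕ} (n : ℕ) (s : ℝ) :
    Measurable fun ξ : ℕ × ℕ → EuclideanSpace ℝ (Fin d) => bridgeLevel ξ n s := by
  unfold bridgeLevel
  fun_prop

lemma integral_exp_bridgeSeries {d m : ℕ} (s : Fin m → ℝ)
    (c : Fin m → EuclideanSpace ℝ (Fin d)) :
    ∫ ξ, Complex.exp (((∑ j, inner ℝ (c j) (bridgeSeries ξ (s j)) : ℝ) : ℂ) * Complex.I)
      ∂gaussianSeq d =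
      Complex.exp ((-(∑ j, ∑ j', bridgeCov (s j) (s j') * inner ℝ (c j) (c j')) / 2 : ℝ) : ℂ) := by
  have h1 := tendsto_integral_of_dominated_convergence (μ := gaussianSeq d)
    (F := fun M ξ => Complex.exp (((∑ j, inner ℝ (c j)
        (∑ n ∈ Finset.range M, bridgeLevel ξ n (s j)) : ℝ) : ℂ) * Complex.I))
    (f := fun ξ => Complex.exp
      (((∑ j, inner ℝ (c j) (bridgeSeries ξ (s j)) : ℝ) : ℂ) * Complex.I))
    (fun _ => 1) (fun M => by
      refine Measurable.aestronglyMeasurable ?_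
      have := fun n j => measurable_bridgeLevel (d := d) n (s j)
      fun_prop) (integrable_const 1) (fun M => Filter.Eventually.of_forall fun ξ => by
        rw [Complex.norm_exp_ofReal_mul_I]) (by
      filter_upwards [bridgeBound_lt_top d] with ξ hξ
      refine (Complex.continuous_exp.tendsto _).comp (Filter.Tendsto.mul_const _ ?_)
      refine (Complex.continuous_ofReal.tendsto _).comp ?_
      refine tendsto_finsetSum _ fun j _ => ?_
      exact Filter.Tendsto.inner tendsto_const_nhds (tendsto_bridgeSeries hξ (s j)))
  refine tendsto_nhds_unique h1 ?_
  simp_rw [integral_exp_bridgePartial]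
  refine (Complex.continuous_exp.tendsto _).comp ((Complex.continuous_ofReal.tendsto _).comp ?_)
  refine Filter.Tendsto.div_const (Filter.Tendsto.neg ?_) _
  exact tendsto_finsetSum _ fun j _ => tendsto_finsetSum _ fun j' _ =>
    (tendsto_schauder_cov (s j) (s j')).mul_const _

/-- Trajectories in `ℝᵈ` over the time interval `[0, T]`. -/
abbrev Trajectory (d : ℕ) (T : ℝ) := C(Set.Icc (0 : ℝ) T, EuclideanSpace ℝ (Fin d))

/-- The σ-algebra on trajectories generated by the evaluations (equivalently, the Borel
σ-algebra of uniform convergence). -/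
instance instMeasurableSpaceTrajectory (d : ℕ) (T : ℝ) : MeasurableSpace (Trajectory d T) :=
  MeasurableSpace.comap (fun ω s => ω s) MeasurableSpace.pi

/-- `μ` is the law of the Brownian bridge in `ℝᵈ` from `x` at time `0` to `y` at time `T`, with
diffusion constant `D`: the Gaussian process with continuous paths, mean
`x + (s / T) (y - x)` and covariance `D (min s s' - s s' / T)` in every coordinate, different
coordinates being independent.  It is given through the characteristic functions of its
finite-dimensional distributions. -/
structure IsBrownianBridge {d : ℕ} (D T : ℝ) (x y : EuclideanSpace ℝ (Fin d))
    (μ : Measure (Trajectory d T)) : Prop where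
  isProbabilityMeasure : IsProbabilityMeasure μ
  charFun_eq : ∀ (m : ℕ) (s : Fin m → Set.Icc (0 : ℝ) T) (c : Fin m → EuclideanSpace ℝ (Fin d)),
    ∫ ω, Complex.exp (((∑ j, inner ℝ (c j) (ω (s j)) : ℝ) : ℂ) * Complex.I) ∂μ =
      Complex.exp (((∑ j, inner ℝ (c j) (x + ((s j : ℝ) / T) • (y - x)) : ℝ) : ℂ) * Complex.I -
        ((D / 2 * ∑ j, ∑ j', (min (s j : ℝ) (s j') - (s j : ℝ) * (s j') / T) *
          inner ℝ (c j) (c j') : ℝ) : ℂ))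

open Classical in
/-- The Brownian bridge trajectory built from a sequence of Gaussian vectors. -/
noncomputable def bridgeTrajectory {d : ℕ} (D T : ℝ) (x y : EuclideanSpace ℝ (Fin d))
    (ξ : ℕ × ℕ → EuclideanSpace ℝ (Fin d)) : Trajectory d T :=
  if h : bridgeBound ξ < ⊤ then
    ⟨fun s => x + ((s : ℝ) / T) • (y - x) + √(D * T) • bridgeSeries ξ ((s : ℝ) / T), by
      have := continuous_bridgeSeries h
      fun_prop⟩
  else 0

lemma measurable_bridgeTrajectory {d : ℕ} (D T : ℝ) (x y : EuclideanSpace ℝ (Fin d)) :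
    Measurable (bridgeTrajectory D T x y) := by
  rw [measurable_comap_iff, measurable_pi_iff]
  intro s
  have hG : MeasurableSet {ξ : ℕ × ℕ → EuclideanSpace ℝ (Fin d) | bridgeBound ξ < ⊤} :=
    measurableSet_lt measurable_bridgeBound measurable_const
  refine measurable_of_tendsto_metrizable
    (f := fun M => {ξ : ℕ × ℕ → EuclideanSpace ℝ (Fin d) | bridgeBound ξ < ⊤}.indicator
      fun ξ => x + ((s : ℝ) / T) • (y - x) +
        √(D * T) • ∑ n ∈ Finset.range M, bridgeLevel ξ n ((s : ℝ) / T)) (fun M => ?_) ?_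
  · refine Measurable.indicator ?_ hG
    have := fun n => measurable_bridgeLevel (d := d) n ((s : ℝ) / T)
    fun_prop
  · rw [tendsto_pi_nhds]
    intro ξ
    by_cases h : bridgeBound ξ < ⊤
    · simp only [Set.indicator, Set.mem_ofPred_eq, h, if_true, Function.comp_apply,
        bridgeTrajectory, dif_pos, ContinuousMap.coe_mk]
      exact ((tendsto_bridgeSeries h _).const_smul _).const_add _
    · simp only [Set.indicator, Set.mem_ofPred_eq, h, if_false, Function.comp_apply,
        bridgeTrajectory, dif_neg, not_false_eq_true, ContinuousMap.zero_apply]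
      exact tendsto_const_nhds

lemma bridgeCov_div {T : ℝ} (hT : 0 < T) (s s' : Set.Icc (0 : ℝ) T) :
    T * bridgeCov ((s : ℝ) / T) ((s' : ℝ) / T) = min (s : ℝ) s' - (s : ℝ) * s' / T := by
  have h (r : Set.Icc (0 : ℝ) T) : clamp ((r : ℝ) / T) = (r : ℝ) / T := by
    have h1 : 0 ≤ (r : ℝ) / T := div_nonneg r.2.1 hT.le
    have h2 : (r : ℝ) / T ≤ 1 := (div_le_one hT).2 r.2.2
    rw [clamp, min_eq_left h2, max_eq_right h1]
  unfold bridgeCov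
  rw [h, h, min_div_div_right hT.le]
  field_simp

/-- The Brownian bridge exists. -/
theorem exists_isBrownianBridge {d : ℕ} {D T : ℝ} (hD : 0 ≤ D) (hT : 0 < T)
    (x y : EuclideanSpace ℝ (Fin d)) :
    ∃ μ : Measure (Trajectory d T), IsBrownianBridge D T x y μ := by
  refine ⟨(gaussianSeq d).map (bridgeTrajectory D T x y), ?_, fun m s c => ?_⟩
  · exact Measure.isProbabilityMeasure_map (measurable_bridgeTrajectory D T x y).aemeasurable
  · have hev (r : Set.Icc (0 : ℝ) T) : Measurable fun ω : Trajectory d T => ω r :=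
      (measurable_pi_apply r).comp (comap_measurable _)
    have hmeas : Measurable fun ω : Trajectory d T =>
        Complex.exp (((∑ j, inner ℝ (c j) (ω (s j)) : ℝ) : ℂ) * Complex.I) :=
      Complex.measurable_exp.comp ((Complex.measurable_ofReal.comp
        (Finset.measurable_sum _ fun j _ => measurable_const.inner (hev (s j)))).mul_const _)
    rw [integral_map (measurable_bridgeTrajectory D T x y).aemeasurable hmeas.aestronglyMeasurable]
    have h1 : (fun ξ => Complex.exp (((∑ j, inner ℝ (c j) (bridgeTrajectory D T x y ξ (s j)) : ℝ)
        : ℂ) * Complex.I)) =ᵐ[gaussianSeq d] fun ξ =>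
        Complex.exp (((∑ j, inner ℝ (c j) (x + ((s j : ℝ) / T) • (y - x)) : ℝ) : ℂ) * Complex.I) *
        Complex.exp (((∑ j, inner ℝ (√(D * T) • c j) (bridgeSeries ξ ((s j : ℝ) / T)) : ℝ) : ℂ) *
          Complex.I) := by
      filter_upwards [bridgeBound_lt_top d] with ξ hξ
      rw [← Complex.exp_add, ← add_mul, ← Complex.ofReal_add, ← Finset.sum_add_distrib]
      simp only [bridgeTrajectory, dif_pos hξ, ContinuousMap.coe_mk, inner_add_right,
        real_inner_smul_left, real_inner_smul_right]
    have hsq : √(D * T) * √(D * T) = D * T := Real.mul_self_sqrt (by positivity)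
    have key : -(∑ j, ∑ j', bridgeCov ((s j : ℝ) / T) ((s j' : ℝ) / T) *
        inner ℝ (√(D * T) • c j) (√(D * T) • c j')) / 2 =
        -(D / 2 * ∑ j, ∑ j', (min (s j : ℝ) (s j') - (s j : ℝ) * (s j') / T) *
          inner ℝ (c j) (c j')) := by
      rw [neg_div, neg_inj, Finset.mul_sum, Finset.sum_div]
      refine Finset.sum_congr rfl fun j _ => ?_
      rw [Finset.mul_sum, Finset.sum_div]
      refine Finset.sum_congr rfl fun j' _ => ?_
      rw [← bridgeCov_div hT, real_inner_smul_left, real_inner_smul_right]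
      linear_combination
        (bridgeCov ((s j : ℝ) / T) ((s j' : ℝ) / T) * inner ℝ (c j) (c j') / 2) * hsq
    rw [integral_congr_ae h1, integral_const_mul, integral_exp_bridgeSeries, ← Complex.exp_add,
      key, Complex.ofReal_neg]
    exact congrArg Complex.exp (sub_eq_add_neg _ _).symm

/-- The law of the Brownian bridge in `ℝᵈ` from `x` to `y` in time `T > 0` with diffusion constant
`D ≥ 0`.  (Its characteristic functions determine it uniquely.) -/
noncomputable def bridgeLaw {d : ℕ} (D T : ℝ) (x y : EuclideanSpace ℝ (Fin d)) :
    Measure (Trajectory d T) :=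
  open Classical in
  if h : 0 ≤ D ∧ 0 < T then (exists_isBrownianBridge h.1 h.2 x y).choose else 0

lemma isBrownianBridge_bridgeLaw {d : ℕ} {D T : ℝ} (hD : 0 ≤ D) (hT : 0 < T)
    (x y : EuclideanSpace ℝ (Fin d)) : IsBrownianBridge D T x y (bridgeLaw D T x y) := by
  rw [bridgeLaw, dif_pos ⟨hD, hT⟩]
  exact (exists_isBrownianBridge hD hT x y).choose_spec

/-! ### The path integral -/

/-- The thermal wave length `λ_t` at inverse temperature `t`. -/
noncomputable def thermalLength (ħ m₀ t : ℝ) : ℝ := √(2 * Real.pi * ħ ^ 2 * t / m₀)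

/-- The Wiener measure `P^T_{xy}` on trajectories in `ℝᵈ` from `x` at time `0` to `y` at time `T`:
the heat kernel `λ_T⁻ᵈ exp (-π |y - x|² / λ_T²)` times the law of the Brownian bridge. -/
noncomputable def wienerMeasure {d : ℕ} (ħ m₀ T : ℝ) (x y : EuclideanSpace ℝ (Fin d)) :
    Measure (Trajectory d T) :=
  ENNReal.ofReal ((thermalLength ħ m₀ T)⁻¹ ^ d *
    Real.exp (-Real.pi * ‖y - x‖ ^ 2 / thermalLength ħ m₀ T ^ 2)) • bridgeLaw (ħ ^ 2 / m₀) T x y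

/-- The vector `c z` of `ℝᵈ`, for an integer vector `z`. -/
noncomputable def latticeVec {d : ℕ} (c : ℝ) (z : Fin d → ℤ) : EuclideanSpace ℝ (Fin d) :=
  WithLp.toLp 2 fun i => c * (z i : ℝ)

/-- The Wiener measure `W^T_{xy}` of the torus of side `L`. -/
noncomputable def torusWienerMeasure {d : ℕ} (ħ m₀ L T : ℝ) (x y : EuclideanSpace ℝ (Fin d)) :
    Measure (Trajectory d T) :=
  Measure.sum fun z : Fin d → ℤ => wienerMeasure ħ m₀ T x (y + latticeVec L z)

/-- The periodized potential `u_L`. -/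
noncomputable def periodized {d : ℕ} (L : ℝ) (u : EuclideanSpace ℝ (Fin d) → ℝ)
    (x : EuclideanSpace ℝ (Fin d)) : ℝ :=
  ∑' z : Fin d → ℤ, u (x + latticeVec L z)

/-- The position of a trajectory at time `s` (only used for `s ∈ [0, T]`). -/
noncomputable def position {d : ℕ} {T : ℝ} (ω : Trajectory d T) (s : ℝ) :
    EuclideanSpace ℝ (Fin d) :=
  open Classical in if h : s ∈ Set.Icc 0 T then ω ⟨s, h⟩ else 0

/-- The potential energy `U(ω)` of the `n` particles that form the trajectory `ω`. -/
noncomputable def selfEnergy {d : ℕ} (β L : ℝ) (u : EuclideanSpace ℝ (Fin d) → ℝ) {n : ℕ}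
    (ω : Trajectory d (n * β)) : ℝ :=
  β⁻¹ * ∫ t in (0 : ℝ)..β, ∑ k ∈ Finset.range n, ∑ j ∈ Finset.range k,
    periodized L u (position ω (k * β + t) - position ω (j * β + t))

/-- The energy of interaction `U(ω', ω)` between two trajectories. -/
noncomputable def pairEnergy {d : ℕ} (β L : ℝ) (u : EuclideanSpace ℝ (Fin d) → ℝ) {n' n : ℕ}
    (ω' : Trajectory d (n' * β)) (ω : Trajectory d (n * β)) : ℝ :=
  β⁻¹ * ∫ t in (0 : ℝ)..β, ∑ j ∈ Finset.range n', ∑ k ∈ Finset.range n,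
    periodized L u (position ω (k * β + t) - position ω' (j * β + t))

/-- The cube `Λ = (-L/2, L/2]ᵈ`. -/
def cube (d : ℕ) (L : ℝ) : Set (EuclideanSpace ℝ (Fin d)) :=
  {x | ∀ i, -L / 2 < x i ∧ x i ≤ L / 2}

/-- The path integral `G[{n_l}_0^p](x)`.  Trajectory `0` goes from `0` to `x`, and trajectory
`l ≥ 1` is a loop on the torus, based at a point that is integrated over `Λ`. -/
noncomputable def pathIntegral {d p : ℕ} (ħ m₀ β L : ℝ) (u : EuclideanSpace ℝ (Fin d) → ℝ)
    (n : Fin (p + 1) → ℕ) (x : EuclideanSpace ℝ (Fin d)) : ℝ :=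
  L ^ d * ∫ y in {y : Fin p → EuclideanSpace ℝ (Fin d) | ∀ l, y l ∈ cube d L},
    ∫ ω : (l : Fin (p + 1)) → Trajectory d (n l * β),
      (∏ l, Real.exp (-β * selfEnergy β L u (ω l))) *
        (∏ l, ∏ l' ∈ Finset.Iio l, Real.exp (-β * pairEnergy β L u (ω l') (ω l)))
      ∂Measure.pi fun l => torusWienerMeasure ħ m₀ L (n l * β)
        ((Fin.cons 0 y : Fin (p + 1) → EuclideanSpace ℝ (Fin d)) l)
        ((Fin.cons x y : Fin (p + 1) → EuclideanSpace ℝ (Fin d)) l)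

/-! ### The Fourier series -/

/-- The Fourier transform `û(k) = ∫ exp (-2πi k·x) u(x) dx` of an even real function, which is
real. -/
noncomputable def fourierU {d : ℕ} (u : EuclideanSpace ℝ (Fin d) → ℝ)
    (k : EuclideanSpace ℝ (Fin d)) : ℝ :=
  (FourierTransform.fourier (fun x => (u x : ℂ)) k).re

/-- `N_{l-1}`, the number of particles in the cycles before cycle `l`. -/
def countBefore {p : ℕ} (n : Fin (p + 1) → ℕ) (l : Fin (p + 1)) : ℕ := ∑ l' ∈ Finset.Iio l, n l'

/-- `N_l`, the number of particles in the cycles up to and including cycle `l`. -/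
def countUpTo {p : ℕ} (n : Fin (p + 1) → ℕ) (l : Fin (p + 1)) : ℕ := ∑ l' ∈ Finset.Iic l, n l'

/-- `C_l`, the set of the particles in cycle `l`. -/
def cycle {p : ℕ} (n : Fin (p + 1) → ℕ) (l : Fin (p + 1)) : Finset ℕ :=
  Finset.Icc (countBefore n l + 1) (countUpTo n l)

/-- The pairs `(j, k)` with `1 ≤ j < k ≤ N`. -/
def pairs (N : ℕ) : Finset (ℕ × ℕ) :=
  (Finset.Icc 1 N ×ˢ Finset.Icc 1 N).filter fun e => e.1 < e.2

/-- The multiplicities `α^k_j` of the pairs. -/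
abbrev Multiplicities (N : ℕ) := pairs N → ℕ

/-- The nonzero integer vectors `z^k_{j,r}`, `1 ≤ r ≤ α^k_j`. -/
abbrev Vectors (d : ℕ) {N : ℕ} (α : Multiplicities N) :=
  (e : pairs N) → Fin (α e) → {v : Fin d → ℤ // v ≠ 0}

/-- The times `t^k_{j,r}`, `1 ≤ r ≤ α^k_j`. -/
abbrev Times {N : ℕ} (α : Multiplicities N) := (e : pairs N) → Fin (α e) → ℝ

/-- All times are in `[0, 1]`. -/
def unitTimes {N : ℕ} (α : Multiplicities N) : Set (Times α) :=
  {τ | ∀ e r, τ e r ∈ Set.Icc (0 : ℝ) 1}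

/-- `∑_r z^k_{j,r}`. -/
def totalSum {d N : ℕ} {α : Multiplicities N} (z : Vectors d α) (j k : ℕ) : Fin d → ℤ :=
  if h : (j, k) ∈ pairs N then ∑ r, (z ⟨(j, k), h⟩ r : Fin d → ℤ) else 0

/-- `∑_r 1{t^k_{j,r} ≥ t} z^k_{j,r}`. -/
noncomputable def lateSum {d N : ℕ} {α : Multiplicities N} (z : Vectors d α) (τ : Times α)
    (t : ℝ) (j k : ℕ) : Fin d → ℤ :=
  if h : (j, k) ∈ pairs N then
    ∑ r, if τ ⟨(j, k), h⟩ r ≥ t then (z ⟨(j, k), h⟩ r : Fin d → ℤ) else 0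
  else 0

/-- `∑_r 1{t^k_{j,r} < t} z^k_{j,r}`. -/
noncomputable def earlySum {d N : ℕ} {α : Multiplicities N} (z : Vectors d α) (τ : Times α)
    (t : ℝ) (j k : ℕ) : Fin d → ℤ :=
  if h : (j, k) ∈ pairs N then
    ∑ r, if τ ⟨(j, k), h⟩ r < t then (z ⟨(j, k), h⟩ r : Fin d → ℤ) else 0
  else 0

/-- `Z_q(t)` for a particle `q` in cycle `l`. -/
noncomputable def shift {d p : ℕ} (n : Fin (p + 1) → ℕ) {α : Multiplicities (∑ l, n l)}
    (z : Vectors d α) (τ : Times α) (l : Fin (p + 1)) (q : ℕ) (t : ℝ) : Fin d → ℤ :=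
  - ∑ j ∈ Finset.Icc 1 (q - 1), ∑ k ∈ Finset.Icc q (countUpTo n l), lateSum z τ t j k
  + ∑ j ∈ Finset.Icc q (countUpTo n l), ∑ k ∈ Finset.Icc (countUpTo n l + 1) (∑ l, n l),
      lateSum z τ t j k
  - ∑ j ∈ Finset.Icc 1 q, ∑ k ∈ Finset.Icc (q + 1) (countUpTo n l), earlySum z τ t j k
  + ∑ j ∈ Finset.Icc (q + 1) (countUpTo n l), ∑ k ∈ Finset.Icc (countUpTo n l + 1) (∑ l, n l),
      earlySum z τ t j k

/-- `Z^l_1 = Z_{N_{l-1}+1}(0)`. -/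
noncomputable def initialShift {d p : ℕ} (n : Fin (p + 1) → ℕ) {α : Multiplicities (∑ l, n l)}
    (z : Vectors d α) (τ : Times α) (l : Fin (p + 1)) : Fin d → ℤ :=
  shift n z τ l (countBefore n l + 1) 0

/-- The weight `exp (-(π λ_β² / L²) ∑_{q ∈ C_l} ∫₀¹ [w + Z_q(t)]² dt)`. -/
noncomputable def cycleWeight {d p : ℕ} (ħ m₀ β L : ℝ) (n : Fin (p + 1) → ℕ)
    {α : Multiplicities (∑ l, n l)} (z : Vectors d α) (τ : Times α) (l : Fin (p + 1))
    (w : Fin d → ℤ) : ℝ :=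
  Real.exp (-(Real.pi * thermalLength ħ m₀ β ^ 2 / L ^ 2) * ∑ q ∈ cycle n l,
    ∫ t in (0 : ℝ)..1, ∑ i, (((w + shift n z τ l q t) i : ℤ) : ℝ) ^ 2)

/-- The quantity in square brackets, under the summations over the multiplicities and the vectors
and under the time integrals. -/
noncomputable def bracket {d p : ℕ} (ħ m₀ β L : ℝ) (n : Fin (p + 1) → ℕ)
    (x : EuclideanSpace ℝ (Fin d)) {α : Multiplicities (∑ l, n l)} (z : Vectors d α)
    (τ : Times α) : ℝ :=
  ((if initialShift n z τ 0 = 0 then 1 else 0) *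
    ∑' w : Fin d → ℤ, cycleWeight ħ m₀ β L n z τ 0 w *
      Real.cos (2 * Real.pi / L * ∑ i, (w i : ℝ) * x i)) *
  ∏ l : Fin p, ((if initialShift n z τ l.succ = 0 then 1 else 0) *
    ∑' w : Fin d → ℤ, cycleWeight ħ m₀ β L n z τ l.succ w)

/-- The contribution of given multiplicities and vectors, without the factorials. -/
noncomputable def seriesTerm {d p : ℕ} (ħ m₀ β L : ℝ) (u : EuclideanSpace ℝ (Fin d) → ℝ)
    (n : Fin (p + 1) → ℕ) (x : EuclideanSpace ℝ (Fin d)) (α : Multiplicities (∑ l, n l))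
    (z : Vectors d α) : ℝ :=
  (∏ e, ∏ r, (-β / L ^ d * fourierU u (latticeVec L⁻¹ (z e r : Fin d → ℤ)))) *
    ∫ τ in unitTimes α, bracket ħ m₀ β L n x z τ

end TorusBose

open TorusBose

namespace TorusBose
open MeasureTheory ProbabilityTheory

/-! ### Sums of products -/

/-! The Boltzmann factor is the exponential of `-β` times a sum, over all pairs of particles, of the
integral over `s ∈ [0, 1]` of `u_L(x_k(s) - x_j(s))`. By `ae_periodization_eq_fourierSeries`, `u_L`
agrees almost everywhere with its absolutely convergent Fourier series, a bounded continuous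
function. The trajectories may still meet the exceptional null set, but at each fixed interior time
the law of `x_k - x_j` has a density, because a Brownian bridge has nondegenerate Gaussian positions
and increments. By Fubini, almost every configuration avoids the null set at almost every time, so
`u_L` may be replaced by the series (`ae_boltzmannFactor_eq`). The Fourier mode `0` contributes a
constant for each of the `N(N-1)/2` pairs, hence the prefactor. The exponential of the other modes
is expanded into a sum over multiplicities and tuples of vectors, one time integral per vector
(`hasSum_exp_seriesPotential`). Each term is a coefficient times an average of products of plane
waves. These have modulus one and the Wiener measures and the cube are finite, so the absolutely
summable coefficients alone justify every interchange of sum and integral. A product of plane waves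
factorizes over the cycles (`waveProduct_eq`). Along one cycle, the characteristic function of the
bridge, weighted by the heat kernel and summed over the windings `Lw`, is a lattice sum of Gaussians
times waves. Poisson summation turns it into a sum over a dual vector `w` of exponentials of a
quadratic form (`integral_exp_torusWienerMeasure`). With waves `A_m` at times `v_m`, the form
contains `min (v_m) (v_m')`, which is the overlap of the indicators of `s ≤ v_m` and `s ≤ v_m'`. The
form is therefore the integral over `[0, n_l]` of the square of `w / L` minus the sum of the `A_m`
with `v_m ≥ s`; cut into unit intervals, this is the sum over `q ∈ C_l` of the integrals of `[w +
Z_q(t)]² / L²` (`cycleWeight_eq`). Finally, averaging the base point of a loop over the cube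
annihilates the term unless the total wave vector of that loop is zero (`integral_cube_wave`). The
base point of cycle `0` is fixed, but its constraint follows from the others, since every pair
contributes opposite vectors to its two particles. Real parts turn the wave in `x` into a cosine. -/

lemma summable_norm_and_tsum_fin_prod {𝕜 κ : Type*} [NormedField 𝕜] [CompleteSpace 𝕜] {m : ℕ}
    (f : Fin m → κ → 𝕜) (hf : ∀ i, Summable fun k => ‖f i k‖) :
    (Summable fun x : Fin m → κ => ‖∏ i, f i (x i)‖) ∧
      ∑' x : Fin m → κ, ∏ i, f i (x i) = ∏ i, ∑' k, f i k := by
  induction m with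
  | zero =>
    refine ⟨(hasSum_fintype _).summable, ?_⟩
    simp
  | succ m ih =>
    obtain ⟨h1, h2⟩ := ih (fun i => f i.succ) fun i => hf i.succ
    have h0 : Summable fun k => ‖f 0 k‖ := hf 0
    have h3 := Summable.mul_norm (f := f 0) h0 h1
    have key (x : κ × (Fin m → κ)) : f 0 x.1 * ∏ i, f i.succ (x.2 i) =
        (fun x : Fin (m + 1) → κ => ∏ i, f i (x i)) (Fin.consEquiv (fun _ => κ) x) := by
      beta_reduce
      rw [Fin.prod_univ_succ]
      rfl
    constructor
    · exact (Fin.consEquiv fun _ : Fin (m + 1) => κ).summable_iff.1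
        (h3.congr fun x => congrArg norm (key x))
    · rw [← (Fin.consEquiv fun _ : Fin (m + 1) => κ).tsum_eq, Fin.prod_univ_succ, ← h2,
        tsum_mul_tsum_of_summable_norm h0 h1]
      exact tsum_congr fun x => (key x).symm

lemma summable_norm_and_tsum_pi_prod {𝕜 ι κ : Type*} [NormedField 𝕜] [CompleteSpace 𝕜] [Fintype ι]
    (f : ι → κ → 𝕜) (hf : ∀ i, Summable fun k => ‖f i k‖) :
    (Summable fun x : ι → κ => ‖∏ i, f i (x i)‖) ∧
      ∑' x : ι → κ, ∏ i, f i (x i) = ∏ i, ∑' k, f i k := by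
  set e := (Fintype.equivFin ι).symm
  obtain ⟨h1, h2⟩ := summable_norm_and_tsum_fin_prod (fun i => f (e i)) fun i => hf (e i)
  have key : ∀ x : ι → κ, ∏ i, f (e i) (x (e i)) = ∏ i, f i (x i) := fun x =>
    e.prod_comp fun i => f i (x i)
  constructor
  · rw [← (e.arrowCongr (Equiv.refl κ)).symm.summable_iff] at h1
    refine h1.congr fun x => ?_
    rw [← key]
    rfl
  · rw [← e.prod_comp fun i => ∑' k, f i k, ← h2, ← (e.arrowCongr (Equiv.refl κ)).symm.tsum_eq]
    refine tsum_congr fun x => ?_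
    rw [← key]
    rfl

/-- The `a`-th power of a series is a sum over `a`-tuples, so the exponential series becomes a sum
over tuples of all lengths. The same computation with `‖c v‖` gives absolute convergence. -/
lemma summable_norm_and_tsum_sigma_exp {V : Type*} (c : V → ℂ) (hc : Summable fun v => ‖c v‖) :
    (Summable fun x : Σ a : ℕ, Fin a → V => ‖1 / (x.1.factorial : ℂ) * ∏ r, c (x.2 r)‖) ∧
      ∑' x : Σ a : ℕ, Fin a → V, 1 / (x.1.factorial : ℂ) * ∏ r, c (x.2 r) =
        Complex.exp (∑' v, c v) := by
  have h1 (a : ℕ) := summable_norm_and_tsum_pi_prod (ι := Fin a) (fun _ => c) fun _ => hc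
  have hs : Summable fun x : Σ a : ℕ, Fin a → V => ‖1 / (x.1.factorial : ℂ) * ∏ r, c (x.2 r)‖ := by
    rw [summable_sigma_of_nonneg fun _ => norm_nonneg _]
    refine ⟨fun a => ?_, ?_⟩
    · simp_rw [norm_mul]
      exact (h1 a).1.mul_left _
    · refine (NormedSpace.expSeries_div_summable (𝔸 := ℝ) (∑' v, ‖c v‖)).congr fun a => ?_
      obtain ⟨-, h3⟩ := summable_norm_and_tsum_pi_prod (ι := Fin a) (fun _ v => ‖c v‖)
        fun _ => by simpa using hc
      simp_rw [norm_mul, tsum_mul_left, norm_prod]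
      rw [h3]
      simp [div_eq_inv_mul]
  refine ⟨hs, ?_⟩
  rw [hs.of_norm.tsum_sigma, Complex.exp_eq_exp_ℂ, NormedSpace.exp_eq_tsum_div]
  refine tsum_congr fun a => ?_
  dsimp only
  rw [tsum_mul_left, (h1 a).2]
  simp [div_eq_inv_mul]

/-- Expansion of the exponential of a finite sum of absolutely convergent series. -/
theorem summable_norm_and_hasSum_exp {ι V : Type*} [Fintype ι] (c : ι → V → ℂ)
    (hc : ∀ e, Summable fun v => ‖c e v‖) :
    (Summable fun x : Σ α : ι → ℕ, ∀ e, Fin (α e) → V =>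
      ‖∏ e, (1 / ((x.1 e).factorial : ℂ) * ∏ r, c e (x.2 e r))‖) ∧
    HasSum (fun x : Σ α : ι → ℕ, ∀ e, Fin (α e) → V =>
      ∏ e, (1 / ((x.1 e).factorial : ℂ) * ∏ r, c e (x.2 e r)))
      (Complex.exp (∑ e, ∑' v, c e v)) := by
  have h := fun e => summable_norm_and_tsum_sigma_exp (c e) (hc e)
  obtain ⟨h1, h2⟩ := summable_norm_and_tsum_pi_prod
    (fun e (x : Σ a : ℕ, Fin a → V) => 1 / (x.1.factorial : ℂ) * ∏ r, c e (x.2 r)) fun e => (h e).1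
  -- Choosing a length and a tuple for every index is the same as choosing all lengths first and
  -- then all tuples.
  let E : (Σ α : ι → ℕ, ∀ e, Fin (α e) → V) ≃ (ι → Σ a : ℕ, Fin a → V) :=
    { toFun := fun g e => ⟨g.1 e, g.2 e⟩
      invFun := fun f => ⟨fun e => (f e).1, fun e => (f e).2⟩
      left_inv := fun _ => rfl
      right_inv := fun _ => rfl }
  have hs : Summable fun x : Σ α : ι → ℕ, ∀ e, Fin (α e) → V =>
      ‖∏ e, (1 / ((x.1 e).factorial : ℂ) * ∏ r, c e (x.2 e r))‖ := E.summable_iff.2 h1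
  refine ⟨hs, ?_⟩
  have h3 := hs.of_norm.hasSum
  have h4 : ∑' x : Σ α : ι → ℕ, ∀ e, Fin (α e) → V,
      ∏ e, (1 / ((x.1 e).factorial : ℂ) * ∏ r, c e (x.2 e r)) =
      Complex.exp (∑ e, ∑' v, c e v) := by
    rw [Complex.exp_sum, ← Finset.prod_congr rfl fun e _ => (h e).2, ← h2]
    exact E.tsum_eq (fun f : ι → Σ a : ℕ, Fin a → V =>
      ∏ e, (1 / ((f e).1.factorial : ℂ) * ∏ r, c e ((f e).2 r)))
  rwa [h4] at h3

/-! ### Poisson summation for Gaussians -/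

/-- Taking the modulus removes the oscillating factor and leaves the general term of the theta
series `evenKernel`. -/
lemma summable_norm_gaussian_int {a : ℝ} (ha : 0 < a) (b ξ : ℝ) :
    Summable fun z : ℤ =>
      ‖Complex.exp (-Real.pi * a * (z + b) ^ 2 + 2 * Real.pi * Complex.I * z * ξ)‖ := by
  refine (HurwitzZeta.hasSum_int_evenKernel b ha).summable.congr fun z => ?_
  rw [Complex.norm_exp]
  congr 1
  have : (-Real.pi * a * (z + b) ^ 2 + 2 * Real.pi * Complex.I * z * ξ : ℂ) =
      ((-Real.pi * (z + b) ^ 2 * a : ℝ) : ℂ) + ((2 * Real.pi * z * ξ : ℝ) : ℂ) * Complex.I := by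
    push_cast
    ring
  rw [this, Complex.add_re, Complex.ofReal_re, Complex.re_ofReal_mul, Complex.I_re]
  ring

lemma summable_norm_gaussian_int' {a : ℝ} (ha : 0 < a) (b ξ : ℝ) :
    Summable fun w : ℤ =>
      ‖Complex.exp (-Real.pi / a * (ξ + w) ^ 2 - 2 * Real.pi * Complex.I * b * (ξ + w))‖ := by
  refine (HurwitzZeta.hasSum_int_evenKernel ξ (inv_pos.2 ha)).summable.congr fun z => ?_
  rw [Complex.norm_exp]
  congr 1
  have : (-Real.pi / a * (ξ + z) ^ 2 - 2 * Real.pi * Complex.I * b * (ξ + z) : ℂ) =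
      ((-Real.pi * (z + ξ) ^ 2 * a⁻¹ : ℝ) : ℂ) +
        ((-2 * Real.pi * b * (ξ + z) : ℝ) : ℂ) * Complex.I := by
    push_cast
    ring
  rw [this, Complex.add_re, Complex.ofReal_re, Complex.re_ofReal_mul, Complex.I_re]
  ring

/-- Jacobi's functional equation at the complex argument `-ab + iξ`. Completing the square produces
the common factor `exp (-π a b²)`, and the substitution `w ↦ -w` matches the signs. -/
lemma tsum_gaussian_int {a : ℝ} (ha : 0 < a) (b ξ : ℝ) :
    ∑' w : ℤ, Complex.exp (-Real.pi / a * (ξ + w) ^ 2 - 2 * Real.pi * Complex.I * b * (ξ + w)) =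
      (√a : ℂ) * ∑' z : ℤ,
        Complex.exp (-Real.pi * a * (z + b) ^ 2 + 2 * Real.pi * Complex.I * z * ξ) := by
  have h := Complex.tsum_exp_neg_quadratic (a := a) (by simpa using ha)
    (-a * b + Complex.I * ξ)
  have ha' : (a : ℂ) ≠ 0 := by exact_mod_cast ha.ne'
  have hs : (a : ℂ) ^ (1 / 2 : ℂ) = (√a : ℂ) := by
    rw [Real.sqrt_eq_rpow, Complex.ofReal_cpow ha.le]
    norm_num
  have hs0 : (√a : ℂ) ≠ 0 := by exact_mod_cast (Real.sqrt_pos.2 ha).ne'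
  have h1 (z : ℤ) : Complex.exp (-Real.pi * a * (z + b) ^ 2 + 2 * Real.pi * Complex.I * z * ξ) =
      Complex.exp (-Real.pi * a * b ^ 2) * Complex.exp (-Real.pi * a * z ^ 2 +
        2 * Real.pi * (-a * b + Complex.I * ξ) * z) := by
    rw [← Complex.exp_add]
    congr 1
    ring
  have h2 (w : ℤ) : Complex.exp (-Real.pi / a * (ξ + w) ^ 2 -
        2 * Real.pi * Complex.I * b * (ξ + w)) =
      Complex.exp (-Real.pi * a * b ^ 2) *
        Complex.exp (-Real.pi / a * (((Equiv.neg ℤ) w : ℤ) +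
          Complex.I * (-a * b + Complex.I * ξ)) ^ 2) := by
    rw [← Complex.exp_add]
    congr 1
    simp only [Equiv.neg_apply, Int.cast_neg]
    field_simp
    ring_nf
    simp only [Complex.I_sq, Complex.I_pow_three, Complex.I_pow_four]
    ring
  simp_rw [h1, h2]
  rw [tsum_mul_left, tsum_mul_left, h, (Equiv.neg ℤ).tsum_eq fun w : ℤ =>
    Complex.exp (-Real.pi / a * (w + Complex.I * (-a * b + Complex.I * ξ)) ^ 2), hs]
  field_simp

lemma summable_norm_gaussian_lattice {d : ℕ} {a : ℝ} (ha : 0 < a) (b ξ : Fin d → ℝ) :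
    Summable fun z : Fin d → ℤ => ‖Complex.exp (∑ i,
      (-Real.pi * a * (z i + b i) ^ 2 + 2 * Real.pi * Complex.I * z i * ξ i))‖ := by
  simp_rw [Complex.exp_sum]
  exact (summable_norm_and_tsum_pi_prod (fun i (z : ℤ) =>
    Complex.exp (-Real.pi * a * (z + b i) ^ 2 + 2 * Real.pi * Complex.I * z * ξ i))
    fun i => summable_norm_gaussian_int ha _ _).1

lemma summable_norm_gaussian_lattice' {d : ℕ} {a : ℝ} (ha : 0 < a) (b ξ : Fin d → ℝ) :
    Summable fun w : Fin d → ℤ => ‖Complex.exp (∑ i,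
      (-Real.pi / a * (ξ i + w i) ^ 2 - 2 * Real.pi * Complex.I * b i * (ξ i + w i)))‖ := by
  simp_rw [Complex.exp_sum]
  exact (summable_norm_and_tsum_pi_prod (fun i (w : ℤ) =>
    Complex.exp (-Real.pi / a * (ξ i + w) ^ 2 - 2 * Real.pi * Complex.I * b i * (ξ i + w)))
    fun i => summable_norm_gaussian_int' ha _ _).1

/-- Poisson summation for Gaussians on `ℤᵈ`. -/
theorem tsum_gaussian_lattice {d : ℕ} {a : ℝ} (ha : 0 < a) (b ξ : Fin d → ℝ) :
    ∑' w : Fin d → ℤ, Complex.exp (∑ i,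
      (-Real.pi / a * (ξ i + w i) ^ 2 - 2 * Real.pi * Complex.I * b i * (ξ i + w i))) =
    (√a : ℂ) ^ d * ∑' z : Fin d → ℤ, Complex.exp (∑ i,
      (-Real.pi * a * (z i + b i) ^ 2 + 2 * Real.pi * Complex.I * z i * ξ i)) := by
  simp_rw [Complex.exp_sum]
  rw [(summable_norm_and_tsum_pi_prod (fun i (w : ℤ) =>
    Complex.exp (-Real.pi / a * (ξ i + w) ^ 2 - 2 * Real.pi * Complex.I * b i * (ξ i + w)))
    fun i => summable_norm_gaussian_int' ha _ _).2,
    (summable_norm_and_tsum_pi_prod (fun i (z : ℤ) =>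
    Complex.exp (-Real.pi * a * (z + b i) ^ 2 + 2 * Real.pi * Complex.I * z * ξ i))
    fun i => summable_norm_gaussian_int ha _ _).2]
  simp_rw [tsum_gaussian_int ha, Finset.prod_mul_distrib]
  simp

/-! ### Plane waves and Poisson summation on the lattice `Lℤᵈ` -/

/-- The plane wave `exp (2πi k·x)`. -/
noncomputable def wave {d : ℕ} (k x : EuclideanSpace ℝ (Fin d)) : ℂ :=
  Complex.exp ((2 * Real.pi * inner ℝ k x : ℝ) * Complex.I)

section wave
variable {d : ℕ} (k k' x y : EuclideanSpace ℝ (Fin d))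

@[simp] lemma norm_wave : ‖wave k x‖ = 1 := Complex.norm_exp_ofReal_mul_I _

lemma continuous_wave : Continuous (wave k) := by
  unfold wave
  fun_prop

lemma wave_add_right : wave k (x + y) = wave k x * wave k y := by
  unfold wave
  rw [← Complex.exp_add, inner_add_right]
  push_cast
  ring_nf

lemma wave_add_left : wave (k + k') x = wave k x * wave k' x := by
  unfold wave
  rw [← Complex.exp_add, inner_add_left]
  push_cast
  ring_nf

@[simp] lemma wave_zero_left : wave 0 x = 1 := by simp [wave]

@[simp] lemma wave_zero_right : wave k 0 = 1 := by simp [wave]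

lemma wave_neg_right : wave k (-x) = wave (-k) x := by simp [wave]

end wave

lemma latticeVec_neg {d : ℕ} (c : ℝ) (z : Fin d → ℤ) : latticeVec c (-z) = -latticeVec c z := by
  ext i
  simp [latticeVec]

@[simp] lemma latticeVec_zero {d : ℕ} (c : ℝ) : latticeVec c (0 : Fin d → ℤ) = 0 := by
  ext i
  simp [latticeVec]

/-- Poisson summation for a Gaussian times a plane wave. -/
theorem tsum_gaussian_wave {d : ℕ} {L s : ℝ} (hL : 0 < L) (hs : 0 < s)
    (k x : EuclideanSpace ℝ (Fin d)) :
    (Summable fun w : Fin d → ℤ => Real.exp (-Real.pi * ‖x + latticeVec L w‖ ^ 2 / s ^ 2)) ∧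
    (Summable fun z : Fin d → ℤ => Real.exp (-Real.pi * s ^ 2 * ‖latticeVec L⁻¹ z + k‖ ^ 2)) ∧
    ∑' w : Fin d → ℤ, (Real.exp (-Real.pi * ‖x + latticeVec L w‖ ^ 2 / s ^ 2) : ℂ) *
        wave (-k) (x + latticeVec L w) =
      ((s / L : ℝ) : ℂ) ^ d * ∑' z : Fin d → ℤ,
        (Real.exp (-Real.pi * s ^ 2 * ‖latticeVec L⁻¹ z + k‖ ^ 2) : ℂ) *
          wave (latticeVec L⁻¹ z) x := by
  -- In units of `L` the lattice is `ℤᵈ`, the width is `s / L`, the point is `x / L` and the wave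
  -- vector is `kL`.
  have ha : 0 < (s / L) ^ 2 := by positivity
  set b : Fin d → ℝ := fun i => k i * L with hb
  set ξ : Fin d → ℝ := fun i => x i / L with hξ
  have hLc : (L : ℂ) ≠ 0 := by exact_mod_cast hL.ne'
  have hsc : (s : ℂ) ≠ 0 := by exact_mod_cast hs.ne'
  have h1 (w : Fin d → ℤ) : (Real.exp (-Real.pi * ‖x + latticeVec L w‖ ^ 2 / s ^ 2) : ℂ) *
        wave (-k) (x + latticeVec L w) = Complex.exp (∑ i,
      (-Real.pi / ((s / L) ^ 2 : ℝ) * (ξ i + w i) ^ 2 -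
        2 * Real.pi * Complex.I * b i * (ξ i + w i))) := by
    rw [wave, Complex.ofReal_exp, ← Complex.exp_add, EuclideanSpace.real_norm_sq_eq,
      PiLp.inner_apply, Finset.mul_sum, Finset.mul_sum, Finset.sum_div, Complex.ofReal_sum,
      Complex.ofReal_sum, Finset.sum_mul, ← Finset.sum_add_distrib]
    congr 1
    refine Finset.sum_congr rfl fun i _ => ?_
    simp [hb, hξ, latticeVec]
    field_simp
    ring
  have h2 (z : Fin d → ℤ) : (Real.exp (-Real.pi * s ^ 2 * ‖latticeVec L⁻¹ z + k‖ ^ 2) : ℂ) *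
        wave (latticeVec L⁻¹ z) x = Complex.exp (∑ i,
      (-Real.pi * ((s / L) ^ 2 : ℝ) * (z i + b i) ^ 2 + 2 * Real.pi * Complex.I * z i * ξ i)) := by
    rw [wave, Complex.ofReal_exp, ← Complex.exp_add, EuclideanSpace.real_norm_sq_eq,
      PiLp.inner_apply, Finset.mul_sum, Finset.mul_sum, Complex.ofReal_sum,
      Complex.ofReal_sum, Finset.sum_mul, ← Finset.sum_add_distrib]
    congr 1
    refine Finset.sum_congr rfl fun i _ => ?_
    simp [hb, hξ, latticeVec]
    field_simp
  refine ⟨?_, ?_, ?_⟩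
  · refine (summable_norm_gaussian_lattice' ha b ξ).congr fun w => ?_
    rw [← h1, norm_mul, norm_wave, mul_one, Complex.norm_real, Real.norm_of_nonneg
      (Real.exp_nonneg _)]
  · refine (summable_norm_gaussian_lattice ha b ξ).congr fun w => ?_
    rw [← h2, norm_mul, norm_wave, mul_one, Complex.norm_real, Real.norm_of_nonneg
      (Real.exp_nonneg _)]
  · simp_rw [h1, h2]
    rw [tsum_gaussian_lattice ha b ξ, Real.sqrt_sq (by positivity)]

/-! ### The Fourier series of a periodized integrable function -/

/-- Tonelli for the norms. -/
lemma integrable_tsum_of_summable_integral_norm {α ι : Type*} [MeasurableSpace α] {μ : Measure α}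
    [Countable ι] {F : ι → α → ℂ} (hF_int : ∀ i, Integrable (F i) μ)
    (hF_sum : Summable fun i => ∫ a, ‖F i a‖ ∂μ) : Integrable (fun a => ∑' i, F i a) μ := by
  refine ⟨(AEMeasurable.tsum fun i => (hF_int i).1.aemeasurable).aestronglyMeasurable, ?_⟩
  rw [hasFiniteIntegral_iff_enorm]
  calc ∫⁻ a, ‖∑' i, F i a‖ₑ ∂μ ≤ ∫⁻ a, ∑' i, ‖F i a‖ₑ ∂μ :=
        lintegral_mono fun a => enorm_tsum_le_tsum_enorm
    _ = ∑' i, ∫⁻ a, ‖F i a‖ₑ ∂μ := lintegral_tsum fun i => (hF_int i).1.enorm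
    _ = ∑' i, ENNReal.ofReal (∫ a, ‖F i a‖ ∂μ) := by
        simp_rw [ofReal_integral_norm_eq_lintegral_enorm (hF_int _)]
    _ < ⊤ := by
        rw [← ENNReal.ofReal_tsum_of_nonneg (fun i => integral_nonneg fun a => norm_nonneg _) hF_sum]
        exact ENNReal.ofReal_lt_top

/-- Injectivity of the Fourier transform on `L¹`, by duality: a smooth compactly supported `φ` is
the Fourier transform of a Schwartz function `Ψ`, and the integral of `φ f` equals that of `Ψ` times
the transform of `f`, so it depends only on the transform. -/
lemma ae_eq_of_forall_integral_mul_wave_eq {d : ℕ} {f g : EuclideanSpace ℝ (Fin d) → ℂ}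
    (hf : Integrable f) (hg : Integrable g)
    (h : ∀ k, ∫ x, f x * wave (-k) x = ∫ x, g x * wave (-k) x) : f =ᵐ[volume] g := by
  have hF (f : EuclideanSpace ℝ (Fin d) → ℂ) (k : EuclideanSpace ℝ (Fin d)) :
      FourierTransform.fourier f k = ∫ x, f x * wave (-k) x := by
    rw [Real.fourier_eq']
    refine integral_congr_ae (Filter.Eventually.of_forall fun x => ?_)
    simp only [smul_eq_mul, wave, inner_neg_left, real_inner_comm k x]
    rw [mul_comm]
    simp
  have hfg : FourierTransform.fourier f = FourierTransform.fourier g := by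
    ext k
    rw [hF, hF, h]
  refine ae_eq_of_integral_contDiff_smul_eq hf.locallyIntegrable hg.locallyIntegrable
    fun φ hφ hφc => ?_
  have hφ1 : HasCompactSupport (Complex.ofRealCLM ∘ φ) := hφc.comp_left rfl
  have hφ2 : ContDiff ℝ (⊤ : ℕ∞) (Complex.ofRealCLM ∘ φ) := by fun_prop
  set Φ := hφ1.toSchwartzMap hφ2 with hΦ
  set Ψ : SchwartzMap (EuclideanSpace ℝ (Fin d)) ℂ := FourierTransform.fourierInv Φ with hΨ
  have hΨΦ : FourierTransform.fourier (Ψ : EuclideanSpace ℝ (Fin d) → ℂ) = Φ := by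
    rw [← SchwartzMap.fourier_coe, hΨ, FourierTransform.fourier_fourierInv_eq]
  have key {f : EuclideanSpace ℝ (Fin d) → ℂ} (hf : Integrable f) :
      ∫ x, φ x • f x = ∫ x, Ψ x • FourierTransform.fourier f x := by
    have := VectorFourier.integral_fourierIntegral_smul_eq_flip (L := innerₗ _)
      Real.continuous_fourierChar continuous_inner (Ψ.integrable (μ := volume)) hf
    have h2 : (∫ x, φ x • f x) = ∫ x, (FourierTransform.fourier Ψ x) • f x := by
      refine integral_congr_ae (Filter.Eventually.of_forall fun x => ?_)
      change _ = (FourierTransform.fourier (Ψ : EuclideanSpace ℝ (Fin d) → ℂ) x) • f x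
      rw [hΨΦ, hΦ]
      simp
    rw [h2]
    simpa using! this
  rw [key hf, key hg, hfg]

lemma fourier_eq_integral_wave {d : ℕ} (f : EuclideanSpace ℝ (Fin d) → ℂ)
    (k : EuclideanSpace ℝ (Fin d)) :
    FourierTransform.fourier f k = ∫ x, f x * wave (-k) x := by
  rw [Real.fourier_eq']
  refine integral_congr_ae (Filter.Eventually.of_forall fun x => ?_)
  simp only [smul_eq_mul, wave, inner_neg_left, real_inner_comm k x]
  rw [mul_comm]
  simp

/-- The Gaussian weight `exp (-π |x|² / L²)`. -/
noncomputable def gaussWeight {d : ℕ} (L : ℝ) (x : EuclideanSpace ℝ (Fin d)) : ℝ :=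
  Real.exp (-Real.pi * ‖x‖ ^ 2 / L ^ 2)

section periodization
variable {d : ℕ} {L : ℝ}

lemma gaussWeight_pos (x : EuclideanSpace ℝ (Fin d)) : 0 < gaussWeight L x := Real.exp_pos _

lemma gaussWeight_le_one (x : EuclideanSpace ℝ (Fin d)) : gaussWeight L x ≤ 1 := by
  unfold gaussWeight
  rw [Real.exp_le_one_iff, neg_mul, neg_div]
  have := Real.pi_pos
  exact neg_nonpos.2 (by positivity)

lemma continuous_gaussWeight : Continuous (gaussWeight L : EuclideanSpace ℝ (Fin d) → ℝ) := by
  unfold gaussWeight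
  fun_prop

lemma norm_gaussWeight_mul_wave (k x : EuclideanSpace ℝ (Fin d)) :
    ‖(gaussWeight L x : ℂ) * wave k x‖ = gaussWeight L x := by
  rw [norm_mul, norm_wave, mul_one, Complex.norm_real, Real.norm_of_nonneg (gaussWeight_pos _).le]

lemma continuous_gaussWeight_mul_wave (k : EuclideanSpace ℝ (Fin d)) :
    Continuous fun x => (gaussWeight L x : ℂ) * wave k x :=
  (Complex.continuous_ofReal.comp continuous_gaussWeight).mul (continuous_wave k)

/-- Poisson summation writes the sum over translates as dual Gaussians times unimodular waves, which
is bounded independently of `x`. This uniform bound makes a periodized integrable function,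
multiplied by the Gaussian, integrable on the whole space. -/
lemma exists_sum_gaussWeight_le (hL : 0 < L) : ∃ C : ℝ, ∀ (s : Finset (Fin d → ℤ))
    (x : EuclideanSpace ℝ (Fin d)), ∑ w ∈ s, gaussWeight L (x + latticeVec L w) ≤ C := by
  have hL1 : ((L / L : ℝ) : ℂ) ^ d = 1 := by rw [div_self hL.ne']; simp
  refine ⟨∑' z : Fin d → ℤ, Real.exp (-Real.pi * L ^ 2 * ‖latticeVec L⁻¹ z + 0‖ ^ 2),
    fun s x => ?_⟩
  obtain ⟨h1, h2, h3⟩ := tsum_gaussian_wave hL hL 0 x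
  have h4 : ∑ w ∈ s, gaussWeight L (x + latticeVec L w) ≤
      ∑' w : Fin d → ℤ, gaussWeight L (x + latticeVec L w) :=
    h1.sum_le_tsum s fun _ _ => (gaussWeight_pos _).le
  refine h4.trans ?_
  simp only [neg_zero, wave_zero_left, mul_one, hL1, one_mul] at h3
  rw [← Complex.ofReal_tsum] at h3
  have h5 : 0 ≤ ∑' w : Fin d → ℤ, gaussWeight L (x + latticeVec L w) :=
    tsum_nonneg fun _ => (gaussWeight_pos _).le
  have h6 := congrArg norm h3
  unfold gaussWeight at h5 ⊢
  rw [Complex.norm_real, Real.norm_of_nonneg h5] at h6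
  rw [h6]
  have h7 (z : Fin d → ℤ) : ‖(Real.exp (-Real.pi * L ^ 2 * ‖latticeVec L⁻¹ z + 0‖ ^ 2) : ℂ) *
      wave (latticeVec L⁻¹ z) x‖ = Real.exp (-Real.pi * L ^ 2 * ‖latticeVec L⁻¹ z + 0‖ ^ 2) := by
    rw [norm_mul, norm_wave, mul_one, Complex.norm_real, Real.norm_of_nonneg (Real.exp_nonneg _)]
  refine (norm_tsum_le_tsum_norm ?_).trans (le_of_eq (tsum_congr h7))
  simpa only [h7] using h2

lemma integrable_mul_gaussWeight_wave {f : EuclideanSpace ℝ (Fin d) → ℂ} (hf : Integrable f)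
    (k y : EuclideanSpace ℝ (Fin d)) :
    Integrable fun x => f x * ((gaussWeight L (x + y) : ℂ) * wave k (x + y)) := by
  refine hf.mul_bdd (c := 1) ?_ (Filter.Eventually.of_forall fun x => ?_)
  · exact ((continuous_gaussWeight_mul_wave k).comp
      (continuous_add_const y)).aestronglyMeasurable
  · rw [norm_gaussWeight_mul_wave]
    exact gaussWeight_le_one _

lemma summable_integral_norm_mul_gaussWeight (hL : 0 < L) {f : EuclideanSpace ℝ (Fin d) → ℂ}
    (hf : Integrable f) (k : EuclideanSpace ℝ (Fin d)) : Summable fun w : Fin d → ℤ =>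
      ∫ x, ‖f x * ((gaussWeight L (x + latticeVec L w) : ℂ) * wave k (x + latticeVec L w))‖ := by
  obtain ⟨C, hC⟩ := exists_sum_gaussWeight_le (d := d) hL
  refine summable_of_sum_le (c := ∫ x, ‖f x‖ * C) (fun w => integral_nonneg fun x => norm_nonneg _)
    fun s => ?_
  rw [← integral_finsetSum _ fun w _ => (integrable_mul_gaussWeight_wave hf k _).norm]
  refine integral_mono (integrable_finsetSum _ fun w _ =>
    (integrable_mul_gaussWeight_wave hf k _).norm) (hf.norm.mul_const C) fun x => ?_
  beta_reduce
  simp_rw [norm_mul (f x), norm_gaussWeight_mul_wave]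
  rw [← Finset.mul_sum]
  exact mul_le_mul_of_nonneg_left (hC s x) (norm_nonneg _)

/-- The Fourier transform of a periodized function times a Gaussian. -/
lemma integrable_and_integral_periodization_mul (hL : 0 < L) {f : EuclideanSpace ℝ (Fin d) → ℂ}
    (hf : Integrable f) (k : EuclideanSpace ℝ (Fin d)) :
    Integrable (fun x => (∑' w : Fin d → ℤ, f (x + latticeVec L w)) *
      ((gaussWeight L x : ℂ) * wave (-k) x)) ∧
    ∫ x, (∑' w : Fin d → ℤ, f (x + latticeVec L w)) * ((gaussWeight L x : ℂ) * wave (-k) x) =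
      ∑' z : Fin d → ℤ, (Real.exp (-Real.pi * L ^ 2 * ‖latticeVec L⁻¹ z + k‖ ^ 2) : ℂ) *
        FourierTransform.fourier f (-latticeVec L⁻¹ z) := by
  have hL1 : ((L / L : ℝ) : ℂ) ^ d = 1 := by rw [div_self hL.ne']; simp
  set G : (Fin d → ℤ) → EuclideanSpace ℝ (Fin d) → ℂ := fun w x =>
    f x * ((gaussWeight L (x + latticeVec L w) : ℂ) * wave (-k) (x + latticeVec L w)) with hG
  set F : (Fin d → ℤ) → EuclideanSpace ℝ (Fin d) → ℂ := fun w x =>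
    f (x + latticeVec L w) * ((gaussWeight L x : ℂ) * wave (-k) x) with hF
  have hFG (w : Fin d → ℤ) : F w = fun x => G (-w) (x + latticeVec L w) := by
    ext x
    simp [hF, hG, latticeVec_neg]
  have hGint (w : Fin d → ℤ) : Integrable (G w) := integrable_mul_gaussWeight_wave hf _ _
  have hFint (w : Fin d → ℤ) : Integrable (F w) := by
    rw [hFG]
    exact (hGint (-w)).comp_add_right _
  have hGsum : Summable fun w => ∫ x, ‖G w x‖ := summable_integral_norm_mul_gaussWeight hL hf _
  have hFsum : Summable fun w => ∫ x, ‖F w x‖ := by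
    refine ((Equiv.neg (Fin d → ℤ)).summable_iff.2 hGsum).congr fun w => ?_
    rw [hFG]
    exact (integral_add_right_eq_self (fun x => ‖G (-w) x‖) _).symm
  -- This needs no summability: where the periodization diverges both `tsum`s are zero, unless the
  -- factor vanishes.
  have hmul (x : EuclideanSpace ℝ (Fin d)) : (∑' w : Fin d → ℤ, f (x + latticeVec L w)) *
      ((gaussWeight L x : ℂ) * wave (-k) x) = ∑' w, F w x := tsum_mul_right.symm
  simp_rw [hmul]
  refine ⟨integrable_tsum_of_summable_integral_norm hFint hFsum, ?_⟩
  rw [← integral_tsum_of_summable_integral_norm hFint hFsum]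
  -- Translation invariance moves the lattice shift from `f` to the Gaussian.
  have h1 : ∑' w, ∫ x, F w x = ∑' w, ∫ x, G w x := by
    rw [← (Equiv.neg (Fin d → ℤ)).tsum_eq fun w => ∫ x, G w x]
    refine tsum_congr fun w => ?_
    rw [hFG]
    exact integral_add_right_eq_self (G (-w)) _
  rw [h1, integral_tsum_of_summable_integral_norm hGint hGsum]
  set H : (Fin d → ℤ) → EuclideanSpace ℝ (Fin d) → ℂ := fun z x =>
    (Real.exp (-Real.pi * L ^ 2 * ‖latticeVec L⁻¹ z + k‖ ^ 2) : ℂ) *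
      (f x * wave (latticeVec L⁻¹ z) x) with hH
  -- Poisson summation with width `s = L`, for which the factor `s / L` is one, brings in the dual
  -- lattice.
  have hGH (x : EuclideanSpace ℝ (Fin d)) : ∑' w, G w x = ∑' z, H z x := by
    have h3 := (tsum_gaussian_wave hL hL k x).2.2
    rw [hL1, one_mul] at h3
    simp only [hG, hH, gaussWeight]
    rw [tsum_mul_left, h3, ← tsum_mul_left]
    exact tsum_congr fun z => by ring
  have hw (z : Fin d → ℤ) : Integrable fun x => f x * wave (latticeVec L⁻¹ z) x :=
    hf.mul_bdd (c := 1) (continuous_wave _).aestronglyMeasurable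
      (Filter.Eventually.of_forall fun x => (norm_wave _ _).le)
  have hHint (z : Fin d → ℤ) : Integrable (H z) := (hw z).const_mul _
  have hHsum : Summable fun z => ∫ x, ‖H z x‖ := by
    refine ((tsum_gaussian_wave hL hL k 0).2.1.mul_right (∫ x, ‖f x‖)).congr fun z => ?_
    simp only [hH, norm_mul, norm_wave, mul_one, Complex.norm_real,
      Real.norm_of_nonneg (Real.exp_nonneg _)]
    rw [integral_const_mul]
  simp_rw [hGH]
  rw [← integral_tsum_of_summable_integral_norm hHint hHsum]
  refine tsum_congr fun z => ?_
  simp only [hH]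
  rw [integral_const_mul, fourier_eq_integral_wave, neg_neg]

lemma integrable_gaussWeight (hL : 0 < L) :
    Integrable (gaussWeight L : EuclideanSpace ℝ (Fin d) → ℝ) := by
  have h := GaussianFourier.integrable_cexp_neg_mul_sq_norm_add
    (V := EuclideanSpace ℝ (Fin d)) (b := ((Real.pi / L ^ 2 : ℝ) : ℂ))
    (by rw [Complex.ofReal_re]; positivity) 0 0
  refine h.norm.congr (Filter.Eventually.of_forall fun x => ?_)
  unfold gaussWeight
  beta_reduce
  rw [Complex.norm_exp]
  congr 1
  have : (-((Real.pi / L ^ 2 : ℝ) : ℂ) * (‖x‖ : ℂ) ^ 2 + 0 * (inner ℝ 0 x : ℝ)) =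
    ((-Real.pi * ‖x‖ ^ 2 / L ^ 2 : ℝ) : ℂ) := by
    push_cast
    ring
  rw [this, Complex.ofReal_re]

lemma integral_gaussWeight_mul_wave (hL : 0 < L) (k : EuclideanSpace ℝ (Fin d)) :
    ∫ x, (gaussWeight L x : ℂ) * wave k x =
      (L : ℂ) ^ d * (Real.exp (-Real.pi * L ^ 2 * ‖k‖ ^ 2) : ℂ) := by
  have hLc : (L : ℂ) ≠ 0 := by exact_mod_cast hL.ne'
  have hpi : (Real.pi : ℂ) ≠ 0 := by exact_mod_cast Real.pi_ne_zero
  have h := GaussianFourier.integral_cexp_neg_mul_sq_norm_add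
    (V := EuclideanSpace ℝ (Fin d)) (b := ((Real.pi / L ^ 2 : ℝ) : ℂ))
    (by rw [Complex.ofReal_re]; positivity) (2 * Real.pi * Complex.I) k
  have h1 (x : EuclideanSpace ℝ (Fin d)) : (gaussWeight L x : ℂ) * wave k x =
      Complex.exp (-((Real.pi / L ^ 2 : ℝ) : ℂ) * (‖x‖ : ℂ) ^ 2 +
        2 * Real.pi * Complex.I * (inner ℝ k x : ℝ)) := by
    unfold gaussWeight wave
    rw [Complex.ofReal_exp, ← Complex.exp_add]
    push_cast
    ring_nf
  simp_rw [h1]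
  rw [h]
  congr 1
  · rw [finrank_euclideanSpace_fin]
    have h2 : (Real.pi / ((Real.pi / L ^ 2 : ℝ) : ℂ)) = ((L ^ 2 : ℝ) : ℂ) := by
      push_cast
      field_simp
    rw [h2, show ((d : ℂ) / 2) = (((d : ℝ) / 2 : ℝ) : ℂ) by push_cast; ring,
      ← Complex.ofReal_cpow (by positivity), ← Complex.ofReal_pow]
    congr 1
    rw [← Real.rpow_natCast L 2, ← Real.rpow_mul hL.le, ← Real.rpow_natCast L d]
    congr 1
    push_cast
    ring
  · rw [Complex.ofReal_exp]
    congr 1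
    push_cast
    field_simp
    rw [Complex.I_sq]
    ring

/-- A periodized integrable function is almost everywhere the sum of its Fourier series, if this
series converges absolutely. -/
theorem ae_periodization_eq_fourierSeries (hL : 0 < L) {f : EuclideanSpace ℝ (Fin d) → ℂ}
    (hf : Integrable f)
    (hsum : Summable fun z : Fin d → ℤ => ‖FourierTransform.fourier f (latticeVec L⁻¹ z)‖) :
    ∀ᵐ x, ∑' w : Fin d → ℤ, f (x + latticeVec L w) = ((L : ℂ) ^ d)⁻¹ *
      ∑' z : Fin d → ℤ, FourierTransform.fourier f (latticeVec L⁻¹ z) *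
        wave (latticeVec L⁻¹ z) x := by
  have hLc : (L : ℂ) ≠ 0 := by exact_mod_cast hL.ne'
  set c : (Fin d → ℤ) → ℂ := fun z => FourierTransform.fourier f (latticeVec L⁻¹ z) with hc
  set K : EuclideanSpace ℝ (Fin d) → (Fin d → ℤ) → EuclideanSpace ℝ (Fin d) → ℂ :=
    fun k z x => ((L : ℂ) ^ d)⁻¹ * c z *
      ((gaussWeight L x : ℂ) * wave (latticeVec L⁻¹ z - k) x) with hK
  have hgw (k : EuclideanSpace ℝ (Fin d)) :
      Integrable fun x => (gaussWeight L x : ℂ) * wave k x :=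
    (integrable_gaussWeight hL).ofReal.mul_bdd (c := 1) (continuous_wave _).aestronglyMeasurable
      (Filter.Eventually.of_forall fun x => (norm_wave _ _).le)
  have hKint (k z) : Integrable (K k z) := (hgw _).const_mul _
  have hKsum (k) : Summable fun z => ∫ x, ‖K k z x‖ := by
    refine (hsum.mul_left (‖((L : ℂ) ^ d)⁻¹‖ * ∫ x, gaussWeight (d := d) L x)).congr fun z => ?_
    simp only [hK, norm_mul _ (_ * _), norm_gaussWeight_mul_wave]
    rw [integral_const_mul, norm_mul]
    ring
  have hKeq (k x) : ∑' z, K k z x = ((L : ℂ) ^ d)⁻¹ *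
      (∑' z : Fin d → ℤ, c z * wave (latticeVec L⁻¹ z) x) *
        (gaussWeight L x : ℂ) * wave (-k) x := by
    rw [mul_assoc, mul_assoc, ← tsum_mul_right, ← tsum_mul_left]
    refine tsum_congr fun z => ?_
    simp only [hK]
    rw [sub_eq_add_neg, wave_add_left]
    ring
  have h0 := integrable_and_integral_periodization_mul hL hf
  -- A nonzero periodic function is not integrable over `ℝᵈ`, but both sides become integrable after
  -- multiplication by the Gaussian, so their Fourier transforms can be compared. The positive
  -- Gaussian is cancelled at the end.
  have h : (fun x => (∑' w : Fin d → ℤ, f (x + latticeVec L w)) * (gaussWeight L x : ℂ)) =ᵐ[volume]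
      fun x => ((L : ℂ) ^ d)⁻¹ *
        (∑' z : Fin d → ℤ, c z * wave (latticeVec L⁻¹ z) x) * (gaussWeight L x : ℂ) := by
    refine ae_eq_of_forall_integral_mul_wave_eq ?_ ?_ fun k => ?_
    · simpa using (h0 0).1
    · refine (integrable_tsum_of_summable_integral_norm (hKint 0) (hKsum 0)).congr
        (Filter.Eventually.of_forall fun x => ?_)
      simp only [hKeq]
      simp
    · simp_rw [mul_assoc _ _ (wave (-k) _)]
      rw [(h0 k).2]
      simp_rw [← mul_assoc _ _ (wave (-k) _), ← hKeq]
      rw [← integral_tsum_of_summable_integral_norm (hKint k) (hKsum k),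
        ← (Equiv.neg (Fin d → ℤ)).tsum_eq]
      refine tsum_congr fun z => ?_
      simp only [hK, Equiv.neg_apply, latticeVec_neg, neg_neg]
      rw [integral_const_mul, integral_gaussWeight_mul_wave hL, ← norm_neg (_ + k), neg_add,
        neg_neg, ← sub_eq_add_neg]
      rw [show FourierTransform.fourier f (latticeVec L⁻¹ z) = c z from rfl]
      field_simp
  filter_upwards [h] with x hx
  have hg : (gaussWeight L x : ℂ) ≠ 0 := by exact_mod_cast (gaussWeight_pos x).ne'
  exact mul_right_cancel₀ hg hx

end periodization

/-! ### Characteristic functions of the Wiener measures -/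

lemma IsBrownianBridge.integral_exp_sum {d : ℕ} {D T : ℝ} {x y : EuclideanSpace ℝ (Fin d)}
    {μ : Measure (Trajectory d T)} (h : IsBrownianBridge D T x y μ) {M : Type*} [Fintype M]
    (s : M → Set.Icc (0 : ℝ) T) (c : M → EuclideanSpace ℝ (Fin d)) :
    ∫ ω, Complex.exp (((∑ j, inner ℝ (c j) (ω (s j)) : ℝ) : ℂ) * Complex.I) ∂μ =
      Complex.exp (((∑ j, inner ℝ (c j) (x + ((s j : ℝ) / T) • (y - x)) : ℝ) : ℂ) * Complex.I -
        ((D / 2 * ∑ j, ∑ j', (min (s j : ℝ) (s j') - (s j : ℝ) * (s j') / T) *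
          inner ℝ (c j) (c j') : ℝ) : ℂ)) := by
  set e := (Fintype.equivFin M).symm
  have := h.charFun_eq _ (s ∘ e) (c ∘ e)
  simp only [Function.comp_apply] at this
  have h1 (ω : Trajectory d T) : ∑ j, inner ℝ (c (e j)) (ω (s (e j))) =
      ∑ j, inner ℝ (c j) (ω (s j)) := e.sum_comp fun j => inner ℝ (c j) (ω (s j))
  simp_rw [h1] at this
  rw [this, e.sum_comp fun j => inner ℝ (c j) (x + ((s j : ℝ) / T) • (y - x)),
    e.sum_comp fun j => ∑ j', (min (s j : ℝ) (s (e j')) - (s j : ℝ) * (s (e j')) / T) *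
      inner ℝ (c j) (c (e j'))]
  congr 4
  refine Finset.sum_congr rfl fun j _ => ?_
  exact e.sum_comp fun j' => (min (s j : ℝ) (s j') - (s j : ℝ) * (s j') / T) *
      inner ℝ (c j) (c j')

lemma position_of_mem {d : ℕ} {T : ℝ} (ω : Trajectory d T) {s : ℝ} (hs : s ∈ Set.Icc 0 T) :
    position ω s = ω ⟨s, hs⟩ := dif_pos hs

lemma thermalLength_pos {ħ m₀ t : ℝ} (hħ : 0 < ħ) (hm₀ : 0 < m₀) (ht : 0 < t) :
    0 < thermalLength ħ m₀ t := by
  have := Real.pi_pos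
  unfold thermalLength
  positivity

lemma thermalLength_sq {ħ m₀ t : ℝ} (hm₀ : 0 < m₀) (ht : 0 < t) :
    thermalLength ħ m₀ t ^ 2 = 2 * Real.pi * ħ ^ 2 * t / m₀ := by
  have := Real.pi_pos
  unfold thermalLength
  rw [Real.sq_sqrt (by positivity)]

lemma measurable_trajectory_eval {d : ℕ} {T : ℝ} (s : Set.Icc (0 : ℝ) T) :
    Measurable fun ω : Trajectory d T => ω s :=
  (measurable_pi_apply s).comp (comap_measurable _)

lemma measurable_position {d : ℕ} {T : ℝ} (s : ℝ) :
    Measurable fun ω : Trajectory d T => position ω s := by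
  by_cases hs : s ∈ Set.Icc 0 T
  · simp_rw [position_of_mem _ hs]
    exact measurable_trajectory_eval _
  · simp only [position, dif_neg hs]
    exact measurable_const

section torus
variable {d : ℕ} {ħ m₀ T L : ℝ}

lemma isProbabilityMeasure_bridgeLaw (hm₀ : 0 < m₀) (hT : 0 < T)
    (x y : EuclideanSpace ℝ (Fin d)) : IsProbabilityMeasure (bridgeLaw (ħ ^ 2 / m₀) T x y) :=
  (isBrownianBridge_bridgeLaw (by positivity) hT x y).isProbabilityMeasure

/-- The bridges are probability measures, so the total mass is the lattice sum of the heat kernel,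
which converges. -/
lemma isFiniteMeasure_torusWienerMeasure (hħ : 0 < ħ) (hm₀ : 0 < m₀) (hT : 0 < T) (hL : 0 < L)
    (x y : EuclideanSpace ℝ (Fin d)) : IsFiniteMeasure (torusWienerMeasure ħ m₀ L T x y) := by
  have := isProbabilityMeasure_bridgeLaw (d := d) (ħ := ħ) hm₀ hT
  have hl := thermalLength_pos hħ hm₀ hT
  constructor
  unfold torusWienerMeasure wienerMeasure
  rw [Measure.sum_apply _ MeasurableSet.univ]
  simp only [Measure.smul_apply, measure_univ, smul_eq_mul, mul_one]
  have h := (tsum_gaussian_wave hL hl 0 (y - x)).1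
  rw [← ENNReal.ofReal_tsum_of_nonneg (fun w => by positivity)]
  · exact ENNReal.ofReal_lt_top
  · refine (h.mul_left ((thermalLength ħ m₀ T)⁻¹ ^ d)).congr fun w => ?_
    rw [add_sub_right_comm]

/-- Expectations with respect to the Wiener measure on the torus. -/
lemma integral_torusWienerMeasure (hħ : 0 < ħ) (hm₀ : 0 < m₀) (hT : 0 < T) (hL : 0 < L)
    (x y : EuclideanSpace ℝ (Fin d)) {f : Trajectory d T → ℂ} (hf : Measurable f)
    (hf1 : ∀ ω, ‖f ω‖ ≤ 1) :
    ∫ ω, f ω ∂torusWienerMeasure ħ m₀ L T x y =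
      ∑' w : Fin d → ℤ, (((thermalLength ħ m₀ T)⁻¹ ^ d * Real.exp (-Real.pi *
        ‖y - x + latticeVec L w‖ ^ 2 / thermalLength ħ m₀ T ^ 2) : ℝ) : ℂ) *
          ∫ ω, f ω ∂bridgeLaw (ħ ^ 2 / m₀) T x (y + latticeVec L w) := by
  have := isFiniteMeasure_torusWienerMeasure hħ hm₀ hT hL x y
  have hl := thermalLength_pos hħ hm₀ hT
  have hint : Integrable f (torusWienerMeasure ħ m₀ L T x y) :=
    (integrable_const (1 : ℝ)).mono' hf.aestronglyMeasurable (Filter.Eventually.of_forall hf1)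
  unfold torusWienerMeasure at hint ⊢
  rw [← (hasSum_integral_measure hint).tsum_eq]
  refine tsum_congr fun w => ?_
  unfold wienerMeasure
  rw [integral_smul_measure, ENNReal.toReal_ofReal (by positivity), add_sub_right_comm,
    Complex.real_smul]

end torus

/-- The expectation of a product of plane waves along a trajectory on the torus. -/
theorem integral_exp_torusWienerMeasure {d : ℕ} {ħ m₀ β L : ℝ} (hħ : 0 < ħ) (hm₀ : 0 < m₀)
    (hβ : 0 < β) (hL : 0 < L) {n : ℕ} (hn : 1 ≤ n) (x ξ : EuclideanSpace ℝ (Fin d))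
    {M : Type*} [Fintype M] (v : M → ℝ) (hv : ∀ m, v m ∈ Set.Icc (0 : ℝ) n)
    (A : M → EuclideanSpace ℝ (Fin d)) :
    ∫ ω, Complex.exp (((2 * Real.pi * ∑ m, inner ℝ (A m) (position ω (v m * β)) : ℝ) : ℂ) *
        Complex.I) ∂torusWienerMeasure ħ m₀ L (n * β) x (x + ξ) =
      wave (∑ m, A m) x * ((L : ℂ) ^ d)⁻¹ * ∑' w : Fin d → ℤ,
        (Real.exp (-(Real.pi * thermalLength ħ m₀ β ^ 2) * (n * ‖latticeVec L⁻¹ w‖ ^ 2 -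
          2 * ∑ m, v m * inner ℝ (latticeVec L⁻¹ w) (A m) +
          ∑ m, ∑ m', min (v m) (v m') * inner ℝ (A m) (A m'))) : ℂ) *
        wave (latticeVec L⁻¹ w) ξ := by
  have hn0 : (0 : ℝ) < n := by exact_mod_cast hn
  have hT : 0 < n * β := by positivity
  have hl := thermalLength_pos hħ hm₀ hT
  have hpi := Real.pi_pos
  have hlc : (thermalLength ħ m₀ (n * β) : ℂ) ≠ 0 := by exact_mod_cast hl.ne'
  have hLc : (L : ℂ) ≠ 0 := by exact_mod_cast hL.ne'
  rw [integral_torusWienerMeasure hħ hm₀ hT hL]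
  rotate_left
  · have := fun m => measurable_position (d := d) (T := n * β) (v m * β)
    fun_prop
  · exact fun ω => (Complex.norm_exp_ofReal_mul_I _).le
  have hs (m : M) : v m * β ∈ Set.Icc 0 (n * β) :=
    ⟨mul_nonneg (hv m).1 hβ.le, mul_le_mul_of_nonneg_right (hv m).2 hβ.le⟩
  -- The mean of the bridge at time `v_m β` is `x + (v_m / n)(ξ + Lw)`. So the winding enters only
  -- through a plane wave with the averaged wave vector `B`, and the covariance gives the factor
  -- `exp (-Q)`, independent of `w`.
  set B : EuclideanSpace ℝ (Fin d) := ∑ m, (v m / n) • A m with hB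
  set Q : ℝ := Real.pi * thermalLength ħ m₀ β ^ 2 *
    ∑ m, ∑ m', (min (v m) (v m') - v m * v m' / n) * inner ℝ (A m) (A m') with hQ
  have h1 (w : Fin d → ℤ) : ∫ ω, Complex.exp (((2 * Real.pi *
        ∑ m, inner ℝ (A m) (position ω (v m * β)) : ℝ) : ℂ) * Complex.I)
        ∂bridgeLaw (ħ ^ 2 / m₀) (n * β) x (x + ξ + latticeVec L w) =
      wave (∑ m, A m) x * wave B (ξ + latticeVec L w) * (Real.exp (-Q) : ℂ) := by
    have h2 := (isBrownianBridge_bridgeLaw (D := ħ ^ 2 / m₀) (by positivity) hT x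
      (x + ξ + latticeVec L w)).integral_exp_sum (fun m => ⟨v m * β, hs m⟩)
      (fun m => (2 * Real.pi) • A m)
    have h3 (ω : Trajectory d (n * β)) : 2 * Real.pi *
        ∑ m, inner ℝ (A m) (position ω (v m * β)) =
        ∑ m, inner ℝ ((2 * Real.pi) • A m) (ω ⟨v m * β, hs m⟩) := by
      rw [Finset.mul_sum]
      refine Finset.sum_congr rfl fun m _ => ?_
      rw [real_inner_smul_left, position_of_mem _ (hs m)]
    simp_rw [h3]
    rw [h2, wave, wave, Complex.ofReal_exp, ← Complex.exp_add, ← Complex.exp_add, sub_eq_add_neg,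
      ← add_mul, ← Complex.ofReal_add, ← Complex.ofReal_neg]
    congr 3
    · congr 1
      rw [hB, sum_inner, sum_inner, Finset.mul_sum, Finset.mul_sum, ← Finset.sum_add_distrib]
      refine Finset.sum_congr rfl fun m _ => ?_
      rw [real_inner_smul_left, inner_add_right, real_inner_smul_right, real_inner_smul_left,
        add_assoc, add_sub_cancel_left, mul_div_mul_right _ _ hβ.ne']
      ring
    · rw [hQ, thermalLength_sq hm₀ hβ, neg_inj, Finset.mul_sum, Finset.mul_sum]
      refine Finset.sum_congr rfl fun m _ => ?_
      rw [Finset.mul_sum, Finset.mul_sum]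
      refine Finset.sum_congr rfl fun m' _ => ?_
      rw [real_inner_smul_left, real_inner_smul_right, ← min_mul_of_nonneg _ _ hβ.le]
      field_simp
  have h4 (w : Fin d → ℤ) : (((thermalLength ħ m₀ (n * β))⁻¹ ^ d * Real.exp (-Real.pi *
        ‖x + ξ - x + latticeVec L w‖ ^ 2 / thermalLength ħ m₀ (n * β) ^ 2) : ℝ) : ℂ) *
      (wave (∑ m, A m) x * wave B (ξ + latticeVec L w) * (Real.exp (-Q) : ℂ)) =
      ((thermalLength ħ m₀ (n * β) : ℂ)⁻¹ ^ d * wave (∑ m, A m) x * (Real.exp (-Q) : ℂ)) *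
      ((Real.exp (-Real.pi * ‖ξ + latticeVec L w‖ ^ 2 / thermalLength ħ m₀ (n * β) ^ 2) : ℂ) *
        wave (-(-B)) (ξ + latticeVec L w)) := by
    rw [add_sub_cancel_left, neg_neg, Complex.ofReal_mul, Complex.ofReal_pow, Complex.ofReal_inv]
    ring
  simp_rw [h1, h4]
  rw [tsum_mul_left, (tsum_gaussian_wave hL hl (-B) ξ).2.2]
  -- Since `λ_{nβ}² = n λ_β²`, expanding the square yields a term `n ‖B‖²`, which cancels the part
  -- `-v_m v_m' / n` of the bridge covariance and leaves only `min (v_m) (v_m')`.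
  have h5 (z : Fin d → ℤ) : Real.exp (-(Real.pi * thermalLength ħ m₀ β ^ 2) *
      (n * ‖latticeVec L⁻¹ z‖ ^ 2 - 2 * ∑ m, v m * inner ℝ (latticeVec L⁻¹ z) (A m) +
        ∑ m, ∑ m', min (v m) (v m') * inner ℝ (A m) (A m'))) = Real.exp (-Q) *
      Real.exp (-Real.pi * thermalLength ħ m₀ (n * β) ^ 2 * ‖latticeVec L⁻¹ z + -B‖ ^ 2) := by
    rw [← Real.exp_add]
    congr 1
    have h6 : ‖B‖ ^ 2 = ∑ m, ∑ m', v m * v m' / n / n * inner ℝ (A m) (A m') := by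
      rw [← real_inner_self_eq_norm_sq, hB, sum_inner]
      refine Finset.sum_congr rfl fun m _ => ?_
      rw [inner_sum]
      refine Finset.sum_congr rfl fun m' _ => ?_
      rw [real_inner_smul_left, real_inner_smul_right]
      ring
    have h7 : inner ℝ (latticeVec L⁻¹ z) B =
        (∑ m, v m * inner ℝ (latticeVec L⁻¹ z) (A m)) / n := by
      rw [hB, inner_sum, Finset.sum_div]
      refine Finset.sum_congr rfl fun m _ => ?_
      rw [real_inner_smul_right]
      ring
    have h8 : ∑ m, ∑ m', (min (v m) (v m') - v m * v m' / n) * inner ℝ (A m) (A m') =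
        ∑ m, ∑ m', min (v m) (v m') * inner ℝ (A m) (A m') - n * ‖B‖ ^ 2 := by
      rw [h6, Finset.mul_sum, ← Finset.sum_sub_distrib]
      refine Finset.sum_congr rfl fun m _ => ?_
      rw [Finset.mul_sum, ← Finset.sum_sub_distrib]
      refine Finset.sum_congr rfl fun m' _ => ?_
      field_simp
    have h9 : thermalLength ħ m₀ (n * β) ^ 2 = n * thermalLength ħ m₀ β ^ 2 := by
      rw [thermalLength_sq hm₀ hT, thermalLength_sq hm₀ hβ]
      ring
    rw [← sub_eq_add_neg, norm_sub_sq_real, h7, hQ, h8, h9]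
    field_simp
    ring
  simp_rw [h5]
  have h10 (z : Fin d → ℤ) : ((Real.exp (-Q) * Real.exp (-Real.pi *
      thermalLength ħ m₀ (n * β) ^ 2 * ‖latticeVec L⁻¹ z + -B‖ ^ 2) : ℝ) : ℂ) *
      wave (latticeVec L⁻¹ z) ξ = (Real.exp (-Q) : ℂ) * ((Real.exp (-Real.pi *
      thermalLength ħ m₀ (n * β) ^ 2 * ‖latticeVec L⁻¹ z + -B‖ ^ 2) : ℂ) *
      wave (latticeVec L⁻¹ z) ξ) := by
    rw [Complex.ofReal_mul]
    ring
  simp_rw [h10]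
  rw [tsum_mul_left, Complex.ofReal_div, div_pow, inv_pow]
  field_simp

/-! ### Numbering of the particles -/

section particles
variable {p : ℕ} (n : Fin (p + 1) → ℕ)

/-- The number of particles in the first `m` cycles. -/
def countFirst (m : ℕ) : ℕ := ∑ l ∈ Finset.univ.filter fun l : Fin (p + 1) => (l : ℕ) < m, n l

lemma countBefore_eq_countFirst (l : Fin (p + 1)) : countBefore n l = countFirst n l := by
  unfold countBefore countFirst
  congr 1
  ext l'
  simp

lemma countUpTo_eq_countFirst (l : Fin (p + 1)) : countUpTo n l = countFirst n (l + 1) := by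
  unfold countUpTo countFirst
  congr 1
  ext l'
  rw [Finset.mem_Iic, Finset.mem_filter_univ, Fin.le_iff_val_le_val, Nat.lt_succ_iff]

lemma countFirst_last : countFirst n (p + 1) = ∑ l, n l := by
  unfold countFirst
  congr 1
  ext l
  simp only [Finset.mem_filter_univ, Finset.mem_univ, l.2]

lemma filter_lt_succ (l : Fin (p + 1)) :
    (Finset.univ.filter fun l' : Fin (p + 1) => (l' : ℕ) < l + 1) =
      insert l (Finset.univ.filter fun l' : Fin (p + 1) => (l' : ℕ) < l) := by
  ext l'
  simp only [Finset.mem_filter_univ, Finset.mem_insert, Fin.ext_iff]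
  omega

lemma countFirst_succ (l : Fin (p + 1)) : countFirst n (l + 1) = countFirst n l + n l := by
  unfold countFirst
  rw [filter_lt_succ, Finset.sum_insert (by simp), add_comm]

lemma countUpTo_eq (l : Fin (p + 1)) : countUpTo n l = countBefore n l + n l := by
  rw [countUpTo_eq_countFirst, countBefore_eq_countFirst, countFirst_succ]

lemma countUpTo_le (l : Fin (p + 1)) : countUpTo n l ≤ ∑ l, n l :=
  Finset.sum_le_sum_of_subset (Finset.subset_univ _)

/-- The numbering runs through the cycles one after another, so the sum splits by induction on the
number `m` of cycles. -/
lemma sum_range_countFirst {G : Type*} [AddCommMonoid G] (f : ℕ → G) {m : ℕ} (hm : m ≤ p + 1) :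
    ∑ q ∈ Finset.range (countFirst n m), f q =
      ∑ l ∈ Finset.univ.filter fun l : Fin (p + 1) => (l : ℕ) < m,
        ∑ i ∈ Finset.range (n l), f (countBefore n l + i) := by
  induction m with
  | zero => simp [countFirst]
  | succ m ih =>
    have h := filter_lt_succ (⟨m, hm⟩ : Fin (p + 1))
    have h2 := countFirst_succ n (⟨m, hm⟩ : Fin (p + 1))
    have h3 := countBefore_eq_countFirst n (⟨m, hm⟩ : Fin (p + 1))
    dsimp only at h h2 h3
    rw [h, Finset.sum_insert (by simp), h2, Finset.sum_range_add, ih (by omega), add_comm, h3]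

lemma sum_range_total {G : Type*} [AddCommMonoid G] (f : ℕ → G) :
    ∑ q ∈ Finset.range (∑ l, n l), f q =
      ∑ l, ∑ i ∈ Finset.range (n l), f (countBefore n l + i) := by
  rw [← countFirst_last, sum_range_countFirst n f le_rfl]
  congr 1
  ext l
  simp only [Finset.mem_filter_univ, Finset.mem_univ, l.2]

lemma sum_range_countBefore {G : Type*} [AddCommMonoid G] (f : ℕ → G) (l : Fin (p + 1)) :
    ∑ q ∈ Finset.range (countBefore n l), f q =
      ∑ l' ∈ Finset.Iio l, ∑ i ∈ Finset.range (n l'), f (countBefore n l' + i) := by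
  rw [countBefore_eq_countFirst, sum_range_countFirst n f l.2.le]
  congr 1
  ext l'
  simp

lemma sum_pairs {G : Type*} [AddCommMonoid G] (N : ℕ) (f : ℕ → ℕ → G) :
    ∑ e ∈ pairs N, f e.1 e.2 = ∑ k ∈ Finset.range N, ∑ j ∈ Finset.range k, f (j + 1) (k + 1) := by
  rw [Finset.sum_sigma']
  refine Finset.sum_bij' (fun e _ => ⟨e.2 - 1, e.1 - 1⟩) (fun x _ => (x.2 + 1, x.1 + 1)) ?_ ?_ ?_
    ?_ ?_
  · intro e he
    simp only [pairs, Finset.mem_filter, Finset.mem_product, Finset.mem_Icc] at he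
    simp only [Finset.mem_sigma, Finset.mem_range]
    omega
  · intro x hx
    simp only [Finset.mem_sigma, Finset.mem_range] at hx
    simp only [pairs, Finset.mem_filter, Finset.mem_product, Finset.mem_Icc]
    omega
  · intro e he
    simp only [pairs, Finset.mem_filter, Finset.mem_product, Finset.mem_Icc] at he
    ext <;> simp <;> omega
  · intro x _
    simp
  · intro e he
    simp only [pairs, Finset.mem_filter, Finset.mem_product, Finset.mem_Icc] at he
    dsimp only
    rw [Nat.sub_add_cancel he.1.1.1, Nat.sub_add_cancel he.1.2.1]

/-- The pairs of particles are the pairs in the same cycle and the pairs in two cycles. -/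
lemma sum_pairs_eq_sum_cycles {G : Type*} [AddCommMonoid G] (f : ℕ → ℕ → G) :
    ∑ e ∈ pairs (∑ l, n l), f e.1 e.2 =
      ∑ l, (∑ k ∈ Finset.range (n l), ∑ j ∈ Finset.range k,
        f (countBefore n l + j + 1) (countBefore n l + k + 1)) +
      ∑ l, ∑ l' ∈ Finset.Iio l, ∑ j ∈ Finset.range (n l'), ∑ k ∈ Finset.range (n l),
        f (countBefore n l' + j + 1) (countBefore n l + k + 1) := by
  rw [sum_pairs, sum_range_total, ← Finset.sum_add_distrib]
  refine Finset.sum_congr rfl fun l _ => ?_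
  -- The particles before particle `k` of cycle `l` are those of the earlier cycles and the first
  -- `k` of cycle `l`.
  simp_rw [Finset.sum_range_add, Finset.sum_add_distrib, sum_range_countBefore]
  rw [add_comm]
  congr 1
  rw [Finset.sum_comm]
  exact Finset.sum_congr rfl fun l' _ => Finset.sum_comm

lemma card_pairs (N : ℕ) : ((pairs N).card : ℝ) = N * (N - 1) / 2 := by
  have h := sum_pairs N fun _ _ => (1 : ℝ)
  simp only [Finset.sum_const, nsmul_eq_mul, mul_one, Finset.card_range] at h
  rw [h]
  clear h
  induction N with
  | zero => simp
  | succ N ih =>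
    rw [Finset.sum_range_succ, ih]
    push_cast
    ring

lemma sum_ite_particle (b i₀ m k : ℕ) :
    ∑ i ∈ Finset.range m, (if i₀ ≤ i then (if k = b + i + 1 then (1 : ℤ) else 0) else 0) =
      if b + i₀ + 1 ≤ k ∧ k ≤ b + m then 1 else 0 := by
  simp_rw [← ite_and]
  by_cases h : b + i₀ + 1 ≤ k ∧ k ≤ b + m
  · rw [if_pos h, Finset.sum_eq_single (k - b - 1)]
    · rw [if_pos]
      omega
    · intro i _ hi
      rw [if_neg]
      omega
    · intro hi
      rw [Finset.mem_range] at hi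
      omega
  · rw [if_neg h]
    refine Finset.sum_eq_zero fun i hi => ?_
    rw [Finset.mem_range] at hi
    rw [if_neg]
    omega

/-- The sign with which particle `i` of cycle `l` enters `x_k - x_j`, for a pair `e = (j, k)`. -/
def pairSign (l : Fin (p + 1)) (i : ℕ) (e : ℕ × ℕ) : ℤ :=
  (if e.2 = countBefore n l + i + 1 then 1 else 0) -
    (if e.1 = countBefore n l + i + 1 then 1 else 0)

/-- Conservation of momentum: of all particles, exactly one carries the sign `+1` and exactly one
the sign `-1`. -/
lemma sum_sum_pairSign {e : ℕ × ℕ} (he : e ∈ pairs (∑ l, n l)) :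
    ∑ l, ∑ i ∈ Finset.range (n l), pairSign n l i e = 0 := by
  simp only [pairs, Finset.mem_filter, Finset.mem_product, Finset.mem_Icc] at he
  have h (q : ℕ) (hq : 1 ≤ q ∧ q ≤ ∑ l, n l) : ∑ l, ∑ i ∈ Finset.range (n l),
      (if q = countBefore n l + i + 1 then (1 : ℤ) else 0) = 1 := by
    rw [← sum_range_total n fun r => if q = r + 1 then (1 : ℤ) else 0,
      Finset.sum_eq_single (q - 1)]
    · rw [if_pos]
      omega
    · intro i _ hi
      rw [if_neg]
      omega
    · intro hi
      rw [Finset.mem_range] at hi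
      omega
  simp_rw [pairSign, Finset.sum_sub_distrib]
  rw [h _ he.1.1, h _ he.1.2, sub_self]

end particles

/-! ### The shifts `Z_q` -/

/-- Brings the four double sums in `shift`, over different rectangles of indices, to sums over the
same index type, so that they can be compared pair by pair. -/
lemma sum_sum_dite_pairs {G : Type*} [AddCommMonoid G] {N : ℕ} (F : pairs N → G)
    (A B : Finset ℕ) :
    ∑ j ∈ A, ∑ k ∈ B, (if h : (j, k) ∈ pairs N then F ⟨(j, k), h⟩ else 0) =
      ∑ e : pairs N, if e.1.1 ∈ A ∧ e.1.2 ∈ B then F e else 0 := by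
  set g : ℕ × ℕ → G := fun e => if h : e ∈ pairs N then F ⟨e, h⟩ else 0 with hg
  have h1 (e : pairs N) : (if e.1.1 ∈ A ∧ e.1.2 ∈ B then F e else 0) =
      (fun e : ℕ × ℕ => if e ∈ A ×ˢ B then g e else 0) e := by
    simp [hg, Finset.mem_product]
  simp_rw [h1]
  rw [Finset.sum_coe_sort (pairs N) fun e => if e ∈ A ×ˢ B then g e else 0, Finset.sum_ite_mem,
    ← Finset.sum_product' A B fun j k => g (j, k), Finset.inter_comm, ← Finset.sum_ite_mem]
  refine Finset.sum_congr rfl fun e _ => ?_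
  by_cases he : e ∈ pairs N <;> simp [hg, he]

section shift
variable {d p : ℕ} (n : Fin (p + 1) → ℕ) {α : Multiplicities (∑ l, n l)}

/-- `Z_q(t)` as the sum over the later times at which the plane waves of the cycle are
evaluated. -/
lemma shift_eq_sum (z : Vectors d α) (τ : Times α) (l : Fin (p + 1)) (i₀ : ℕ) (t : ℝ) :
    shift n z τ l (countBefore n l + i₀ + 1) t =
      -∑ e : pairs (∑ l, n l), ∑ r : Fin (α e), ∑ i ∈ Finset.range (n l),
        (if (t ≤ τ e r ∧ i₀ ≤ i) ∨ i₀ < i then pairSign n l i e else 0) •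
          (z e r : Fin d → ℤ) := by
  have hcu := countUpTo_eq n l
  have hN := countUpTo_le n l
  unfold shift lateSum earlySum
  rw [sum_sum_dite_pairs (fun e => ∑ r, if τ e r ≥ t then (z e r : Fin d → ℤ) else 0),
    sum_sum_dite_pairs (fun e => ∑ r, if τ e r ≥ t then (z e r : Fin d → ℤ) else 0),
    sum_sum_dite_pairs (fun e => ∑ r, if τ e r < t then (z e r : Fin d → ℤ) else 0),
    sum_sum_dite_pairs (fun e => ∑ r, if τ e r < t then (z e r : Fin d → ℤ) else 0),
    ← Finset.sum_neg_distrib, ← Finset.sum_neg_distrib, ← Finset.sum_add_distrib,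
    ← Finset.sum_sub_distrib, ← Finset.sum_add_distrib]
  refine Finset.sum_congr rfl fun e _ => ?_
  obtain ⟨⟨j, k⟩, he⟩ := e
  have he' := he
  simp only [pairs, Finset.mem_filter, Finset.mem_product, Finset.mem_Icc] at he'
  simp only [← Finset.sum_smul]
  have hite (P : Prop) [Decidable P] (f : Fin (α ⟨(j, k), he⟩) → Fin d → ℤ) :
      (if P then ∑ r, f r else 0) = ∑ r, if P then f r else 0 := by
    split_ifs <;> simp
  simp only [hite, ← Finset.sum_neg_distrib, ← Finset.sum_add_distrib, ← Finset.sum_sub_distrib]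
  refine Finset.sum_congr rfl fun r _ => ?_
  -- The signs of the particles from `i₁` on add up to the indicator that `k` is one of them minus
  -- the indicator that `j` is.
  have hcoef (i₁ : ℕ) : ∑ i ∈ Finset.range (n l), (if i₁ ≤ i then pairSign n l i (j, k) else 0) =
      (if countBefore n l + i₁ + 1 ≤ k ∧ k ≤ countUpTo n l then 1 else 0) -
      (if countBefore n l + i₁ + 1 ≤ j ∧ j ≤ countUpTo n l then 1 else 0) := by
    rw [hcu, ← sum_ite_particle, ← sum_ite_particle, ← Finset.sum_sub_distrib]
    refine Finset.sum_congr rfl fun i _ => ?_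
    unfold pairSign
    split_ifs <;> simp
  -- A wave at a time at least `t` is still ahead of particle `i₀` itself; an earlier one is ahead
  -- only when it sits on a later particle. These two cases are the late and the early sums, and
  -- after `hcoef` each is a comparison of inequalities between `j`, `k` and the ends of the cycle.
  rcases le_or_gt t (τ ⟨(j, k), he⟩ r) with h | h
  · have h1 : ∑ i ∈ Finset.range (n l), (if (t ≤ τ ⟨(j, k), he⟩ r ∧ i₀ ≤ i) ∨ i₀ < i then
        pairSign n l i (j, k) else 0) =
        ∑ i ∈ Finset.range (n l), (if i₀ ≤ i then pairSign n l i (j, k) else 0) := by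
      refine Finset.sum_congr rfl fun i _ => if_congr ?_ rfl rfl
      constructor
      · rintro (h' | h')
        exacts [h'.2, h'.le]
      · exact fun h' => Or.inl ⟨h, h'⟩
    rw [h1, hcoef, if_pos h, if_neg (not_lt.2 h)]
    simp only [Finset.mem_Icc, ite_self, sub_zero, add_zero]
    generalize countUpTo n l = cu at *
    generalize countBefore n l = cb at *
    generalize (z ⟨(j, k), he⟩ r : Fin d → ℤ) = Z
    split_ifs <;> first | (exfalso; omega) | simp
  · have h1 : ∑ i ∈ Finset.range (n l), (if (t ≤ τ ⟨(j, k), he⟩ r ∧ i₀ ≤ i) ∨ i₀ < i then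
        pairSign n l i (j, k) else 0) =
        ∑ i ∈ Finset.range (n l), (if i₀ + 1 ≤ i then pairSign n l i (j, k) else 0) := by
      refine Finset.sum_congr rfl fun i _ => if_congr ?_ rfl rfl
      constructor
      · rintro (h' | h')
        exacts [absurd h'.1 (not_le.2 h), h']
      · exact fun h' => Or.inr h'
    rw [h1, hcoef, if_neg (not_le.2 h), if_pos h]
    simp only [Finset.mem_Icc, ite_self, neg_zero, zero_add, zero_sub]
    generalize countUpTo n l = cu at *
    generalize countBefore n l = cb at *
    generalize (z ⟨(j, k), he⟩ r : Fin d → ℤ) = Z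
    split_ifs <;> first | (exfalso; omega) | simp

lemma initialShift_eq_sum (z : Vectors d α) {τ : Times α} (hτ : τ ∈ unitTimes α)
    (l : Fin (p + 1)) :
    initialShift n z τ l = -∑ e : pairs (∑ l, n l), ∑ r : Fin (α e), ∑ i ∈ Finset.range (n l),
        pairSign n l i e • (z e r : Fin d → ℤ) := by
  have h := shift_eq_sum n z τ l 0 0
  rw [add_zero] at h
  unfold initialShift
  rw [h]
  congr 1
  refine Finset.sum_congr rfl fun e _ => Finset.sum_congr rfl fun r _ =>
    Finset.sum_congr rfl fun i _ => ?_
  rw [if_pos (Or.inl ⟨(hτ e r).1, Nat.zero_le _⟩)]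

/-- By conservation of momentum the constraint of cycle `0` follows once all the others hold. -/
lemma sum_initialShift (z : Vectors d α) {τ : Times α} (hτ : τ ∈ unitTimes α) :
    ∑ l, initialShift n z τ l = 0 := by
  simp_rw [initialShift_eq_sum n z hτ]
  rw [Finset.sum_neg_distrib, neg_eq_zero, Finset.sum_comm]
  refine Finset.sum_eq_zero fun e _ => ?_
  rw [Finset.sum_comm]
  refine Finset.sum_eq_zero fun r _ => ?_
  simp_rw [← Finset.sum_smul]
  rw [sum_sum_pairSign n e.2, zero_smul]

/-- At `t = 0` all times in `[0, 1]` are late, so the early sums vanish and the late sums are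
complete. -/
lemma initialShift_eq_totalSum (z : Vectors d α) {τ : Times α} (hτ : τ ∈ unitTimes α)
    (l : Fin (p + 1)) : initialShift n z τ l =
      - ∑ j ∈ Finset.Icc 1 (countBefore n l), ∑ k ∈ cycle n l, totalSum z j k
      + ∑ j ∈ cycle n l, ∑ k ∈ Finset.Icc (countUpTo n l + 1) (∑ l, n l), totalSum z j k := by
  have h1 (j k : ℕ) : lateSum z τ 0 j k = totalSum z j k := by
    unfold lateSum totalSum
    split_ifs with h
    · exact Finset.sum_congr rfl fun r _ => if_pos (hτ _ r).1
    · rfl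
  have h2 (j k : ℕ) : earlySum z τ 0 j k = 0 := by
    unfold earlySum
    split_ifs with h
    · exact Finset.sum_eq_zero fun r _ => if_neg (not_lt.2 (hτ _ r).1)
    · rfl
  unfold initialShift shift cycle
  simp [h1, h2]

end shift

/-! ### The weights of the cycles -/

lemma intervalIntegrable_ite_le (a b v c : ℝ) :
    IntervalIntegrable (fun s : ℝ => if s ≤ v then c else 0) volume a b := by
  have h : (fun s : ℝ => if s ≤ v then c else 0) = (Set.Iic v).indicator fun _ => c := by
    ext s
    simp [Set.indicator]
  have h2 : IntervalIntegrable (fun _ : ℝ => c) volume a b := intervalIntegrable_const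
  rw [intervalIntegrable_iff] at h2 ⊢
  rw [h]
  exact h2.indicator measurableSet_Iic

lemma integral_ite_le {N v : ℝ} (hv : v ∈ Set.Icc 0 N) (c : ℝ) :
    ∫ s in (0 : ℝ)..N, (if s ≤ v then c else 0) = v * c := by
  rw [intervalIntegral.integral_of_le (hv.1.trans hv.2)]
  have h : (fun s : ℝ => if s ≤ v then c else 0) = (Set.Iic v).indicator fun _ => c := by
    ext s
    simp [Set.indicator]
  rw [h, setIntegral_indicator measurableSet_Iic, Set.Ioc_inter_Iic, min_eq_right hv.2,
    setIntegral_const, Measure.real, Real.volume_Ioc, sub_zero, ENNReal.toReal_ofReal hv.1,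
    smul_eq_mul]

/-- The integrated square of a step function. -/
lemma integral_sq_sub_step {d : ℕ} {M : Type*} [Fintype M] {N : ℝ} (w : Fin d → ℝ)
    (a : M → Fin d → ℝ) (v : M → ℝ) (hv : ∀ m, v m ∈ Set.Icc 0 N) :
    IntervalIntegrable (fun s : ℝ => ∑ c, (w c - ∑ m, if s ≤ v m then a m c else 0) ^ 2)
      volume 0 N ∧
    ∫ s in (0 : ℝ)..N, ∑ c, (w c - ∑ m, if s ≤ v m then a m c else 0) ^ 2 =
      N * ∑ c, w c ^ 2 - 2 * ∑ m, v m * ∑ c, w c * a m c +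
        ∑ m, ∑ m', min (v m) (v m') * ∑ c, a m c * a m' c := by
  -- In the expanded square, the product of the indicators of `s ≤ v` and `s ≤ v'` is the indicator
  -- of `s ≤ min v v'`.
  have h1 (s : ℝ) : ∑ c, (w c - ∑ m, if s ≤ v m then a m c else 0) ^ 2 =
      ∑ c, w c ^ 2 - 2 * ∑ m, (if s ≤ v m then ∑ c, w c * a m c else 0) +
        ∑ m, ∑ m', (if s ≤ min (v m) (v m') then ∑ c, a m c * a m' c else 0) := by
    have h2 : ∑ m, (if s ≤ v m then ∑ c, w c * a m c else 0) =
        ∑ c, w c * ∑ m, if s ≤ v m then a m c else 0 := by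
      simp_rw [Finset.mul_sum]
      rw [Finset.sum_comm]
      refine Finset.sum_congr rfl fun m _ => ?_
      split_ifs <;> simp
    have h3 : ∑ m, ∑ m', (if s ≤ min (v m) (v m') then ∑ c, a m c * a m' c else 0) =
        ∑ c : Fin d, (∑ m, if s ≤ v m then a m c else 0) ^ 2 := by
      simp_rw [sq, Finset.sum_mul_sum]
      symm
      rw [Finset.sum_comm]
      refine Finset.sum_congr rfl fun m _ => ?_
      rw [Finset.sum_comm]
      refine Finset.sum_congr rfl fun m' _ => ?_
      simp only [le_min_iff]
      by_cases h : s ≤ v m <;> by_cases h' : s ≤ v m' <;> simp [h, h']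
    rw [h2, h3, Finset.mul_sum, ← Finset.sum_sub_distrib, ← Finset.sum_add_distrib]
    refine Finset.sum_congr rfl fun c _ => ?_
    ring
  have i1 : IntervalIntegrable (fun s : ℝ => ∑ m, if s ≤ v m then ∑ c, w c * a m c else 0)
      volume 0 N := by
    simpa only [Finset.sum_fn] using
      IntervalIntegrable.sum Finset.univ fun m _ => intervalIntegrable_ite_le 0 N (v m) _
  have i2 (m : M) : IntervalIntegrable (fun s : ℝ =>
      ∑ m', if s ≤ min (v m) (v m') then ∑ c, a m c * a m' c else 0) volume 0 N := by
    simpa only [Finset.sum_fn] using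
      IntervalIntegrable.sum Finset.univ fun m' _ => intervalIntegrable_ite_le 0 N _ _
  have i3 : IntervalIntegrable (fun s : ℝ =>
      ∑ m, ∑ m', if s ≤ min (v m) (v m') then ∑ c, a m c * a m' c else 0) volume 0 N := by
    simpa only [Finset.sum_fn] using IntervalIntegrable.sum Finset.univ fun m _ => i2 m
  have i4 : IntervalIntegrable (fun _ : ℝ => ∑ c, w c ^ 2) volume 0 N :=
    intervalIntegrable_const
  simp_rw [h1]
  refine ⟨(i4.sub (i1.const_mul 2)).add i3, ?_⟩
  rw [intervalIntegral.integral_add (i4.sub (i1.const_mul 2)) i3,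
    intervalIntegral.integral_sub i4 (i1.const_mul 2), intervalIntegral.integral_const_mul,
    intervalIntegral.integral_finsetSum fun m _ => intervalIntegrable_ite_le 0 N _ _,
    intervalIntegral.integral_finsetSum fun m _ => i2 m, intervalIntegral.integral_const]
  congr 1
  · rw [sub_zero, smul_eq_mul]
    congr 2
    exact Finset.sum_congr rfl fun m _ => integral_ite_le (hv m) _
  · refine Finset.sum_congr rfl fun m _ => ?_
    rw [intervalIntegral.integral_finsetSum fun m' _ => intervalIntegrable_ite_le 0 N _ _]
    refine Finset.sum_congr rfl fun m' _ => ?_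
    rw [integral_ite_le ⟨le_min (hv m).1 (hv m').1, (min_le_left _ _).trans (hv m).2⟩]

lemma sum_integral_unit_intervals {f : ℝ → ℝ} (N : ℕ) (hf : IntervalIntegrable f volume 0 N) :
    ∑ i ∈ Finset.range N, ∫ t in (0 : ℝ)..1, f (i + t) = ∫ s in (0 : ℝ)..N, f s := by
  have h := intervalIntegral.sum_integral_adjacent_intervals (f := f) (μ := volume)
    (a := fun i : ℕ => (i : ℝ)) (n := N) fun i hi => by
      refine hf.mono_set ?_
      have h1 : (i : ℝ) ≤ (i + 1 : ℕ) := by push_cast; linarith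
      have h2 : ((i + 1 : ℕ) : ℝ) ≤ N := by exact_mod_cast hi
      rw [Set.uIcc_of_le h1, Set.uIcc_of_le (Nat.cast_nonneg N)]
      exact Set.Icc_subset_Icc (Nat.cast_nonneg i) h2
  rw [Nat.cast_zero] at h
  rw [← h]
  refine Finset.sum_congr rfl fun i _ => ?_
  rw [intervalIntegral.integral_comp_add_left fun s => f s]
  simp

section cycleWeight
variable {d p : ℕ} (n : Fin (p + 1) → ℕ) {α : Multiplicities (∑ l, n l)}

/-- The index set of the plane waves that are evaluated along the trajectory of cycle `l`. -/
abbrev WaveIndex (α : Multiplicities (∑ l, n l)) (l : Fin (p + 1)) :=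
  (Σ e : pairs (∑ l, n l), Fin (α e)) × Fin (n l)

/-- The wave vectors (times `L`) of the plane waves along cycle `l`. -/
def waveVector (z : Vectors d α) (l : Fin (p + 1)) (m : WaveIndex n α l) : Fin d → ℤ :=
  pairSign n l m.2 m.1.1 • (z m.1.1 m.1.2 : Fin d → ℤ)

/-- The times (over `β`) of the plane waves along cycle `l`. -/
def waveTime (τ : Times α) (l : Fin (p + 1)) (m : WaveIndex n α l) : ℝ :=
  ((m.2 : ℕ) : ℝ) + τ m.1.1 m.1.2

lemma waveTime_mem {τ : Times α} (hτ : τ ∈ unitTimes α) (l : Fin (p + 1))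
    (m : WaveIndex n α l) : waveTime n τ l m ∈ Set.Icc (0 : ℝ) (n l) := by
  have h := hτ m.1.1 m.1.2
  have h2 : (((m.2 : ℕ) + 1 : ℕ) : ℝ) ≤ n l := by exact_mod_cast m.2.2
  push_cast at h2
  refine ⟨add_nonneg (Nat.cast_nonneg _) h.1, ?_⟩
  unfold waveTime
  linarith [h.2]

lemma sum_waveIndex {G : Type*} [AddCommMonoid G] (l : Fin (p + 1))
    (f : (e : pairs (∑ l, n l)) → Fin (α e) → ℕ → G) :
    ∑ m : WaveIndex n α l, f m.1.1 m.1.2 m.2 =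
      ∑ e : pairs (∑ l, n l), ∑ r : Fin (α e), ∑ i ∈ Finset.range (n l), f e r i := by
  rw [Fintype.sum_prod_type, Fintype.sum_sigma]
  refine Finset.sum_congr rfl fun e _ => Finset.sum_congr rfl fun r _ => ?_
  exact Fin.sum_univ_eq_sum_range (fun i => f e r i) (n l)

lemma initialShift_eq_sum_waveVector (z : Vectors d α) {τ : Times α} (hτ : τ ∈ unitTimes α)
    (l : Fin (p + 1)) : initialShift n z τ l = -∑ m, waveVector n z l m := by
  rw [initialShift_eq_sum n z hτ]
  congr 1
  exact (sum_waveIndex n l fun e r i => pairSign n l i e • (z e r : Fin d → ℤ)).symm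

/-- Particle `i₀` at time `t` is the point `s = i₀ + t` of the trajectory, and `Z_q(t)` collects the
waves not yet passed at `s`. The value `t = 0` is excluded: a wave on particle `i₀ - 1` at time `1`
also has trajectory time `i₀`, yet `Z_q(0)` does not count it. -/
lemma shift_eq_sum_waveVector (z : Vectors d α) {τ : Times α} (hτ : τ ∈ unitTimes α)
    (l : Fin (p + 1)) (i₀ : ℕ) {t : ℝ} (ht : t ∈ Set.Ioc (0 : ℝ) 1) :
    shift n z τ l (countBefore n l + i₀ + 1) t =
      -∑ m, if i₀ + t ≤ waveTime n τ l m then waveVector n z l m else 0 := by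
  rw [shift_eq_sum]
  congr 1
  rw [← sum_waveIndex n l fun e r i =>
    (if (t ≤ τ e r ∧ i₀ ≤ i) ∨ i₀ < i then pairSign n l i e else 0) • (z e r : Fin d → ℤ)]
  refine Finset.sum_congr rfl fun m _ => ?_
  have h : ((t ≤ τ m.1.1 m.1.2 ∧ i₀ ≤ (m.2 : ℕ)) ∨ i₀ < (m.2 : ℕ)) ↔
      i₀ + t ≤ waveTime n τ l m := by
    have hτ' := hτ m.1.1 m.1.2
    unfold waveTime
    rcases lt_trichotomy i₀ (m.2 : ℕ) with h | h | h
    · have h' : ((i₀ + 1 : ℕ) : ℝ) ≤ (m.2 : ℕ) := by exact_mod_cast h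
      push_cast at h'
      exact iff_of_true (Or.inr h) (by linarith [hτ'.1, ht.2])
    · rw [h]
      simp
    · have h' : (((m.2 : ℕ) + 1 : ℕ) : ℝ) ≤ i₀ := by exact_mod_cast h
      push_cast at h'
      refine iff_of_false (by omega) ?_
      linarith [hτ'.2, ht.1]
  by_cases h' : i₀ + t ≤ waveTime n τ l m
  · rw [if_pos h', if_pos (h.2 h')]
    rfl
  · rw [if_neg h', if_neg fun h'' => h' (h.1 h''), zero_smul]

/-- Laid end to end, the functions `w + Z_q` of the particles of the cycle form one step function on
`[0, n_l]`. Its integrated square is the quadratic form that Poisson summation yields for the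
bridge. -/
lemma cycleWeight_eq (ħ m₀ β L : ℝ) (z : Vectors d α) {τ : Times α} (hτ : τ ∈ unitTimes α)
    (l : Fin (p + 1)) (w : Fin d → ℤ) :
    cycleWeight ħ m₀ β L n z τ l w =
      Real.exp (-(Real.pi * thermalLength ħ m₀ β ^ 2) * (n l * ‖latticeVec L⁻¹ w‖ ^ 2 -
        2 * ∑ m, waveTime n τ l m *
          inner ℝ (latticeVec L⁻¹ w) (latticeVec L⁻¹ (waveVector n z l m)) +
        ∑ m, ∑ m', min (waveTime n τ l m) (waveTime n τ l m') *
          inner ℝ (latticeVec L⁻¹ (waveVector n z l m))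
            (latticeVec L⁻¹ (waveVector n z l m')))) := by
  have hinner (y y' : Fin d → ℤ) : inner ℝ (latticeVec L⁻¹ y) (latticeVec L⁻¹ y') =
      (L ^ 2)⁻¹ * ∑ c, (y c : ℝ) * (y' c : ℝ) := by
    rw [PiLp.inner_apply, Finset.mul_sum]
    refine Finset.sum_congr rfl fun c _ => ?_
    simp only [latticeVec, RCLike.inner_apply, conj_trivial]
    ring
  obtain ⟨h1, h2⟩ := integral_sq_sub_step (N := n l) (fun c => (w c : ℝ))
    (fun m c => (waveVector n z l m c : ℝ)) _ (waveTime_mem n hτ l)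
  have h3 : ∑ q ∈ cycle n l, ∫ t in (0 : ℝ)..1, ∑ i, (((w + shift n z τ l q t) i : ℤ) : ℝ) ^ 2 =
      ∫ s in (0 : ℝ)..n l,
        ∑ c, ((w c : ℝ) - ∑ m, if s ≤ waveTime n τ l m then (waveVector n z l m c : ℝ) else 0) ^ 2
      := by
    rw [← sum_integral_unit_intervals _ h1]
    have h4 : cycle n l = Finset.Ico (countBefore n l + 1) (countBefore n l + 1 + n l) := by
      ext q
      rw [cycle, countUpTo_eq, Finset.mem_Icc, Finset.mem_Ico]
      omega
    rw [h4, Finset.sum_Ico_eq_sum_range, Nat.add_sub_cancel_left]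
    refine Finset.sum_congr rfl fun i₀ _ => ?_
    -- Only `t ∈ (0, 1]` is needed here, which disposes of the ambiguous endpoint `0`.
    refine intervalIntegral.integral_congr_ae (Filter.Eventually.of_forall fun t ht => ?_)
    rw [Set.uIoc_of_le zero_le_one] at ht
    rw [add_right_comm, shift_eq_sum_waveVector n z hτ l i₀ ht]
    refine Finset.sum_congr rfl fun c _ => ?_
    congr 1
    rw [Pi.add_apply, Pi.neg_apply, Finset.sum_apply, Int.cast_add, Int.cast_neg, Int.cast_sum,
      ← sub_eq_add_neg]
    congr 1
    refine Finset.sum_congr rfl fun m _ => ?_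
    split_ifs <;> simp
  unfold cycleWeight
  rw [h3, h2]
  congr 1
  simp_rw [← real_inner_self_eq_norm_sq, hinner, mul_left_comm _ (L ^ 2)⁻¹, ← Finset.mul_sum]
  simp_rw [sq]
  ring

end cycleWeight

/-! ### Absolute continuity of the laws of the increments -/

/-- A characteristic function determines the measure, and this one belongs to an explicit Gaussian
density. -/
lemma absolutelyContinuous_of_charFun_gaussian {d : ℕ} {ν : Measure (EuclideanSpace ℝ (Fin d))}
    [IsProbabilityMeasure ν] {σ : ℝ} (hσ : 0 < σ) (y : EuclideanSpace ℝ (Fin d))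
    (h : ∀ t, charFun ν t = Complex.exp (((inner ℝ t y : ℝ) : ℂ) * Complex.I -
      ((σ / 2 * ‖t‖ ^ 2 : ℝ) : ℂ))) : ν ≪ volume := by
  have hpi := Real.pi_pos
  -- With this width, `exp (-π |x|² / L²)` is `exp (-|x|² / (2σ))`.
  set L : ℝ := √(2 * Real.pi * σ) with hL
  have hL0 : 0 < L := by positivity
  have hL2 : L ^ 2 = 2 * Real.pi * σ := Real.sq_sqrt (by positivity)
  have hLc : (L : ℂ) ≠ 0 := by exact_mod_cast hL0.ne'
  set g : EuclideanSpace ℝ (Fin d) → ℝ := fun x => (L ^ d)⁻¹ * gaussWeight L (x - y) with hg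
  have hg0 (x) : 0 ≤ g x := mul_nonneg (by positivity) (gaussWeight_pos _).le
  have hgm : Measurable g :=
    ((continuous_gaussWeight.comp (continuous_sub_right y)).const_mul _).measurable
  have hgi : Integrable g := ((integrable_gaussWeight hL0).comp_sub_right y).const_mul _
  have hfin : IsFiniteMeasure (volume.withDensity fun x => ENNReal.ofReal (g x)) :=
    isFiniteMeasure_withDensity_ofReal hgi.2
  have heq : ν = volume.withDensity fun x => ENNReal.ofReal (g x) := by
    refine Measure.ext_of_charFun (funext fun t => ?_)
    rw [h, charFun_apply, integral_withDensity_eq_integral_toReal_smul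
      hgm.ennreal_ofReal (Filter.Eventually.of_forall fun _ => ENNReal.ofReal_lt_top)]
    have h1 (x : EuclideanSpace ℝ (Fin d)) : (ENNReal.ofReal (g x)).toReal •
        Complex.exp (((inner ℝ x t : ℝ) : ℂ) * Complex.I) =
        (((L : ℂ) ^ d)⁻¹ * wave ((2 * Real.pi)⁻¹ • t) y) *
          ((gaussWeight L (x - y) : ℂ) * wave ((2 * Real.pi)⁻¹ • t) (x - y)) := by
      have h2 : Complex.exp (((inner ℝ x t : ℝ) : ℂ) * Complex.I) =
          wave ((2 * Real.pi)⁻¹ • t) (x - y) * wave ((2 * Real.pi)⁻¹ • t) y := by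
        rw [← wave_add_right, sub_add_cancel, wave, real_inner_smul_left, ← mul_assoc,
          mul_inv_cancel₀ (by positivity), one_mul, real_inner_comm]
      rw [ENNReal.toReal_ofReal (hg0 x), h2, Complex.real_smul, hg]
      push_cast
      ring
    simp_rw [h1]
    rw [integral_const_mul, integral_sub_right_eq_self fun x =>
      (gaussWeight L x : ℂ) * wave ((2 * Real.pi)⁻¹ • t) x,
      integral_gaussWeight_mul_wave hL0, wave, Complex.ofReal_exp, sub_eq_add_neg,
      Complex.exp_add]
    have h3 : 2 * Real.pi * inner ℝ ((2 * Real.pi)⁻¹ • t) y = inner ℝ t y := by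
      rw [real_inner_smul_left]
      field_simp
    have h4 : -Real.pi * L ^ 2 * ‖(2 * Real.pi)⁻¹ • t‖ ^ 2 = -(σ / 2 * ‖t‖ ^ 2) := by
      rw [hL2, norm_smul, Real.norm_of_nonneg (by positivity)]
      field_simp
      try ring
    rw [h3, h4, Complex.ofReal_neg]
    field_simp
  rw [heq]
  exact withDensity_absolutelyContinuous _ _

lemma measurable_sum_smul_eval {d : ℕ} {T : ℝ} {M : Type*} [Fintype M]
    (s : M → Set.Icc (0 : ℝ) T) (b : M → ℝ) :
    Measurable fun ω : Trajectory d T => ∑ j, b j • ω (s j) :=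
  Finset.measurable_sum _ fun j _ => (measurable_trajectory_eval (s j)).const_smul (b j)

/-- A scalar combination of positions of the bridge is Gaussian with covariance a multiple of the
identity; `hσ` says that this multiple is positive. -/
lemma absolutelyContinuous_map_sum_bridge {d : ℕ} {D T : ℝ} {x y : EuclideanSpace ℝ (Fin d)}
    {μ : Measure (Trajectory d T)} (h : IsBrownianBridge D T x y μ) {M : Type*} [Fintype M]
    (s : M → Set.Icc (0 : ℝ) T) (b : M → ℝ)
    (hσ : 0 < D * ∑ j, ∑ j', (min (s j : ℝ) (s j') - (s j : ℝ) * (s j') / T) * (b j * b j')) :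
    μ.map (fun ω => ∑ j, b j • ω (s j)) ≪ volume := by
  have := h.isProbabilityMeasure
  have hm := measurable_sum_smul_eval (d := d) s b
  have : IsProbabilityMeasure (μ.map fun ω => ∑ j, b j • ω (s j)) :=
    Measure.isProbabilityMeasure_map hm.aemeasurable
  refine absolutelyContinuous_of_charFun_gaussian hσ
    (∑ j, b j • (x + ((s j : ℝ) / T) • (y - x))) fun t => ?_
  rw [charFun_apply, integral_map hm.aemeasurable (by fun_prop)]
  have h1 := h.integral_exp_sum s fun j => b j • t
  have h2 (f : M → EuclideanSpace ℝ (Fin d)) :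
      ∑ j, inner ℝ (b j • t) (f j) = inner ℝ t (∑ j, b j • f j) := by
    rw [inner_sum]
    refine Finset.sum_congr rfl fun j _ => ?_
    rw [real_inner_smul_left, real_inner_smul_right]
  simp_rw [h2, ← real_inner_comm t] at h1
  rw [h1, real_inner_comm]
  congr 3
  rw [Finset.mul_sum, Finset.mul_sum, Finset.sum_div, Finset.sum_mul]
  refine Finset.sum_congr rfl fun j _ => ?_
  rw [Finset.mul_sum, Finset.mul_sum, Finset.sum_div, Finset.sum_mul]
  refine Finset.sum_congr rfl fun j' _ => ?_
  rw [real_inner_smul_left, real_inner_smul_right, real_inner_self_eq_norm_sq]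
  ring

section torus
variable {d : ℕ} {ħ m₀ T L : ℝ}

lemma torusWienerMeasure_eq_zero
    (x y : EuclideanSpace ℝ (Fin d)) {S : Set (Trajectory d T)} (hS : MeasurableSet S)
    (h : ∀ y, bridgeLaw (ħ ^ 2 / m₀) T x y S = 0) : torusWienerMeasure ħ m₀ L T x y S = 0 := by
  unfold torusWienerMeasure wienerMeasure
  rw [Measure.sum_apply _ hS]
  simp [h]

/-- The variance factor `s - s² / T` is positive strictly between the pinned ends. The point `c`
stands for a particle of another trajectory, held fixed by Fubini. -/
lemma torusWienerMeasure_position_mem (hħ : 0 < ħ) (hm₀ : 0 < m₀)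
    (x y c : EuclideanSpace ℝ (Fin d)) {s : ℝ} (hs : s ∈ Set.Ioo 0 T)
    {A : Set (EuclideanSpace ℝ (Fin d))} (hA : MeasurableSet A) (hA0 : volume A = 0) :
    torusWienerMeasure ħ m₀ L T x y {ω | c - position ω s ∈ A} = 0 := by
  have hT : 0 < T := hs.1.trans hs.2
  have hs' : s ∈ Set.Icc 0 T := Set.Ioo_subset_Icc_self hs
  have hm : MeasurableSet {ω : Trajectory d T | c - position ω s ∈ A} :=
    ((measurable_position s).const_sub c) hA
  refine torusWienerMeasure_eq_zero x y hm fun y' => ?_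
  have h := absolutelyContinuous_map_sum_bridge (M := Unit)
    (isBrownianBridge_bridgeLaw (D := ħ ^ 2 / m₀) (by positivity) hT x y') (fun _ => ⟨s, hs'⟩)
    (fun _ => 1) (by
      have h1 : 0 < s - s * s / T := by
        rw [sub_pos, div_lt_iff₀ hT]
        exact mul_lt_mul_of_pos_left hs.2 hs.1
      simp only [min_self, Finset.univ_unique, Finset.sum_const, Finset.card_singleton, one_smul,
        mul_one]
      positivity)
  have hA' : volume ((fun z => c - z) ⁻¹' A) = 0 :=
    (quasiMeasurePreserving_sub_left volume c).preimage_null hA0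
  have h2 := h hA'
  rw [Measure.map_apply (measurable_sum_smul_eval _ _)
    (hA.preimage (measurable_const_sub c))] at h2
  refine Eq.trans ?_ h2
  congr 1
  ext ω
  simp [position_of_mem _ hs']

lemma torusWienerMeasure_increment_mem (hħ : 0 < ħ) (hm₀ : 0 < m₀)
    (x y : EuclideanSpace ℝ (Fin d)) {s s' : ℝ} (hs : s ∈ Set.Ioo 0 T) (hs' : s' ∈ Set.Ioo 0 T)
    (hss' : s' < s) {A : Set (EuclideanSpace ℝ (Fin d))} (hA : MeasurableSet A)
    (hA0 : volume A = 0) :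
    torusWienerMeasure ħ m₀ L T x y {ω | position ω s - position ω s' ∈ A} = 0 := by
  have hT : 0 < T := hs.1.trans hs.2
  have hs1 : s ∈ Set.Icc 0 T := Set.Ioo_subset_Icc_self hs
  have hs1' : s' ∈ Set.Icc 0 T := Set.Ioo_subset_Icc_self hs'
  have hm : MeasurableSet {ω : Trajectory d T | position ω s - position ω s' ∈ A} :=
    ((measurable_position s).sub (measurable_position s')) hA
  refine torusWienerMeasure_eq_zero x y hm fun y' => ?_
  have h := absolutelyContinuous_map_sum_bridge
    (isBrownianBridge_bridgeLaw (D := ħ ^ 2 / m₀) (by positivity) hT x y')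
    ![⟨s, hs1⟩, ⟨s', hs1'⟩] ![1, -1] (by
      -- The variance of an increment of length `r = s - s'` is proportional to `r - r² / T`, and `0
      -- < r < T`.
      have h1 : 0 < (s - s') - (s - s') * (s - s') / T := by
        rw [sub_pos, div_lt_iff₀ hT]
        exact mul_lt_mul_of_pos_left (by linarith [hs.2, hs'.1]) (by linarith)
      simp only [Fin.sum_univ_two, Matrix.cons_val_zero, Matrix.cons_val_one, min_self,
        min_eq_left hss'.le, min_eq_right hss'.le]
      refine mul_pos (by positivity) (h1.trans_eq ?_)
      ring)
  have h2 := h hA0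
  rw [Measure.map_apply (measurable_sum_smul_eval _ _) hA] at h2
  refine Eq.trans ?_ h2
  congr 1
  ext ω
  simp [position_of_mem _ hs1, position_of_mem _ hs1', Fin.sum_univ_two, sub_eq_add_neg]

end torus

/-- Continuity in time and measurability at each time give joint measurability on `[0, T]`; outside,
`position` is zero. -/
lemma measurable_position_uncurry {d : ℕ} (T : ℝ) :
    Measurable fun x : Trajectory d T × ℝ => position x.1 x.2 := by
  by_cases hT : 0 ≤ T
  · have h1 : Measurable (Function.uncurry fun (s : Set.Icc (0 : ℝ) T) (ω : Trajectory d T) =>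
        ω s) := measurable_uncurry_of_continuous_of_measurable (fun ω => ω.continuous)
          measurable_trajectory_eval
    have h2 : Measurable fun x : Trajectory d T × ℝ => x.1 (Set.projIcc 0 T hT x.2) :=
      h1.comp (((continuous_projIcc (h := hT)).measurable.comp measurable_snd).prodMk measurable_fst)
    have h3 : (fun x : Trajectory d T × ℝ => position x.1 x.2) =
        {x : Trajectory d T × ℝ | x.2 ∈ Set.Icc 0 T}.indicator
          fun x => x.1 (Set.projIcc 0 T hT x.2) := by
      ext1 x
      by_cases hx : x.2 ∈ Set.Icc 0 T
      · rw [Set.indicator_of_mem (by exact hx), position_of_mem _ hx, Set.projIcc_of_mem hT hx]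
      · rw [Set.indicator_of_notMem (by exact hx), position, dif_neg hx]
    rw [h3]
    exact h2.indicator (measurable_snd measurableSet_Icc)
  · have h : (fun x : Trajectory d T × ℝ => position x.1 x.2) = fun _ => 0 := by
      ext1 x
      rw [position, dif_neg]
      rw [Set.Icc_eq_empty hT]
      exact Set.notMem_empty _
    rw [h]
    exact measurable_const

/-! ### Pair differences along the trajectories -/

section particles
variable {p : ℕ} (n : Fin (p + 1) → ℕ)

lemma countUpTo_le_countBefore {l l' : Fin (p + 1)} (h : l < l') :
    countUpTo n l ≤ countBefore n l' :=
  Finset.sum_le_sum_of_subset fun _ hl'' =>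
    Finset.mem_Iio.2 ((Finset.mem_Iic.1 hl'').trans_lt h)

lemma particle_injective {l l' : Fin (p + 1)} {i i' : ℕ} (hi : i < n l) (hi' : i' < n l')
    (h : countBefore n l + i + 1 = countBefore n l' + i' + 1) : l = l' ∧ i = i' := by
  rcases lt_trichotomy l l' with hl | rfl | hl
  · have := countUpTo_le_countBefore n hl
    rw [countUpTo_eq] at this
    omega
  · exact ⟨rfl, by omega⟩
  · have := countUpTo_le_countBefore n hl
    rw [countUpTo_eq] at this
    omega

/-- If `q` were in no cycle, the indicator of `q` would sum to zero cycle by cycle, although it sums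
to one over all particles. -/
lemma exists_particle {q : ℕ} (hq : 1 ≤ q) (hq' : q ≤ ∑ l, n l) :
    ∃ l, ∃ i < n l, q = countBefore n l + i + 1 := by
  by_contra! hne
  have h := sum_range_total n fun r => if q = r + 1 then (1 : ℤ) else 0
  rw [Finset.sum_eq_single_of_mem (q - 1) (by rw [Finset.mem_range]; omega)
    (fun i _ hi => if_neg (by omega)), if_pos (by omega)] at h
  refine one_ne_zero (h.trans (Finset.sum_eq_zero fun l _ => Finset.sum_eq_zero fun i hi => ?_))
  exact if_neg (hne l i (Finset.mem_range.1 hi))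

lemma sum_sum_ite_smul {G : Type*} [AddCommGroup G] (g : Fin (p + 1) → ℕ → G) {l : Fin (p + 1)}
    {i : ℕ} (hi : i < n l) :
    ∑ l', ∑ i' ∈ Finset.range (n l'), (if countBefore n l + i + 1 = countBefore n l' + i' + 1
      then (1 : ℤ) else 0) • g l' i' = g l i := by
  rw [Finset.sum_eq_single l, Finset.sum_eq_single i]
  · simp
  · intro i' _ hne
    rw [if_neg (by omega), zero_smul]
  · intro hi'
    exact absurd (Finset.mem_range.2 hi) hi'
  · intro l' _ hne
    refine Finset.sum_eq_zero fun i' hi' => ?_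
    rw [if_neg, zero_smul]
    exact fun h => hne (particle_injective n hi (Finset.mem_range.1 hi') h).1.symm
  · simp

variable {d : ℕ} (β : ℝ)

/-- The difference `x_k - x_j` of the positions of two particles at time `s β`. -/
noncomputable def pairDiff (ω : (l : Fin (p + 1)) → Trajectory d (n l * β)) (e : ℕ × ℕ) (s : ℝ) :
    EuclideanSpace ℝ (Fin d) :=
  ∑ l, ∑ i ∈ Finset.range (n l), pairSign n l i e • position (ω l) ((i + s) * β)

/-- The signed sum in `pairDiff` needs no choice of the two cycles and separates the trajectories;
the signs select exactly two of its terms. -/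
lemma pairDiff_eq (ω : (l : Fin (p + 1)) → Trajectory d (n l * β)) (s : ℝ) {l l' : Fin (p + 1)}
    {j k : ℕ} (hj : j < n l') (hk : k < n l) :
    pairDiff n β ω (countBefore n l' + j + 1, countBefore n l + k + 1) s =
      position (ω l) ((k + s) * β) - position (ω l') ((j + s) * β) := by
  unfold pairDiff pairSign
  simp_rw [sub_smul, Finset.sum_sub_distrib]
  rw [sum_sum_ite_smul n (fun l i => position (ω l) ((i + s) * β)) hk,
    sum_sum_ite_smul n (fun l i => position (ω l) ((i + s) * β)) hj]

lemma measurable_pairDiff_uncurry (e : ℕ × ℕ) :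
    Measurable fun x : ((l : Fin (p + 1)) → Trajectory d (n l * β)) × ℝ =>
      pairDiff n β x.1 e x.2 := by
  unfold pairDiff
  refine Finset.measurable_sum _ fun l _ => Finset.measurable_sum _ fun i _ => ?_
  refine Measurable.const_smul ?_ (pairSign n l i e)
  have h : Measurable fun x : ((l : Fin (p + 1)) → Trajectory d (n l * β)) × ℝ =>
      (x.1 l, (i + x.2) * β) :=
    ((measurable_pi_apply l).comp measurable_fst).prodMk
      ((measurable_snd.const_add (i : ℝ)).mul_const β)
  exact (measurable_position_uncurry (n l * β)).comp h

lemma measurable_pairDiff (ω : (l : Fin (p + 1)) → Trajectory d (n l * β)) (e : ℕ × ℕ) :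
    Measurable fun s => pairDiff n β ω e s := by
  unfold pairDiff
  refine Finset.measurable_sum _ fun l _ => Finset.measurable_sum _ fun i _ => ?_
  refine Measurable.const_smul ?_ (pairSign n l i e)
  have h : Measurable fun s : ℝ => (ω l, (i + s) * β) :=
    measurable_const.prodMk ((measurable_id.const_add (i : ℝ)).mul_const β)
  exact (measurable_position_uncurry (n l * β)).comp h

end particles

/-! ### The Boltzmann factor as a functional of the pair differences -/

section energies
variable {d p : ℕ} {ħ m₀ β L : ℝ}

/-- The product of the Wiener measures of all cycles. -/
noncomputable abbrev cyclesMeasure (ħ m₀ β L : ℝ) (n : Fin (p + 1) → ℕ)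
    (X Y : Fin (p + 1) → EuclideanSpace ℝ (Fin d)) :
    Measure ((l : Fin (p + 1)) → Trajectory d (n l * β)) :=
  Measure.pi fun l => torusWienerMeasure ħ m₀ L (n l * β) (X l) (Y l)

/-- Two particles of one cycle differ by an increment of the bridge. For particles of two cycles,
the trajectory of the later one is fixed and the other position has a density. As `s` is interior to
`(0, 1)`, the times stay away from the pinned ends. -/
lemma cyclesMeasure_pairDiff_mem (hħ : 0 < ħ) (hm₀ : 0 < m₀) (hβ : 0 < β) (hL : 0 < L)
    (n : Fin (p + 1) → ℕ) (hn : ∀ l, 1 ≤ n l) (X Y : Fin (p + 1) → EuclideanSpace ℝ (Fin d))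
    {e : ℕ × ℕ} (he : e ∈ pairs (∑ l, n l)) {s : ℝ} (hs : s ∈ Set.Ioo 0 1)
    {A : Set (EuclideanSpace ℝ (Fin d))} (hA : MeasurableSet A) (hA0 : volume A = 0) :
    cyclesMeasure ħ m₀ β L n X Y {ω | pairDiff n β ω e s ∈ A} = 0 := by
  have hT (l) : 0 < n l * β := mul_pos (by exact_mod_cast hn l) hβ
  have := fun l => isFiniteMeasure_torusWienerMeasure hħ hm₀ (hT l) hL (X l) (Y l)
  obtain ⟨j, k⟩ := e
  simp only [pairs, Finset.mem_filter, Finset.mem_product, Finset.mem_Icc] at he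
  obtain ⟨l', i', hi', rfl⟩ := exists_particle n he.1.1.1 he.1.1.2
  obtain ⟨l, i, hi, rfl⟩ := exists_particle n he.1.2.1 he.1.2.2
  simp_rw [pairDiff_eq n β _ s hi' hi]
  have hmem {l : Fin (p + 1)} {i : ℕ} (hi : i < n l) : (i + s) * β ∈ Set.Ioo 0 (n l * β) := by
    have h1 : ((i + 1 : ℕ) : ℝ) ≤ n l := by exact_mod_cast hi
    push_cast at h1
    exact ⟨mul_pos (add_pos_of_nonneg_of_pos (Nat.cast_nonneg _) hs.1) hβ,
      mul_lt_mul_of_pos_right (by linarith [hs.2]) hβ⟩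
  by_cases hl : l = l'
  · subst hl
    have hii : (i' : ℝ) < i := by
      have : i' < i := by omega
      exact_mod_cast this
    have h0 := torusWienerMeasure_increment_mem (L := L) hħ hm₀ (X l) (Y l) (hmem hi) (hmem hi')
      (mul_lt_mul_of_pos_right (add_lt_add_left hii s) hβ) hA hA0
    exact (Measure.quasiMeasurePreserving_eval
      (fun l => torusWienerMeasure ħ m₀ L (n l * β) (X l) (Y l)) l).preimage_null h0
  · obtain ⟨r, hr⟩ := Fin.exists_succAbove_eq (Ne.symm hl)
    subst hr
    set S : Set (Trajectory d (n l * β) × ((r : Fin p) →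
        Trajectory d (n (l.succAbove r) * β))) :=
      {x | position x.1 ((i + s) * β) - position (x.2 r) ((i' + s) * β) ∈ A} with hS
    have hSm : MeasurableSet S :=
      (((measurable_position ((i + s) * β)).comp measurable_fst).sub
        ((measurable_position ((i' + s) * β)).comp
          ((measurable_pi_apply r).comp measurable_snd))) hA
    have hmp := measurePreserving_piFinSuccAbove
      (fun l => torusWienerMeasure ħ m₀ L (n l * β) (X l) (Y l)) l
    refine (hmp.measure_preimage hSm.nullMeasurableSet).trans ?_
    rw [Measure.measure_prod_null hSm]
    refine Filter.Eventually.of_forall fun ω => ?_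
    have h0 := torusWienerMeasure_position_mem (L := L) hħ hm₀ (X (l.succAbove r))
      (Y (l.succAbove r)) (position ω ((i + s) * β)) (hmem hi') hA hA0
    exact (Measure.quasiMeasurePreserving_eval (fun r => torusWienerMeasure ħ m₀ L
      (n (l.succAbove r) * β) (X (l.succAbove r)) (Y (l.succAbove r))) r).preimage_null h0

/-- The Boltzmann factor in terms of all pairs of particles, with the periodized potential replaced
by a function that is equal to it almost everywhere. -/
theorem ae_boltzmannFactor_eq (hħ : 0 < ħ) (hm₀ : 0 < m₀) (hβ : 0 < β) (hL : 0 < L)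
    (u : EuclideanSpace ℝ (Fin d) → ℝ) {V : EuclideanSpace ℝ (Fin d) → ℂ} (hVm : Measurable V)
    {C : ℝ} (hVC : ∀ x, ‖V x‖ ≤ C) (hV : ∀ᵐ x, (periodized L u x : ℂ) = V x)
    (n : Fin (p + 1) → ℕ) (hn : ∀ l, 1 ≤ n l) (X Y : Fin (p + 1) → EuclideanSpace ℝ (Fin d)) :
    ∀ᵐ ω ∂cyclesMeasure ħ m₀ β L n X Y,
      (((∏ l, Real.exp (-β * selfEnergy β L u (ω l))) *
        (∏ l, ∏ l' ∈ Finset.Iio l, Real.exp (-β * pairEnergy β L u (ω l') (ω l))) : ℝ) : ℂ) =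
      Complex.exp (-β * ∑ e : pairs (∑ l, n l), ∫ s in (0 : ℝ)..1, V (pairDiff n β ω e s)) := by
  have hT (l) : 0 < n l * β := mul_pos (by exact_mod_cast hn l) hβ
  have := fun l => isFiniteMeasure_torusWienerMeasure hħ hm₀ (hT l) hL (X l) (Y l)
  -- A measurable hull of the exceptional null set, so that Fubini applies.
  set A : Set (EuclideanSpace ℝ (Fin d)) :=
    toMeasurable volume {x | ¬ (periodized L u x : ℂ) = V x} with hA
  have hAm : MeasurableSet A := measurableSet_toMeasurable _ _
  have hA0 : volume A = 0 := by
    rw [hA, measure_toMeasurable]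
    exact hV
  have hAV (x) (hx : x ∉ A) : (periodized L u x : ℂ) = V x := by
    by_contra h
    exact hx (subset_toMeasurable _ _ h)
  have h1 : ∀ᵐ ω ∂cyclesMeasure ħ m₀ β L n X Y, ∀ e : pairs (∑ l, n l),
      ∀ᵐ s ∂volume.restrict (Set.Ioo (0 : ℝ) 1), pairDiff n β ω e s ∉ A := by
    rw [ae_all_iff]
    intro e
    -- Exchange of quantifiers: it suffices that for each `s` almost every `ω` avoids `A`.
    rw [Measure.ae_ae_comm (p := fun ω s => pairDiff n β ω e s ∉ A)
      ((measurable_pairDiff_uncurry n β e) hAm.compl)]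
    rw [ae_restrict_iff' measurableSet_Ioo]
    refine Filter.Eventually.of_forall fun s hs => ?_
    rw [ae_iff]
    simpa only [not_not] using cyclesMeasure_pairDiff_mem hħ hm₀ hβ hL n hn X Y e.2 hs hAm hA0
  filter_upwards [h1] with ω hω
  have h2 : ∀ᵐ s, s ∈ Set.uIoc (0 : ℝ) 1 → ∀ e : pairs (∑ l, n l),
      (periodized L u (pairDiff n β ω e s) : ℂ) = V (pairDiff n β ω e s) := by
    have h3 : ∀ᵐ s ∂volume.restrict (Set.uIoc (0 : ℝ) 1), ∀ e : pairs (∑ l, n l),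
        pairDiff n β ω e s ∉ A := by
      rw [Set.uIoc_of_le zero_le_one, ← restrict_Ioo_eq_restrict_Ioc, ae_all_iff]
      exact hω
    rw [ae_restrict_iff' measurableSet_uIoc] at h3
    filter_upwards [h3] with s hs hs' e
    exact hAV _ (hs hs' e)
  have hVi (e : ℕ × ℕ) : IntervalIntegrable (fun s => V (pairDiff n β ω e s)) volume 0 1 := by
    refine (intervalIntegrable_const (c := C)).mono_fun' ?_ (Filter.Eventually.of_forall fun s => hVC _)
    exact (hVm.comp (measurable_pairDiff n β ω e)).aestronglyMeasurable
  have hmemP {l l' : Fin (p + 1)} {j k : ℕ} (hj : j < n l') (hk : k < n l)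
      (h : l' < l ∨ (l' = l ∧ j < k)) :
      (countBefore n l' + j + 1, countBefore n l + k + 1) ∈ pairs (∑ l, n l) := by
    have h1 := countUpTo_le n l
    have h2 := countUpTo_le n l'
    have h3 := countUpTo_eq n l
    have h4 := countUpTo_eq n l'
    simp only [pairs, Finset.mem_filter, Finset.mem_product, Finset.mem_Icc]
    rcases h with h | ⟨rfl, h⟩
    · have h5 := countUpTo_le_countBefore n h
      omega
    · omega
  -- The substitution `t = βs` absorbs the factor `β⁻¹` of the energies.
  have hsub (F : ℝ → ℝ) : β⁻¹ * ∫ t in (0 : ℝ)..β, F t = ∫ s in (0 : ℝ)..1, F (β * s) := by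
    rw [intervalIntegral.integral_comp_mul_left _ hβ.ne', mul_zero, mul_one, smul_eq_mul]
  have hself (l : Fin (p + 1)) : ((selfEnergy β L u (ω l) : ℝ) : ℂ) =
      ∑ k ∈ Finset.range (n l), ∑ j ∈ Finset.range k, ∫ s in (0 : ℝ)..1,
        V (pairDiff n β ω (countBefore n l + j + 1, countBefore n l + k + 1) s) := by
    unfold selfEnergy
    rw [hsub, ← intervalIntegral.integral_ofReal]
    have h4 : ∫ s in (0 : ℝ)..1, ((∑ k ∈ Finset.range (n l), ∑ j ∈ Finset.range k,
        periodized L u (position (ω l) (k * β + β * s) - position (ω l) (j * β + β * s)) : ℝ) : ℂ) =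
        ∫ s in (0 : ℝ)..1, ∑ k ∈ Finset.range (n l), ∑ j ∈ Finset.range k,
          V (pairDiff n β ω (countBefore n l + j + 1, countBefore n l + k + 1) s) := by
      refine intervalIntegral.integral_congr_ae ?_
      filter_upwards [h2] with s hs hs'
      rw [Complex.ofReal_sum]
      refine Finset.sum_congr rfl fun k hk => ?_
      rw [Complex.ofReal_sum]
      refine Finset.sum_congr rfl fun j hj => ?_
      rw [Finset.mem_range] at hk hj
      have h5 := hs hs' ⟨_, hmemP (hj.trans hk) hk (Or.inr ⟨rfl, hj⟩)⟩
      rw [← h5, pairDiff_eq n β ω s (hj.trans hk) hk]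
      congr 4 <;> ring
    rw [h4, intervalIntegral.integral_finsetSum fun k _ => by
      simpa only [Finset.sum_fn] using IntervalIntegrable.sum _ fun j _ => hVi _]
    refine Finset.sum_congr rfl fun k _ => ?_
    rw [intervalIntegral.integral_finsetSum fun j _ => hVi _]
  have hpair (l l' : Fin (p + 1)) (hl : l' < l) : ((pairEnergy β L u (ω l') (ω l) : ℝ) : ℂ) =
      ∑ j ∈ Finset.range (n l'), ∑ k ∈ Finset.range (n l), ∫ s in (0 : ℝ)..1,
        V (pairDiff n β ω (countBefore n l' + j + 1, countBefore n l + k + 1) s) := by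
    unfold pairEnergy
    rw [hsub, ← intervalIntegral.integral_ofReal]
    have h4 : ∫ s in (0 : ℝ)..1, ((∑ j ∈ Finset.range (n l'), ∑ k ∈ Finset.range (n l),
        periodized L u (position (ω l) (k * β + β * s) - position (ω l') (j * β + β * s)) : ℝ)
          : ℂ) =
        ∫ s in (0 : ℝ)..1, ∑ j ∈ Finset.range (n l'), ∑ k ∈ Finset.range (n l),
          V (pairDiff n β ω (countBefore n l' + j + 1, countBefore n l + k + 1) s) := by
      refine intervalIntegral.integral_congr_ae ?_
      filter_upwards [h2] with s hs hs'
      rw [Complex.ofReal_sum]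
      refine Finset.sum_congr rfl fun j hj => ?_
      rw [Complex.ofReal_sum]
      refine Finset.sum_congr rfl fun k hk => ?_
      rw [Finset.mem_range] at hk hj
      have h5 := hs hs' ⟨_, hmemP hj hk (Or.inl hl)⟩
      rw [← h5, pairDiff_eq n β ω s hj hk]
      congr 4 <;> ring
    rw [h4, intervalIntegral.integral_finsetSum fun k _ => by
      simpa only [Finset.sum_fn] using IntervalIntegrable.sum _ fun j _ => hVi _]
    refine Finset.sum_congr rfl fun k _ => ?_
    rw [intervalIntegral.integral_finsetSum fun j _ => hVi _]
  have hprod : (∏ l, Real.exp (-β * selfEnergy β L u (ω l))) *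
      (∏ l, ∏ l' ∈ Finset.Iio l, Real.exp (-β * pairEnergy β L u (ω l') (ω l))) =
      Real.exp (-β * (∑ l, selfEnergy β L u (ω l) +
        ∑ l, ∑ l' ∈ Finset.Iio l, pairEnergy β L u (ω l') (ω l))) := by
    simp_rw [← Real.exp_sum, ← Finset.mul_sum]
    rw [← Real.exp_add, ← mul_add]
  rw [hprod, Complex.ofReal_exp]
  congr 1
  rw [Finset.sum_coe_sort (pairs (∑ l, n l)) fun e => ∫ s in (0 : ℝ)..1, V (pairDiff n β ω e s),
    sum_pairs_eq_sum_cycles n fun j k => ∫ s in (0 : ℝ)..1, V (pairDiff n β ω (j, k) s)]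
  push_cast
  congr 2
  · exact Finset.sum_congr rfl fun l _ => hself l
  · exact Finset.sum_congr rfl fun l _ => Finset.sum_congr rfl fun l' hl' =>
      hpair l l' (Finset.mem_Iio.1 hl')

end energies

/-! ### The Fourier series of the pair potential along a path -/

lemma star_wave {d : ℕ} (k x : EuclideanSpace ℝ (Fin d)) :
    (starRingEnd ℂ) (wave k x) = wave (-k) x := by
  unfold wave
  rw [← Complex.exp_conj, map_mul, Complex.conj_ofReal, Complex.conj_I, inner_neg_left]
  push_cast
  ring_nf

/-- Conjugation acts on the transform of a real function as the reflection `x ↦ -x`, under which `u`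
is invariant. -/
lemma fourier_eq_ofReal {d : ℕ} {u : EuclideanSpace ℝ (Fin d) → ℝ} (hu : ∀ x, u (-x) = u x)
    (k : EuclideanSpace ℝ (Fin d)) :
    FourierTransform.fourier (fun x => (u x : ℂ)) k = (fourierU u k : ℂ) := by
  unfold fourierU
  rw [Eq.comm, ← Complex.conj_eq_iff_re, fourier_eq_integral_wave, ← integral_conj]
  simp_rw [map_mul, star_wave, Complex.conj_ofReal]
  rw [← integral_neg_eq_self]
  refine integral_congr_ae (Filter.Eventually.of_forall fun x => ?_)
  simp only [hu, wave_neg_right, neg_neg]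

lemma integral_exp_unit_character {L : ℝ} (hL : 0 < L) (a : ℤ) :
    ∫ t in Set.Ioc (-L / 2) (L / 2), Complex.exp (2 * Real.pi * Complex.I * (L⁻¹ * a * t)) =
      if a = 0 then (L : ℂ) else 0 := by
  have hLc : (L : ℂ) ≠ 0 := by exact_mod_cast hL.ne'
  rw [← intervalIntegral.integral_of_le (by linarith)]
  split_ifs with ha
  · subst ha
    simp
    ring
  · have hac : (a : ℂ) ≠ 0 := by exact_mod_cast ha
    have hpi : (Real.pi : ℂ) ≠ 0 := by exact_mod_cast Real.pi_ne_zero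
    have hc : 2 * Real.pi * Complex.I * ((L : ℂ)⁻¹ * a) ≠ 0 :=
      mul_ne_zero (mul_ne_zero (mul_ne_zero two_ne_zero hpi) Complex.I_ne_zero)
        (mul_ne_zero (inv_ne_zero hLc) hac)
    have h := integral_exp_mul_complex (a := -L / 2) (b := L / 2) hc
    simp_rw [mul_assoc (2 * Real.pi * Complex.I)] at h ⊢
    rw [Complex.ofReal_inv, h]
    -- The exponents at the two ends of the period differ by `2πi a`, so the primitive takes the
    -- same value at both.
    have h1 : 2 * Real.pi * Complex.I * ((L : ℂ)⁻¹ * a * ((L / 2 : ℝ) : ℂ)) =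
        2 * Real.pi * Complex.I * ((L : ℂ)⁻¹ * a * ((-L / 2 : ℝ) : ℂ)) +
          a * (2 * Real.pi * Complex.I) := by
      push_cast
      field_simp
      ring
    rw [h1, Complex.exp_periodic.int_mul a, sub_self, zero_div]

lemma measurableSet_cube (d : ℕ) (L : ℝ) : MeasurableSet (cube d L) := by
  unfold cube
  simp_rw [Set.ofPred_forall]
  refine MeasurableSet.iInter fun i => ?_
  have h : Measurable fun x : EuclideanSpace ℝ (Fin d) => x i := by fun_prop
  exact h measurableSet_Ioc

/-- Orthogonality of characters, one coordinate at a time. It is the source of the constraints on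
the loops `l ≥ 1`. -/
lemma integral_cube_wave {d : ℕ} {L : ℝ} (hL : 0 < L) (a : Fin d → ℤ) :
    ∫ x in cube d L, wave (latticeVec L⁻¹ a) x = if a = 0 then (L : ℂ) ^ d else 0 := by
  have h1 := (PiLp.volume_preserving_toLp (Fin d)).setIntegral_preimage_emb
    (MeasurableEquiv.toLp 2 (Fin d → ℝ)).measurableEmbedding (wave (latticeVec L⁻¹ a)) (cube d L)
  have h2 : (WithLp.toLp 2) ⁻¹' (cube d L) =
      Set.univ.pi fun _ : Fin d => Set.Ioc (-L / 2) (L / 2) := by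
    ext x
    simp [cube, Set.mem_pi]
  have h3 (x : Fin d → ℝ) : wave (latticeVec L⁻¹ a) (WithLp.toLp 2 x) =
      ∏ i, Complex.exp (2 * Real.pi * Complex.I * (L⁻¹ * a i * x i)) := by
    rw [wave, ← Complex.exp_sum, PiLp.inner_apply, Finset.mul_sum, Complex.ofReal_sum,
      Finset.sum_mul]
    congr 1
    refine Finset.sum_congr rfl fun i _ => ?_
    simp [latticeVec]
    ring
  rw [← h1, h2, volume_pi, Measure.restrict_pi_pi]
  simp_rw [h3]
  rw [integral_fintype_prod_eq_prod fun (i : Fin d) (t : ℝ) =>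
    Complex.exp (2 * Real.pi * Complex.I * (L⁻¹ * a i * t))]
  simp_rw [integral_exp_unit_character hL]
  rw [Finset.prod_ite_zero]
  simp [funext_iff]

lemma volume_cube_lt_top {d : ℕ} {L : ℝ} : volume (cube d L) < ⊤ := by
  have h1 := (PiLp.volume_preserving_toLp (Fin d)).measure_preimage
    (measurableSet_cube d L).nullMeasurableSet
  have h2 : (WithLp.toLp 2) ⁻¹' (cube d L) =
      Set.univ.pi fun _ : Fin d => Set.Ioc (-L / 2) (L / 2) := by
    ext x
    simp [cube, Set.mem_pi]
  rw [← h1, h2, volume_pi, Measure.pi_pi]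
  exact ENNReal.prod_lt_top fun i _ => by simp

section potential
variable {d : ℕ} {β L : ℝ} {c : (Fin d → ℤ) → ℝ}

/-- The sum of the Fourier series with coefficients `L⁻ᵈ c`. -/
noncomputable def seriesPotential (L : ℝ) (c : (Fin d → ℤ) → ℝ) (x : EuclideanSpace ℝ (Fin d)) :
    ℂ :=
  ((L : ℂ) ^ d)⁻¹ * ∑' z : Fin d → ℤ, (c z : ℂ) * wave (latticeVec L⁻¹ z) x

lemma norm_mul_wave (z : Fin d → ℤ) (k x : EuclideanSpace ℝ (Fin d)) :
    ‖(c z : ℂ) * wave k x‖ = |c z| := by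
  rw [norm_mul, norm_wave, mul_one, Complex.norm_real, Real.norm_eq_abs]

lemma continuous_seriesPotential (hc : Summable fun z => |c z|) :
    Continuous (seriesPotential L c) := by
  unfold seriesPotential
  refine continuous_const.mul ?_
  exact continuous_tsum (fun z => continuous_const.mul (continuous_wave _)) hc fun z x =>
    (norm_mul_wave z _ x).le

lemma norm_seriesPotential_le (hc : Summable fun z => |c z|) (x : EuclideanSpace ℝ (Fin d)) :
    ‖seriesPotential L c x‖ ≤ ‖((L : ℂ) ^ d)⁻¹‖ * ∑' z, |c z| := by
  unfold seriesPotential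
  rw [norm_mul]
  refine mul_le_mul_of_nonneg_left ?_ (norm_nonneg _)
  exact tsum_of_norm_bounded hc.hasSum fun z => (norm_mul_wave z _ x).le

lemma norm_integral_wave_le (k : EuclideanSpace ℝ (Fin d)) (f : ℝ → EuclideanSpace ℝ (Fin d)) :
    ‖∫ s in Set.Icc (0 : ℝ) 1, wave k (f s)‖ ≤ 1 := by
  have h := norm_setIntegral_le_of_norm_le_const (μ := volume) (s := Set.Icc (0 : ℝ) 1)
    (f := fun s => wave k (f s)) (C := 1) (by simp) fun s _ => (norm_wave _ _).le
  simpa using h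

/-- Absolute convergence permits integration term by term. The mode `0`, whose wave is constant, is
set apart because it becomes the prefactor. -/
lemma integral_seriesPotential (hc : Summable fun z => |c z|)
    {f : ℝ → EuclideanSpace ℝ (Fin d)} (hf : Measurable f) :
    -β * ∫ s in (0 : ℝ)..1, seriesPotential L c (f s) =
      ((-β / L ^ d * c 0 : ℝ) : ℂ) + ∑' z : {v : Fin d → ℤ // v ≠ 0},
        ((-β / L ^ d * c z : ℝ) : ℂ) * ∫ s in Set.Icc (0 : ℝ) 1, wave (latticeVec L⁻¹ z) (f s) := by
  set J : (Fin d → ℤ) → ℂ := fun z => ∫ s in Set.Icc (0 : ℝ) 1, wave (latticeVec L⁻¹ z) (f s)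
    with hJ
  have hwm (z : Fin d → ℤ) : AEStronglyMeasurable (fun s => wave (latticeVec L⁻¹ z) (f s))
      (volume.restrict (Set.Icc (0 : ℝ) 1)) :=
    ((continuous_wave _).measurable.comp hf).aestronglyMeasurable
  have hwi (z : Fin d → ℤ) : Integrable (fun s => (c z : ℂ) * wave (latticeVec L⁻¹ z) (f s))
      (volume.restrict (Set.Icc (0 : ℝ) 1)) :=
    ((integrable_const (1 : ℝ)).mono' (hwm z) (Filter.Eventually.of_forall fun s =>
      (norm_wave _ _).le)).const_mul _
  have h1 : ∫ s in (0 : ℝ)..1, seriesPotential L c (f s) =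
      ((L : ℂ) ^ d)⁻¹ * ∑' z, (c z : ℂ) * J z := by
    rw [intervalIntegral.integral_of_le zero_le_one, ← integral_Icc_eq_integral_Ioc]
    unfold seriesPotential
    rw [integral_const_mul, ← integral_tsum_of_summable_integral_norm hwi]
    · simp_rw [integral_const_mul, hJ]
    · refine hc.congr fun z => ?_
      simp_rw [norm_mul_wave]
      simp
  have hs : Summable fun z => ((-β / L ^ d * c z : ℝ) : ℂ) * J z := by
    refine Summable.of_norm_bounded (hc.mul_left |(-β / L ^ d)|) fun z => ?_
    rw [norm_mul, Complex.norm_real, Real.norm_eq_abs, abs_mul]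
    exact mul_le_of_le_one_right (by positivity) (norm_integral_wave_le _ _)
  have hJ0 : J 0 = 1 := by simp [hJ]
  have h2 : -β * (((L : ℂ) ^ d)⁻¹ * ∑' z, (c z : ℂ) * J z) =
      ∑' z, ((-β / L ^ d * c z : ℝ) : ℂ) * J z := by
    rw [← tsum_mul_left, ← tsum_mul_left]
    refine tsum_congr fun z => ?_
    push_cast
    ring
  rw [h1, h2, ← hs.tsum_subtype_add_tsum_subtype_compl {0},
    tsum_singleton (0 : Fin d → ℤ) fun z => ((-β / L ^ d * c z : ℝ) : ℂ) * J z, hJ0, mul_one]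
  rfl

end potential

/-! ### Integrals over the times -/

lemma unitTimes_eq {N : ℕ} (α : Multiplicities N) :
    unitTimes α = Set.univ.pi fun e => Set.univ.pi fun _ : Fin (α e) => Set.Icc (0 : ℝ) 1 := by
  ext τ
  simp only [unitTimes, Set.mem_ofPred_eq, Set.mem_pi, Set.mem_univ, true_imp_iff]

lemma restrict_unitTimes {N : ℕ} (α : Multiplicities N) :
    (volume : Measure (Times α)).restrict (unitTimes α) = Measure.pi fun e => Measure.pi
      fun _ : Fin (α e) => volume.restrict (Set.Icc (0 : ℝ) 1) := by
  rw [unitTimes_eq, volume_pi, Measure.restrict_pi_pi]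
  congr 1
  ext1 e
  rw [volume_pi, Measure.restrict_pi_pi]

instance {N : ℕ} (α : Multiplicities N) :
    IsProbabilityMeasure ((volume : Measure (Times α)).restrict (unitTimes α)) := by
  have : IsProbabilityMeasure (volume.restrict (Set.Icc (0 : ℝ) 1)) := ⟨by simp⟩
  rw [restrict_unitTimes]
  infer_instance

lemma measurableSet_unitTimes {N : ℕ} (α : Multiplicities N) : MeasurableSet (unitTimes α) := by
  rw [unitTimes_eq]
  exact MeasurableSet.univ_pi fun e => MeasurableSet.univ_pi fun _ => measurableSet_Icc

lemma integral_unitTimes_prod {N : ℕ} (α : Multiplicities N)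
    (f : (e : pairs N) → Fin (α e) → ℝ → ℂ) :
    ∫ τ in unitTimes α, ∏ e, ∏ r, f e r (τ e r) =
      ∏ e, ∏ r, ∫ s in Set.Icc (0 : ℝ) 1, f e r s := by
  rw [restrict_unitTimes, integral_fintype_prod_eq_prod
    fun (e : pairs N) (σ : Fin (α e) → ℝ) => ∏ r, f e r (σ r)]
  refine Finset.prod_congr rfl fun e _ => ?_
  exact integral_fintype_prod_eq_prod _

/-! ### Integration over the trajectories -/

lemma latticeVec_zsmul {d : ℕ} (c : ℝ) (k : ℤ) (z : Fin d → ℤ) :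
    latticeVec c (k • z) = k • latticeVec c z := by
  ext i
  simp [latticeVec]
  ring

lemma latticeVec_sum {d : ℕ} {M : Type*} [Fintype M] (c : ℝ) (z : M → Fin d → ℤ) :
    latticeVec c (∑ m, z m) = ∑ m, latticeVec c (z m) := by
  ext i
  simp [latticeVec, Finset.mul_sum]

section trajectories
variable {d p : ℕ} {ħ m₀ β L : ℝ} (n : Fin (p + 1) → ℕ) {α : Multiplicities (∑ l, n l)}

/-- The product of the plane waves of given vectors, evaluated along the trajectories. -/
noncomputable def waveProduct (β L : ℝ) (z : Vectors d α)
    (ω : (l : Fin (p + 1)) → Trajectory d (n l * β)) (τ : Times α) : ℂ :=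
  ∏ e, ∏ r, wave (latticeVec L⁻¹ (z e r : Fin d → ℤ)) (pairDiff n β ω e (τ e r))

/-- The sum of all wave vectors along cycle `l`. -/
def cycleMomentum (z : Vectors d α) (l : Fin (p + 1)) : Fin d → ℤ := ∑ m, waveVector n z l m

/-- The Fourier series whose coefficients are the weights of cycle `l`. -/
noncomputable def cycleSum (ħ m₀ β L : ℝ) (z : Vectors d α) (τ : Times α) (l : Fin (p + 1))
    (ξ : EuclideanSpace ℝ (Fin d)) : ℂ :=
  ∑' w : Fin d → ℤ, (cycleWeight ħ m₀ β L n z τ l w : ℂ) * wave (latticeVec L⁻¹ w) ξ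

lemma norm_waveProduct (z : Vectors d α) (ω : (l : Fin (p + 1)) → Trajectory d (n l * β))
    (τ : Times α) : ‖waveProduct n β L z ω τ‖ = 1 := by
  unfold waveProduct
  simp_rw [norm_prod, norm_wave, Finset.prod_const_one]

lemma measurable_wave_pairDiff {Ω : Type*} [MeasurableSpace Ω] (k : EuclideanSpace ℝ (Fin d))
    (e : ℕ × ℕ) {F : Ω → (l : Fin (p + 1)) → Trajectory d (n l * β)} (hF : Measurable F)
    {G : Ω → ℝ} (hG : Measurable G) : Measurable fun q => wave k (pairDiff n β (F q) e (G q)) := by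
  have h := (measurable_pairDiff_uncurry n β e).comp (hF.prodMk hG)
  exact (continuous_wave k).measurable.comp h

lemma measurable_waveProduct (z : Vectors d α) :
    Measurable fun q : ((l : Fin (p + 1)) → Trajectory d (n l * β)) × Times α =>
      waveProduct n β L z q.1 q.2 :=
  Finset.measurable_prod _ fun e _ => Finset.measurable_prod _ fun r _ =>
    measurable_wave_pairDiff n _ e measurable_fst
      ((measurable_pi_apply r).comp ((measurable_pi_apply e).comp measurable_snd))

/-- The phase is linear in the positions, so it can be regrouped by trajectory: each vector `z` of a
pair puts a wave `± z / L` on each of the two particles, at the time of that vector. -/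
lemma waveProduct_eq (z : Vectors d α) (ω : (l : Fin (p + 1)) → Trajectory d (n l * β))
    (τ : Times α) : waveProduct n β L z ω τ =
      ∏ l, Complex.exp (((2 * Real.pi * ∑ m, inner ℝ (latticeVec L⁻¹ (waveVector n z l m))
        (position (ω l) (waveTime n τ l m * β)) : ℝ) : ℂ) * Complex.I) := by
  unfold waveProduct wave
  simp_rw [← Complex.exp_sum, ← Finset.sum_mul, ← Complex.ofReal_sum, ← Finset.mul_sum]
  congr 4
  have h (l : Fin (p + 1)) : ∑ m, inner ℝ (latticeVec L⁻¹ (waveVector n z l m))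
        (position (ω l) (waveTime n τ l m * β)) =
      ∑ e : pairs (∑ l, n l), ∑ r : Fin (α e), ∑ i ∈ Finset.range (n l),
        inner ℝ (latticeVec L⁻¹ (z e r : Fin d → ℤ))
          (pairSign n l i e • position (ω l) ((i + τ e r) * β)) := by
    rw [← sum_waveIndex n l fun e r i => inner ℝ (latticeVec L⁻¹ (z e r : Fin d → ℤ))
          (pairSign n l i e • position (ω l) ((i + τ e r) * β))]
    refine Finset.sum_congr rfl fun m _ => ?_
    rw [waveVector, latticeVec_zsmul, ← Int.cast_smul_eq_zsmul ℝ, ← Int.cast_smul_eq_zsmul ℝ,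
      real_inner_smul_left, real_inner_smul_right]
    rfl
  simp_rw [h]
  rw [Finset.sum_comm]
  refine Finset.sum_congr rfl fun e _ => ?_
  rw [Finset.sum_comm]
  refine Finset.sum_congr rfl fun r _ => ?_
  rw [pairDiff, inner_sum]
  exact Finset.sum_congr rfl fun l _ => inner_sum _ _ _

lemma isFiniteMeasure_cyclesMeasure (hħ : 0 < ħ) (hm₀ : 0 < m₀) (hβ : 0 < β) (hL : 0 < L)
    (hn : ∀ l, 1 ≤ n l) (X Y : Fin (p + 1) → EuclideanSpace ℝ (Fin d)) :
    IsFiniteMeasure (cyclesMeasure ħ m₀ β L n X Y) := by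
  have hT (l) : 0 < n l * β := mul_pos (by exact_mod_cast hn l) hβ
  have := fun l => isFiniteMeasure_torusWienerMeasure hħ hm₀ (hT l) hL (X l) (Y l)
  infer_instance

lemma integral_waveProduct (hħ : 0 < ħ) (hm₀ : 0 < m₀) (hβ : 0 < β) (hL : 0 < L)
    (hn : ∀ l, 1 ≤ n l) (X ξ : Fin (p + 1) → EuclideanSpace ℝ (Fin d)) (z : Vectors d α)
    {τ : Times α} (hτ : τ ∈ unitTimes α) :
    ∫ ω, waveProduct n β L z ω τ ∂cyclesMeasure ħ m₀ β L n X (fun l => X l + ξ l) =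
      (∏ l, wave (latticeVec L⁻¹ (cycleMomentum n z l)) (X l)) *
        ∏ l, ((L : ℂ) ^ d)⁻¹ * cycleSum n ħ m₀ β L z τ l (ξ l) := by
  have hT (l) : 0 < n l * β := mul_pos (by exact_mod_cast hn l) hβ
  have := fun l => isFiniteMeasure_torusWienerMeasure hħ hm₀ (hT l) hL (X l) (X l + ξ l)
  simp_rw [waveProduct_eq]
  rw [integral_fintype_prod_eq_prod fun l (ω : Trajectory d (n l * β)) =>
    Complex.exp (((2 * Real.pi * ∑ m, inner ℝ (latticeVec L⁻¹ (waveVector n z l m))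
        (position ω (waveTime n τ l m * β)) : ℝ) : ℂ) * Complex.I), ← Finset.prod_mul_distrib]
  refine Finset.prod_congr rfl fun l _ => ?_
  rw [integral_exp_torusWienerMeasure hħ hm₀ hβ hL (hn l) _ _ _ (waveTime_mem n hτ l),
    cycleMomentum, latticeVec_sum, cycleSum, mul_assoc]
  simp_rw [cycleWeight_eq n ħ m₀ β L z hτ l]

lemma integrable_waveProduct (hħ : 0 < ħ) (hm₀ : 0 < m₀) (hβ : 0 < β) (hL : 0 < L)
    (hn : ∀ l, 1 ≤ n l) (X Y : Fin (p + 1) → EuclideanSpace ℝ (Fin d)) (z : Vectors d α) :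
    Integrable (Function.uncurry fun ω τ => waveProduct n β L z ω τ)
      ((cyclesMeasure ħ m₀ β L n X Y).prod (volume.restrict (unitTimes α))) := by
  have := isFiniteMeasure_cyclesMeasure n hħ hm₀ hβ hL hn X Y
  exact (integrable_const (1 : ℝ)).mono' (measurable_waveProduct n z).aestronglyMeasurable
    (Filter.Eventually.of_forall fun q => (norm_waveProduct n z q.1 q.2).le)

/-- With base points `0`, the product is the integral over the trajectories of a bounded jointly
measurable function. Integrability in `τ` thus comes from Fubini, without an analysis of the series.
-/
lemma integrableOn_prod_cycleSum (hħ : 0 < ħ) (hm₀ : 0 < m₀) (hβ : 0 < β) (hL : 0 < L)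
    (hn : ∀ l, 1 ≤ n l) (ξ : Fin (p + 1) → EuclideanSpace ℝ (Fin d)) (z : Vectors d α) :
    IntegrableOn (fun τ => ∏ l, ((L : ℂ) ^ d)⁻¹ * cycleSum n ħ m₀ β L z τ l (ξ l))
      (unitTimes α) := by
  have := isFiniteMeasure_cyclesMeasure n hħ hm₀ hβ hL hn 0 fun l => 0 + ξ l
  refine (integrable_waveProduct n hħ hm₀ hβ hL hn 0 (fun l => 0 + ξ l) z).integral_prod_right.congr
    ?_
  filter_upwards [ae_restrict_mem (measurableSet_unitTimes α)] with τ hτ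
  have h := integral_waveProduct n hħ hm₀ hβ hL hn 0 ξ z hτ
  simp only [Pi.zero_apply, wave_zero_right, Finset.prod_const_one, one_mul] at h
  exact h

lemma integral_integral_waveProduct (hħ : 0 < ħ) (hm₀ : 0 < m₀) (hβ : 0 < β) (hL : 0 < L)
    (hn : ∀ l, 1 ≤ n l) (X ξ : Fin (p + 1) → EuclideanSpace ℝ (Fin d)) (z : Vectors d α) :
    ∫ ω, (∫ τ in unitTimes α, waveProduct n β L z ω τ)
        ∂cyclesMeasure ħ m₀ β L n X (fun l => X l + ξ l) =
      (∏ l, wave (latticeVec L⁻¹ (cycleMomentum n z l)) (X l)) *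
        ∫ τ in unitTimes α, ∏ l, ((L : ℂ) ^ d)⁻¹ * cycleSum n ħ m₀ β L z τ l (ξ l) := by
  have := isFiniteMeasure_cyclesMeasure n hħ hm₀ hβ hL hn X fun l => X l + ξ l
  rw [integral_integral_swap (integrable_waveProduct n hħ hm₀ hβ hL hn X _ z),
    ← integral_const_mul]
  exact setIntegral_congr_fun (measurableSet_unitTimes α) fun τ hτ =>
    integral_waveProduct n hħ hm₀ hβ hL hn X ξ z hτ

lemma norm_integral_waveProduct_le (z : Vectors d α)
    (ω : (l : Fin (p + 1)) → Trajectory d (n l * β)) :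
    ‖∫ τ in unitTimes α, waveProduct n β L z ω τ‖ ≤ 1 := by
  have h := norm_integral_le_of_norm_le_const (μ := volume.restrict (unitTimes α))
    (f := fun τ => waveProduct n β L z ω τ) (C := 1)
    (Filter.Eventually.of_forall fun τ => (norm_waveProduct n z ω τ).le)
  simpa using h

/-- The product of the coefficients of given vectors, with the factorials. -/
noncomputable def coefficient (β L : ℝ) (c : (Fin d → ℤ) → ℝ) {N : ℕ}
    (x : Σ α : Multiplicities N, Vectors d α) : ℝ :=
  ∏ e, (1 / ((x.1 e).factorial : ℝ) * ∏ r, (-β / L ^ d * c (x.2 e r)))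

lemma summable_abs_coefficient {c : (Fin d → ℤ) → ℝ} (hc : Summable fun z => |c z|) (N : ℕ) :
    Summable fun x : Σ α : Multiplicities N, Vectors d α => |coefficient β L c x| := by
  have h := (summable_norm_and_hasSum_exp (ι := pairs N) (V := {v : Fin d → ℤ // v ≠ 0})
    (fun _ v => ((-β / L ^ d * c v : ℝ) : ℂ)) fun _ => by
      simp_rw [Complex.norm_real, Real.norm_eq_abs, abs_mul]
      exact (hc.comp_injective Subtype.val_injective).mul_left _).1
  refine h.congr fun x => ?_
  rw [← Real.norm_eq_abs, ← Complex.norm_real, coefficient]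
  push_cast
  rfl

/-- The modes `0` of all pairs factor out. In the expansion of the remaining exponential, the
product of the single-time integrals is one integral over `unitTimes`. -/
lemma hasSum_exp_seriesPotential {c : (Fin d → ℤ) → ℝ} (hc : Summable fun z => |c z|)
    (ω : (l : Fin (p + 1)) → Trajectory d (n l * β)) :
    HasSum (fun x : Σ α : Multiplicities (∑ l, n l), Vectors d α =>
        (Real.exp ((pairs (∑ l, n l)).card * (-β / L ^ d * c 0)) : ℂ) *
          ((coefficient β L c x : ℂ) * ∫ τ in unitTimes x.1, waveProduct n β L x.2 ω τ))
      (Complex.exp (-β * ∑ e : pairs (∑ l, n l), ∫ s in (0 : ℝ)..1,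
        seriesPotential L c (pairDiff n β ω e s))) := by
  rw [Finset.mul_sum]
  simp_rw [integral_seriesPotential hc (measurable_pairDiff n β ω _)]
  rw [Finset.sum_add_distrib, Complex.exp_add, Finset.sum_const, Finset.card_univ,
    Fintype.card_coe, nsmul_eq_mul, Complex.ofReal_exp, Complex.ofReal_mul, Complex.ofReal_natCast]
  refine HasSum.mul_left _ ?_
  refine (summable_norm_and_hasSum_exp (fun (e : pairs (∑ l, n l)) (z : {v : Fin d → ℤ // v ≠ 0}) =>
    ((-β / L ^ d * c z : ℝ) : ℂ) * ∫ s in Set.Icc (0 : ℝ) 1,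
      wave (latticeVec L⁻¹ z) (pairDiff n β ω e s)) fun e => ?_).2.congr_fun ?_
  · refine Summable.of_nonneg_of_le (fun _ => norm_nonneg _) (fun z => ?_)
      ((hc.comp_injective Subtype.val_injective).mul_left |(-β / L ^ d)|)
    rw [norm_mul, Complex.norm_real, Real.norm_eq_abs, abs_mul]
    exact mul_le_of_le_one_right (by positivity) (norm_integral_wave_le _ _)
  · intro x
    unfold waveProduct
    rw [integral_unitTimes_prod x.1 fun e r s =>
      wave (latticeVec L⁻¹ (x.2 e r : Fin d → ℤ)) (pairDiff n β ω e s), coefficient]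
    push_cast
    simp_rw [Finset.prod_mul_distrib]
    ring

end trajectories

/-- An unconditionally convergent sum may be taken fibre by fibre; since the constants are nonzero,
summability of a fibre survives division by them. -/
lemma summable_and_hasSum_sigma_mul {ι : Type*} {κ : ι → Type*} {E S : ℝ} {k : ι → ℝ}
    {f : ∀ i, κ i → ℝ} (hE : E ≠ 0) (hk : ∀ i, k i ≠ 0)
    (h : HasSum (fun a : Σ i, κ i => E * (k a.1 * f a.1 a.2)) S) :
    (∀ i, Summable (f i)) ∧ HasSum (fun i => E * (k i * ∑' z, f i z)) S := by
  have hs (i) : Summable (f i) := by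
    have h3 : Summable fun z => E * (k i * f i z) := h.summable.sigma_factor i
    rwa [summable_mul_left_iff hE, summable_mul_left_iff (hk i)] at h3
  exact ⟨hs, h.sigma fun i => ((hs i).hasSum.mul_left _).mul_left _⟩

/-! ### Interchange of the expansion with the path integral -/

section expansion
variable {d p : ℕ} {ħ m₀ β L : ℝ} (n : Fin (p + 1) → ℕ)

/-- The time integral of the Fourier series of all cycles. -/
noncomputable def timeIntegral (ħ m₀ β L : ℝ) (ξ : Fin (p + 1) → EuclideanSpace ℝ (Fin d))
    (x : Σ α : Multiplicities (∑ l, n l), Vectors d α) : ℂ :=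
  ∫ τ in unitTimes x.1, ∏ l, ((L : ℂ) ^ d)⁻¹ * cycleSum n ħ m₀ β L x.2 τ l (ξ l)

/-- For base points `0` this is the average of functions of modulus at most one. The bound is the
same for all multiplicities and vectors, so it can dominate the whole expansion. -/
lemma norm_timeIntegral_le (hħ : 0 < ħ) (hm₀ : 0 < m₀) (hβ : 0 < β) (hL : 0 < L)
    (hn : ∀ l, 1 ≤ n l) (ξ : Fin (p + 1) → EuclideanSpace ℝ (Fin d))
    (x : Σ α : Multiplicities (∑ l, n l), Vectors d α) :
    ‖timeIntegral n ħ m₀ β L ξ x‖ ≤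
      (cyclesMeasure ħ m₀ β L n 0 (fun l => 0 + ξ l)).real Set.univ := by
  have := isFiniteMeasure_cyclesMeasure n hħ hm₀ hβ hL hn 0 fun l => 0 + ξ l
  have h := integral_integral_waveProduct n hħ hm₀ hβ hL hn 0 ξ x.2
  simp only [Pi.zero_apply, wave_zero_right, Finset.prod_const_one, one_mul] at h
  rw [timeIntegral, ← h]
  have h2 := norm_integral_le_of_norm_le_const
    (μ := cyclesMeasure ħ m₀ β L n 0 (fun l => 0 + ξ l))
    (f := fun ω => ∫ τ in unitTimes x.1, waveProduct n β L x.2 ω τ) (C := 1)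
    (Filter.Eventually.of_forall fun ω => norm_integral_waveProduct_le n x.2 ω)
  simpa using h2

/-- The expansion of the path integral with fixed end points. -/
theorem hasSum_integral_boltzmannFactor (hħ : 0 < ħ) (hm₀ : 0 < m₀) (hβ : 0 < β) (hL : 0 < L)
    (hn : ∀ l, 1 ≤ n l) (u : EuclideanSpace ℝ (Fin d) → ℝ) {c : (Fin d → ℤ) → ℝ}
    (hc : Summable fun z => |c z|) (hV : ∀ᵐ x, (periodized L u x : ℂ) = seriesPotential L c x)
    (X ξ : Fin (p + 1) → EuclideanSpace ℝ (Fin d)) :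
    HasSum (fun x : Σ α : Multiplicities (∑ l, n l), Vectors d α =>
        (Real.exp ((pairs (∑ l, n l)).card * (-β / L ^ d * c 0)) : ℂ) *
          ((coefficient β L c x : ℂ) *
            ((∏ l, wave (latticeVec L⁻¹ (cycleMomentum n x.2 l)) (X l)) *
              timeIntegral n ħ m₀ β L ξ x)))
      (∫ ω, (((∏ l, Real.exp (-β * selfEnergy β L u (ω l))) *
        (∏ l, ∏ l' ∈ Finset.Iio l, Real.exp (-β * pairEnergy β L u (ω l') (ω l))) : ℝ) : ℂ)
        ∂cyclesMeasure ħ m₀ β L n X (fun l => X l + ξ l)) := by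
  have := isFiniteMeasure_cyclesMeasure n hħ hm₀ hβ hL hn X fun l => X l + ξ l
  set μ := cyclesMeasure ħ m₀ β L n X (fun l => X l + ξ l) with hμ
  set E := Real.exp ((pairs (∑ l, n l)).card * (-β / L ^ d * c 0)) with hE
  set F : (Σ α : Multiplicities (∑ l, n l), Vectors d α) →
      ((l : Fin (p + 1)) → Trajectory d (n l * β)) → ℂ := fun x ω =>
    (E : ℂ) * ((coefficient β L c x : ℂ) *
      ∫ τ in unitTimes x.1, waveProduct n β L x.2 ω τ) with hF
  have hJ (x : Σ α : Multiplicities (∑ l, n l), Vectors d α) :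
      Integrable (fun ω => ∫ τ in unitTimes x.1, waveProduct n β L x.2 ω τ) μ :=
    (integrable_waveProduct n hħ hm₀ hβ hL hn X _ x.2).integral_prod_left
  have hFi (x) : Integrable (F x) μ := ((hJ x).const_mul _).const_mul _
  -- The time average of unimodular functions is at most one in norm, so the summable coefficients
  -- dominate uniformly in `ω`.
  have hFn (x ω) : ‖F x ω‖ ≤ E * |coefficient β L c x| := by
    rw [hF, norm_mul, norm_mul, Complex.norm_real, Complex.norm_real, Real.norm_eq_abs,
      Real.norm_eq_abs, abs_of_pos (Real.exp_pos _)]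
    refine mul_le_mul_of_nonneg_left ?_ (Real.exp_pos _).le
    exact mul_le_of_le_one_right (abs_nonneg _) (norm_integral_waveProduct_le n x.2 ω)
  have hs : Summable fun x => ∫ ω, ‖F x ω‖ ∂μ := by
    refine Summable.of_nonneg_of_le (fun x => integral_nonneg fun _ => norm_nonneg _) (fun x => ?_)
      (((summable_abs_coefficient (β := β) (L := L) hc (∑ l, n l)).mul_left E).mul_left
        (μ.real Set.univ))
    calc ∫ ω, ‖F x ω‖ ∂μ ≤ ∫ _, E * |coefficient β L c x| ∂μ :=
          integral_mono (hFi x).norm (integrable_const _) (hFn x)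
      _ = _ := by rw [integral_const, smul_eq_mul]
  have h := hasSum_integral_of_summable_integral_norm hFi hs
  have h2 := ae_boltzmannFactor_eq hħ hm₀ hβ hL u (continuous_seriesPotential hc).measurable
    (norm_seriesPotential_le hc) hV n hn X (fun l => X l + ξ l)
  have h3 : ∫ ω, ∑' x, F x ω ∂μ =
      ∫ ω, (((∏ l, Real.exp (-β * selfEnergy β L u (ω l))) *
        (∏ l, ∏ l' ∈ Finset.Iio l, Real.exp (-β * pairEnergy β L u (ω l') (ω l))) : ℝ) : ℂ) ∂μ := by
    refine integral_congr_ae ?_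
    filter_upwards [h2] with ω hω
    rw [hω]
    exact (hasSum_exp_seriesPotential n hc ω).tsum_eq
  rw [h3] at h
  refine h.congr_fun fun x => ?_
  rw [hF, integral_const_mul, integral_const_mul,
    integral_integral_waveProduct n hħ hm₀ hβ hL hn X ξ x.2]
  rfl

lemma setOf_forall_mem_cube : {y : Fin p → EuclideanSpace ℝ (Fin d) | ∀ l, y l ∈ cube d L} =
    Set.univ.pi fun _ => cube d L := by
  ext y
  simp

lemma integral_cubes_wave (hL : 0 < L) (a : Fin p → Fin d → ℤ) :
    ∫ y in {y : Fin p → EuclideanSpace ℝ (Fin d) | ∀ l, y l ∈ cube d L},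
      ∏ l, wave (latticeVec L⁻¹ (a l)) (y l) = ∏ l, if a l = 0 then (L : ℂ) ^ d else 0 := by
  rw [setOf_forall_mem_cube, volume_pi, Measure.restrict_pi_pi,
    integral_fintype_prod_eq_prod fun l (x : EuclideanSpace ℝ (Fin d)) =>
      wave (latticeVec L⁻¹ (a l)) x]
  simp_rw [integral_cube_wave hL]

/-- The expansion of the path integral, in complex form. -/
theorem hasSum_pathIntegral_complex (hħ : 0 < ħ) (hm₀ : 0 < m₀) (hβ : 0 < β) (hL : 0 < L)
    (hn : ∀ l, 1 ≤ n l) (u : EuclideanSpace ℝ (Fin d) → ℝ) {c : (Fin d → ℤ) → ℝ}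
    (hc : Summable fun z => |c z|) (hV : ∀ᵐ x, (periodized L u x : ℂ) = seriesPotential L c x)
    (x : EuclideanSpace ℝ (Fin d)) :
    HasSum (fun a : Σ α : Multiplicities (∑ l, n l), Vectors d α =>
        (L : ℂ) ^ d * ((Real.exp ((pairs (∑ l, n l)).card * (-β / L ^ d * c 0)) : ℂ) *
          ((coefficient β L c a : ℂ) *
            ((∏ l : Fin p, if cycleMomentum n a.2 l.succ = 0 then (L : ℂ) ^ d else 0) *
              timeIntegral n ħ m₀ β L (Fin.cons x 0) a))))
      (pathIntegral ħ m₀ β L u n x : ℂ) := by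
  set S := {y : Fin p → EuclideanSpace ℝ (Fin d) | ∀ l, y l ∈ cube d L} with hS
  have hSfin : IsFiniteMeasure (volume.restrict S) := by
    constructor
    rw [Measure.restrict_apply_univ, hS, setOf_forall_mem_cube, volume_pi, Measure.pi_pi]
    exact ENNReal.prod_lt_top fun _ _ => volume_cube_lt_top
  set E := Real.exp ((pairs (∑ l, n l)).card * (-β / L ^ d * c 0)) with hE
  -- The displacements: `x` for the open trajectory, `0` for the loops. They do not depend on the
  -- base points, so only the plane waves in `y` are integrated over the cubes.
  set ξ : Fin (p + 1) → EuclideanSpace ℝ (Fin d) := Fin.cons x 0 with hξ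
  set T := timeIntegral n ħ m₀ β L ξ with hT
  set C := (cyclesMeasure ħ m₀ β L n 0 (fun l => 0 + ξ l)).real Set.univ with hC
  have hTC (a) : ‖T a‖ ≤ C := norm_timeIntegral_le n hħ hm₀ hβ hL hn ξ a
  set F : (Σ α : Multiplicities (∑ l, n l), Vectors d α) →
      (Fin p → EuclideanSpace ℝ (Fin d)) → ℂ := fun a y =>
    (E : ℂ) * ((coefficient β L c a : ℂ) *
      ((∏ l : Fin p, wave (latticeVec L⁻¹ (cycleMomentum n a.2 l.succ)) (y l)) * T a)) with hF
  have hFc (a) : Continuous (F a) := by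
    have := fun l : Fin p => continuous_wave (latticeVec L⁻¹ (cycleMomentum n a.2 l.succ))
    fun_prop
  have hFn (a y) : ‖F a y‖ ≤ C * (E * |coefficient β L c a|) := by
    rw [hF, norm_mul, norm_mul, norm_mul, norm_prod, Complex.norm_real, Complex.norm_real,
      Real.norm_eq_abs, Real.norm_eq_abs, abs_of_pos (Real.exp_pos _)]
    simp_rw [norm_wave]
    rw [Finset.prod_const_one, one_mul, ← mul_assoc, mul_comm]
    exact mul_le_mul_of_nonneg_right (hTC a) (by positivity)
  have hFi (a) : Integrable (F a) (volume.restrict S) :=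
    (integrable_const (C * (E * |coefficient β L c a|))).mono' (hFc a).aestronglyMeasurable
      (Filter.Eventually.of_forall (hFn a))
  have hs : Summable fun a => ∫ y in S, ‖F a y‖ := by
    refine Summable.of_nonneg_of_le (fun a => integral_nonneg fun _ => norm_nonneg _) (fun a => ?_)
      ((((summable_abs_coefficient (β := β) (L := L) hc (∑ l, n l)).mul_left E).mul_left C).mul_left
        ((volume.restrict S).real Set.univ))
    calc ∫ y in S, ‖F a y‖ ≤ ∫ _ in S, C * (E * |coefficient β L c a|) :=
          integral_mono (hFi a).norm (integrable_const _) (hFn a)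
      _ = _ := by rw [integral_const, smul_eq_mul]
  have h := (hasSum_integral_of_summable_integral_norm hFi hs).mul_left ((L : ℂ) ^ d)
  have hXY (y : Fin p → EuclideanSpace ℝ (Fin d)) :
      (fun l => (Fin.cons 0 y : Fin (p + 1) → EuclideanSpace ℝ (Fin d)) l + ξ l) =
        (Fin.cons x y : Fin (p + 1) → EuclideanSpace ℝ (Fin d)) := by
    ext1 l
    refine Fin.cases ?_ (fun i => ?_) l <;> simp [hξ]
  have h1 (y : Fin p → EuclideanSpace ℝ (Fin d)) := hasSum_integral_boltzmannFactor n hħ hm₀ hβ hL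
    hn u hc hV (Fin.cons 0 y) ξ
  simp_rw [hXY, Fin.prod_univ_succ (fun l => wave _ ((Fin.cons 0 _ :
    Fin (p + 1) → EuclideanSpace ℝ (Fin d)) l)), Fin.cons_zero, Fin.cons_succ, wave_zero_right,
    one_mul] at h1
  have h2 : (pathIntegral ħ m₀ β L u n x : ℂ) = (L : ℂ) ^ d * ∫ y in S, ∑' a, F a y := by
    rw [pathIntegral, Complex.ofReal_mul, Complex.ofReal_pow, ← integral_complex_ofReal]
    congr 1
    refine integral_congr_ae (Filter.Eventually.of_forall fun y => ?_)
    beta_reduce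
    rw [← integral_complex_ofReal]
    exact (h1 y).tsum_eq.symm
  rw [h2]
  refine h.congr_fun fun a => ?_
  rw [hF, integral_const_mul, integral_const_mul, integral_mul_const, integral_cubes_wave hL]

/-- Completing the square in `w` turns the weights into a constant times a Gaussian of inverse width
`λ_β √n_l`, centred at the time-weighted mean `b / n_l` of the wave vectors. -/
lemma summable_cycleWeight (hħ : 0 < ħ) (hm₀ : 0 < m₀) (hβ : 0 < β) (hL : 0 < L)
    (hn : ∀ l, 1 ≤ n l) {α : Multiplicities (∑ l, n l)} (z : Vectors d α) {τ : Times α}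
    (hτ : τ ∈ unitTimes α) (l : Fin (p + 1)) :
    Summable fun w : Fin d → ℤ => cycleWeight ħ m₀ β L n z τ l w := by
  have hn0 : (0 : ℝ) < n l := by exact_mod_cast hn l
  have hl := thermalLength_pos hħ hm₀ hβ
  set A := fun m => latticeVec L⁻¹ (waveVector n z l m) with hA
  set b : EuclideanSpace ℝ (Fin d) := ∑ m, waveTime n τ l m • A m with hb
  set D := ∑ m, ∑ m', min (waveTime n τ l m) (waveTime n τ l m') * inner ℝ (A m) (A m') with hD
  have h := (tsum_gaussian_wave hL (s := thermalLength ħ m₀ β * √(n l)) (by positivity)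
    (-((n l : ℝ)⁻¹ • b)) 0).2.1
  refine (h.mul_left (Real.exp (-(Real.pi * thermalLength ħ m₀ β ^ 2) *
    (D - (n l : ℝ)⁻¹ * ‖b‖ ^ 2)))).congr fun w => ?_
  have h0 : cycleWeight ħ m₀ β L n z τ l w = Real.exp (-(Real.pi * thermalLength ħ m₀ β ^ 2) *
      (n l * ‖latticeVec L⁻¹ w‖ ^ 2 -
        2 * ∑ m, waveTime n τ l m * inner ℝ (latticeVec L⁻¹ w) (A m) + D)) :=
    cycleWeight_eq n ħ m₀ β L z hτ l w
  rw [h0, ← Real.exp_add]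
  congr 1
  have h1 : ∑ m, waveTime n τ l m * inner ℝ (latticeVec L⁻¹ w) (A m) =
      inner ℝ (latticeVec L⁻¹ w) b := by
    rw [hb, inner_sum]
    exact Finset.sum_congr rfl fun m _ => (real_inner_smul_right _ _ _).symm
  rw [h1, ← sub_eq_add_neg, norm_sub_sq_real, norm_smul, real_inner_smul_right, mul_pow, mul_pow,
    Real.sq_sqrt hn0.le, norm_inv, Real.norm_of_nonneg hn0.le]
  field_simp
  ring

lemma cycleSum_zero {α : Multiplicities (∑ l, n l)} (z : Vectors d α) (τ : Times α) (l : Fin (p + 1)) :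
    cycleSum n ħ m₀ β L z τ l 0 = ((∑' w, cycleWeight ħ m₀ β L n z τ l w : ℝ) : ℂ) := by
  rw [cycleSum, Complex.ofReal_tsum]
  simp_rw [wave_zero_right, mul_one]

lemma re_wave_latticeVec (w : Fin d → ℤ) (x : EuclideanSpace ℝ (Fin d)) :
    (wave (latticeVec L⁻¹ w) x).re = Real.cos (2 * Real.pi / L * ∑ i, (w i : ℝ) * x i) := by
  rw [wave, Complex.exp_ofReal_mul_I_re, PiLp.inner_apply, Finset.mul_sum, Finset.mul_sum]
  congr 1
  refine Finset.sum_congr rfl fun i _ => ?_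
  simp [latticeVec]
  ring

lemma re_cycleSum (hħ : 0 < ħ) (hm₀ : 0 < m₀) (hβ : 0 < β) (hL : 0 < L)
    (hn : ∀ l, 1 ≤ n l) {α : Multiplicities (∑ l, n l)} (z : Vectors d α) {τ : Times α}
    (hτ : τ ∈ unitTimes α) (l : Fin (p + 1)) (x : EuclideanSpace ℝ (Fin d)) :
    (cycleSum n ħ m₀ β L z τ l x).re = ∑' w : Fin d → ℤ, cycleWeight ħ m₀ β L n z τ l w *
      Real.cos (2 * Real.pi / L * ∑ i, (w i : ℝ) * x i) := by
  rw [cycleSum, Complex.re_tsum]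
  · simp_rw [Complex.re_ofReal_mul, re_wave_latticeVec]
  · refine Summable.of_norm ?_
    simp_rw [norm_mul, norm_wave, mul_one, Complex.norm_real]
    exact (summable_cycleWeight n hħ hm₀ hβ hL hn z hτ l).norm

/-- The deltas do not depend on `τ`. If a loop has nonzero momentum, both sides vanish. Otherwise
the factor `L^d` and the `p` cube integrals cancel the `p + 1` factors `L^{-d}`, and only cycle `0`
is complex, so the real part falls on it alone. -/
lemma integral_bracket (hħ : 0 < ħ) (hm₀ : 0 < m₀) (hβ : 0 < β) (hL : 0 < L)
    (hn : ∀ l, 1 ≤ n l) (x : EuclideanSpace ℝ (Fin d))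
    (a : Σ α : Multiplicities (∑ l, n l), Vectors d α) :
    ∫ τ in unitTimes a.1, bracket ħ m₀ β L n x a.2 τ =
      ((L : ℂ) ^ d * ((∏ l : Fin p, if cycleMomentum n a.2 l.succ = 0 then (L : ℂ) ^ d else 0) *
        timeIntegral n ħ m₀ β L (Fin.cons x 0) a)).re := by
  obtain ⟨α, z⟩ := a
  have hLc : (L : ℂ) ≠ 0 := by exact_mod_cast hL.ne'
  have hshift {τ : Times α} (hτ : τ ∈ unitTimes α) (l) :
      initialShift n z τ l = -cycleMomentum n z l := initialShift_eq_sum_waveVector n z hτ l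
  by_cases h : ∀ l : Fin p, cycleMomentum n z l.succ = 0
  · simp only [h, if_true, Finset.prod_const, Finset.card_univ, Fintype.card_fin]
    rw [timeIntegral, ← mul_assoc, ← pow_succ', ← integral_const_mul]
    have hi := (integrableOn_prod_cycleSum n hħ hm₀ hβ hL hn (Fin.cons x 0) z).const_mul
      (((L : ℂ) ^ d) ^ (p + 1))
    refine Eq.trans ?_ (integral_re hi)
    refine setIntegral_congr_fun (measurableSet_unitTimes α) fun τ hτ => ?_
    -- Cycle `0` has no cube integral; its delta is satisfied by conservation of momentum.
    have h0 : cycleMomentum n z 0 = 0 := by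
      have h1 := sum_initialShift n z hτ
      rw [Fin.sum_univ_succ] at h1
      simp_rw [hshift hτ, h] at h1
      simpa using h1
    have h2 : ((L : ℂ) ^ d) ^ (p + 1) * ∏ l : Fin (p + 1), ((L : ℂ) ^ d)⁻¹ *
        cycleSum n ħ m₀ β L z τ l ((Fin.cons x 0 : Fin (p + 1) → EuclideanSpace ℝ (Fin d)) l) =
        cycleSum n ħ m₀ β L z τ 0 x *
          ((∏ l : Fin p, ∑' w, cycleWeight ħ m₀ β L n z τ l.succ w : ℝ) : ℂ) := by
      rw [Finset.prod_mul_distrib, Finset.prod_const, Finset.card_univ, Fintype.card_fin,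
        ← mul_assoc, ← mul_pow, mul_inv_cancel₀ (pow_ne_zero _ hLc), one_pow, one_mul,
        Fin.prod_univ_succ, Complex.ofReal_prod]
      simp only [Fin.cons_zero, Fin.cons_succ, Pi.zero_apply, cycleSum_zero]
    beta_reduce
    rw [h2]
    simp only [bracket, hshift hτ, h, h0, neg_zero, if_true, one_mul, RCLike.re_eq_complex_re,
      Complex.re_mul_ofReal, re_cycleSum n hħ hm₀ hβ hL hn z hτ]
  · push Not at h
    obtain ⟨l, hl⟩ := h
    rw [Finset.prod_eq_zero (Finset.mem_univ l) (if_neg hl), zero_mul, mul_zero, Complex.zero_re]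
    refine (setIntegral_congr_fun (measurableSet_unitTimes α) fun τ hτ => ?_).trans
      (integral_zero _ _)
    rw [bracket, Finset.prod_eq_zero (Finset.mem_univ l), mul_zero]
    rw [if_neg, zero_mul]
    rw [hshift hτ]
    simpa using hl

/-- The expansion of the path integral, as a single sum over the multiplicities and the vectors. -/
theorem hasSum_pathIntegral (hħ : 0 < ħ) (hm₀ : 0 < m₀) (hβ : 0 < β) (hL : 0 < L)
    (hn : ∀ l, 1 ≤ n l) (u : EuclideanSpace ℝ (Fin d) → ℝ) (hu_even : ∀ x, u (-x) = u x)
    (hu : Integrable u)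
    (hu_lattice : Summable fun z : Fin d → ℤ =>
      ‖FourierTransform.fourier (fun x => (u x : ℂ)) (latticeVec L⁻¹ z)‖)
    (x : EuclideanSpace ℝ (Fin d)) :
    HasSum (fun a : Σ α : Multiplicities (∑ l, n l), Vectors d α =>
      Real.exp (-(β * fourierU u 0 * ((∑ l, n l : ℕ) : ℝ) * (((∑ l, n l : ℕ) : ℝ) - 1) /
          (2 * L ^ d))) *
        ((∏ e, 1 / ((a.1 e).factorial : ℝ)) * seriesTerm ħ m₀ β L u n x a.1 a.2))
      (pathIntegral ħ m₀ β L u n x) := by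
  set c : (Fin d → ℤ) → ℝ := fun z => fourierU u (latticeVec L⁻¹ z) with hc'
  have hfc (k : EuclideanSpace ℝ (Fin d)) :
      FourierTransform.fourier (fun x => (u x : ℂ)) k = (fourierU u k : ℂ) :=
    fourier_eq_ofReal hu_even k
  have hc : Summable fun z => |c z| := hu_lattice.congr fun z => by
    rw [hfc, Complex.norm_real, Real.norm_eq_abs]
  have hV : ∀ᵐ x, (periodized L u x : ℂ) = seriesPotential L c x := by
    filter_upwards [ae_periodization_eq_fourierSeries (f := fun x => (u x : ℂ)) hL hu.ofReal
      hu_lattice] with x hx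
    rw [periodized, Complex.ofReal_tsum, hx, seriesPotential]
    exact congrArg _ (tsum_congr fun z => by rw [hfc])
  set E := Real.exp (-(β * fourierU u 0 * ((∑ l, n l : ℕ) : ℝ) * (((∑ l, n l : ℕ) : ℝ) - 1) /
    (2 * L ^ d))) with hE
  have hE2 : Real.exp ((pairs (∑ l, n l)).card * (-β / L ^ d * c 0)) = E := by
    have hc0 : c 0 = fourierU u 0 := by
      rw [hc']
      beta_reduce
      rw [latticeVec_zero]
    rw [hE, card_pairs, hc0]
    congr 1
    field_simp
  -- The path integral and all coefficients are real, so real parts affect only the time integrals.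
  have h := Complex.hasSum_re (hasSum_pathIntegral_complex n hħ hm₀ hβ hL hn u hc hV x)
  rw [Complex.ofReal_re] at h
  refine h.congr_fun fun a => ?_
  rw [hE2, seriesTerm, integral_bracket n hħ hm₀ hβ hL hn x a, coefficient,
      Finset.prod_mul_distrib, mul_left_comm ((L : ℂ) ^ d) (E : ℂ), Complex.re_ofReal_mul,
      mul_left_comm ((L : ℂ) ^ d) (Complex.ofReal _), Complex.re_ofReal_mul, mul_assoc]

end expansion

end TorusBose

theorem lemma1 {d p : ℕ} (ħ m₀ β L : ℝ) (hħ : 0 < ħ) (hm₀ : 0 < m₀) (hβ : 0 < β) (hL : 0 < L)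
    (u : EuclideanSpace ℝ (Fin d) → ℝ) (hu_even : ∀ x, u (-x) = u x)
    (hu : MeasureTheory.Integrable u)
    (hu_fourier : MeasureTheory.Integrable (FourierTransform.fourier fun x => (u x : ℂ)))
    (hu_lattice : Summable fun z : Fin d → ℤ =>
      ‖FourierTransform.fourier (fun x => (u x : ℂ)) (latticeVec L⁻¹ z)‖)
    (n : Fin (p + 1) → ℕ) (hn : ∀ l, 1 ≤ n l) (x : EuclideanSpace ℝ (Fin d)) :
    (∀ α : Multiplicities (∑ l, n l), Summable (seriesTerm ħ m₀ β L u n x α)) ∧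
    HasSum
      (fun α : Multiplicities (∑ l, n l) =>
        Real.exp (-(β * fourierU u 0 * ((∑ l, n l : ℕ) : ℝ) * (((∑ l, n l : ℕ) : ℝ) - 1) /
          (2 * L ^ d))) *
        ((∏ e, 1 / ((α e).factorial : ℝ)) *
          ∑' z : Vectors d α, seriesTerm ħ m₀ β L u n x α z))
      (pathIntegral ħ m₀ β L u n x) ∧
    (∀ (α : Multiplicities (∑ l, n l)) (z : Vectors d α), ∀ τ ∈ unitTimes α, ∀ l,
      initialShift n z τ l =
        - ∑ j ∈ Finset.Icc 1 (countBefore n l), ∑ k ∈ cycle n l, totalSum z j k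
        + ∑ j ∈ cycle n l, ∑ k ∈ Finset.Icc (countUpTo n l + 1) (∑ l, n l), totalSum z j k) := by
  have h := hasSum_pathIntegral n hħ hm₀ hβ hL hn u hu_even hu hu_lattice x
  -- Nonzero factorials allow summability over the vectors for fixed `α` to be read off from the
  -- joint sum.
  have hk (α : Multiplicities (∑ l, n l)) : ∏ e, 1 / ((α e).factorial : ℝ) ≠ 0 := by
    refine Finset.prod_ne_zero_iff.2 fun e _ => ?_
    have := Nat.factorial_pos (α e)
    positivity
  have h2 := summable_and_hasSum_sigma_mul (k := fun α : Multiplicities (∑ l, n l) =>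
    ∏ e, 1 / ((α e).factorial : ℝ)) (f := seriesTerm ħ m₀ β L u n x) (Real.exp_pos _).ne' hk h
  exact ⟨h2.1, h2.2, fun α z τ hτ l => initialShift_eq_totalSum n z hτ l⟩
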